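/- Let $(M,g)$ be a time-oriented smooth Lorentzian manifold without boundary (signature $(-,+,\dots,+)$), let $\Omega\subseteq M$ be a region, $p\in\Omega$, and let $t$ be a smooth time function on (a neighbourhood of) $\Omega$, that is, $dt$ is timelike and $t$ increases towards the future, normalized by $t(p)=0$. Let $n=(-g(dt,dt))^{-1/2}$ be the lapse, $T$ the future-directed unit normal of the level sets of $t$, defined by $g(T,\cdot)=-n\,dt$, let $g_T=g+2\,g(T,\cdot)\otimes g(T,\cdot)$ be the reference Riemannian metric, and $\pi=\mathcal L_T g$ the deformation tensor. Let $\overline K_n>0$, $\overline K_{Rm}\in\mathbb R$ and $K_\pi\ge 0$ be constants such that * $n\le \overline K_n$ on $\Omega$; * $\langle Rm(X,Y)Y,X\rangle\le \overline K_{Rm}\,\langle Y,Y\rangle$ for every vector $X$ tangent to a past-directed null geodesic from $p$ contained in $\Omega$ and normalized by $\langle T,X\rangle=1$, and every $Y\perp X$; * $|\pi(V,V)|\le K_\pi\, g_T(V,V)$ for all $V\in T_qM$, $q\in \Omega$. All geodesics below are past-directed null geodesics from $p$ contained in $\Omega$. 1. If $\overline K_{Rm}\le 0$, then no past-directed null geodesic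 from $p$ contained in $\Omega$ has a point conjugate to $p$ along it. 2. If $\overline K_{Rm}>0$, put $$\iota:=\begin{cases}\dfrac{1}{\overline K_n K_\pi}\,\log\!\left(\dfrac{\sqrt{\overline K_{Rm}}}{\sqrt{\overline K_{Rm}}+\pi K_\pi}\right), & K_\pi>0,\\[2ex] -\dfrac{1}{\overline K_n}\,\dfrac{\pi}{\sqrt{\overline K_{Rm}}}, & K_\pi=0\end{cases}$$ (here the factor $\pi$ in front of $K_\pi$ and in the second line is the number $\pi$). Then $\iota<0$; no past-directed null geodesic from $p$ contained in $\Omega$ has a point $q$ conjugate to $p$ along it with $t(q)>\iota$; and the past null conjugacy radius of $p$ with respect to $t$ satisfies $$\mathrm{NullConj}^-(p)\ \ge\ |\iota| .$$ Here $\mathrm{NullConj}^-(p)\in[0,\infty]$ is the supremum of all $|t_0|$, $t_0\le 0$, such that the restriction of $\exp_p$ to the pointed past null cone of $T_pM$ is a local diffeomorphism onto its image at every point of $N^-_{t_0}(p)$, where $N^-_{t_0}(p)$ is the set of past-directed null vectors $V\in T_pM\setminus\{0\}$ whose radial geodesic $s\mapsto\exp_p(sV)$, $0\le s\le 1$, exists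 and stays in $\Omega$ and satisfies $t_0\le t(\exp_p V)\le 0$. -/

import Mathlib

open Set
open scoped Manifold ContDiff ENNReal Topology

noncomputable section

namespace NullConjugacy

/-! ### Lorentzian metrics and their Levi-Civita calculus

`M` is a manifold without boundary modelled on the finite-dimensional real vector space `E`.
In Mathlib the tangent space `TangentSpace 𝓘(ℝ, E) x` is the vector space `E`, a vector being
identified with its components in the preferred chart `extChartAt 𝓘(ℝ, E) x` at `x`. All local
formulas below are evaluated in the preferred chart at the point in question. -/

/-- A smooth Lorentzian metric on `M` (signature `(-,+,…,+)`): a smooth field of symmetric bilinear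
forms on the tangent spaces such that every tangent space contains a timelike vector on whose
orthogonal complement the form is positive definite. -/
structure LorentzianMetric (E M : Type*) [NormedAddCommGroup E] [NormedSpace ℝ E]
    [TopologicalSpace M] [ChartedSpace E M] [IsManifold 𝓘(ℝ, E) ∞ M] where
  inner (x : M) : TangentSpace 𝓘(ℝ, E) x →L[ℝ] TangentSpace 𝓘(ℝ, E) x →L[ℝ] ℝ
  symm (x : M) (v w : TangentSpace 𝓘(ℝ, E) x) : inner x v w = inner x w v
  lorentzian (x : M) : ∃ v : TangentSpace 𝓘(ℝ, E) x, inner x v v < 0 ∧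
    ∀ w : TangentSpace 𝓘(ℝ, E) x, inner x v w = 0 → w ≠ 0 → 0 < inner x w w
  contMDiff : ContMDiff 𝓘(ℝ, E) (𝓘(ℝ, E).prod 𝓘(ℝ, E →L[ℝ] E →L[ℝ] ℝ)) ∞
    (fun x ↦ Bundle.TotalSpace.mk' (E →L[ℝ] E →L[ℝ] ℝ)
      (E := fun x ↦ TangentSpace 𝓘(ℝ, E) x →L[ℝ] TangentSpace 𝓘(ℝ, E) x →L[ℝ] ℝ) x (inner x))

variable {E M : Type*} [NormedAddCommGroup E] [NormedSpace ℝ E]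
  [TopologicalSpace M] [ChartedSpace E M] [IsManifold 𝓘(ℝ, E) ∞ M]

/-- The components of a vector field `T` in the chart at `x₀`, as a function on the chart. -/
def coordField (T : ∀ x : M, TangentSpace 𝓘(ℝ, E) x) (x₀ : M) (y : E) : E :=
  mfderiv 𝓘(ℝ, E) 𝓘(ℝ, E) (extChartAt 𝓘(ℝ, E) x₀) ((extChartAt 𝓘(ℝ, E) x₀).symm y)
    (T ((extChartAt 𝓘(ℝ, E) x₀).symm y))

/-- The velocity `γ'(s)` of a curve. -/
def velocity (γ : ℝ → M) (s : ℝ) : TangentSpace 𝓘(ℝ, E) (γ s) :=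
  mfderiv 𝓘(ℝ, ℝ) 𝓘(ℝ, E) γ s (1 : ℝ)

namespace LorentzianMetric

variable (g : LorentzianMetric E M)

/-- The matrix of metric components `g_{ij}` in the chart at `x₀`, as a function on the chart: the
pullback of the metric by the inverse of the chart. -/
def coordMetric (x₀ : M) (y : E) : E →L[ℝ] E →L[ℝ] ℝ :=
  let B : E →L[ℝ] E →L[ℝ] ℝ := g.inner ((extChartAt 𝓘(ℝ, E) x₀).symm y)
  let A : E →L[ℝ] E := mfderiv 𝓘(ℝ, E) 𝓘(ℝ, E) (extChartAt 𝓘(ℝ, E) x₀).symm y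
  B.bilinearComp A A

/-- The Christoffel symbols `Γ(v, w)` of the Levi-Civita connection in the chart at `x₀`:
`g(Γ(v, w), z) = ½ (∂_v g(w, z) + ∂_w g(v, z) - ∂_z g(v, w))`. -/
def christoffel (x₀ : M) (y v w : E) : E :=
  (g.coordMetric x₀ y).inverse ((1 / 2 : ℝ) •
    (fderiv ℝ (g.coordMetric x₀) y v w + fderiv ℝ (g.coordMetric x₀) y w v
      - ((fderiv ℝ (g.coordMetric x₀) y).flip v).flip w))

/-- The Riemann curvature tensor `Rm(X, Y) Z = ∇_X ∇_Y Z - ∇_Y ∇_X Z - ∇_{[X, Y]} Z` at `x`. -/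
def curvature (x : M) (X Y Z : TangentSpace 𝓘(ℝ, E) x) : TangentSpace 𝓘(ℝ, E) x :=
  let y : E := extChartAt 𝓘(ℝ, E) x x
  let Γ : E → E → E → E := g.christoffel x
  (fderiv ℝ (fun y' ↦ Γ y' Y Z) y X - fderiv ℝ (fun y' ↦ Γ y' X Z) y Y
    + Γ y X (Γ y Y Z) - Γ y Y (Γ y X Z) : E)

/-- The covariant derivative `∇_{γ'} V` at parameter `s` of a vector field `V` along a curve `γ`. -/
def covDerivAlong (γ : ℝ → M) (V : ∀ s : ℝ, TangentSpace 𝓘(ℝ, E) (γ s)) (s : ℝ) :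
    TangentSpace 𝓘(ℝ, E) (γ s) :=
  (deriv (fun r : ℝ ↦
      (mfderiv 𝓘(ℝ, E) 𝓘(ℝ, E) (extChartAt 𝓘(ℝ, E) (γ s)) (γ r) (V r) : E)) s
    + g.christoffel (γ s) (extChartAt 𝓘(ℝ, E) (γ s) (γ s)) (velocity γ s) (V s) : E)

/-- `γ` is an (affinely parametrized) geodesic on the parameter set `S`. -/
def IsGeodesicOn (γ : ℝ → M) (S : Set ℝ) : Prop :=
  ∀ s ∈ S, ContMDiffAt 𝓘(ℝ, ℝ) 𝓘(ℝ, E) 2 γ s ∧ g.covDerivAlong γ (velocity γ) s = 0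

/-- `J` is a Jacobi field along `γ` on `S`: `J'' + Rm(J, γ') γ' = 0`. -/
def IsJacobiFieldOn (γ : ℝ → M) (J : ∀ s : ℝ, TangentSpace 𝓘(ℝ, E) (γ s)) (S : Set ℝ) : Prop :=
  ∀ s ∈ S, ContMDiffAt 𝓘(ℝ, ℝ) 𝓘(ℝ, E).tangent 2
      (fun r ↦ (⟨γ r, J r⟩ : TangentBundle 𝓘(ℝ, E) M)) s ∧
    g.covDerivAlong γ (g.covDerivAlong γ J) s
      + g.curvature (γ s) (J s) (velocity γ s) (velocity γ s) = 0

/-- `γ(b)` is conjugate to `γ(0)` along the geodesic `γ`: some Jacobi field along `γ|[0,b]`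
that does not vanish identically vanishes at `0` and at `b`. -/
def IsConjugateAlong (γ : ℝ → M) (b : ℝ) : Prop :=
  ∃ J : ∀ s : ℝ, TangentSpace 𝓘(ℝ, E) (γ s), g.IsJacobiFieldOn γ J (Icc 0 b) ∧
    J 0 = 0 ∧ J b = 0 ∧ ∃ s ∈ Icc 0 b, J s ≠ 0

/-- `γ` is a geodesic on `[0,b]` with `γ(0) = p` and `γ'(0) = V`. -/
def IsGeodesicFrom (p : M) (V : TangentSpace 𝓘(ℝ, E) p) (γ : ℝ → M) (b : ℝ) : Prop :=
  g.IsGeodesicOn γ (Icc 0 b) ∧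
    (⟨γ 0, velocity γ 0⟩ : TangentBundle 𝓘(ℝ, E) M) = ⟨p, V⟩

open Classical in
/-- The exponential map `exp_p V = γ_V(1)`, where `γ_V` is the geodesic with initial velocity `V`
(with the irrelevant value `p` where that geodesic does not exist up to parameter `1`). -/
def expMap (p : M) (V : TangentSpace 𝓘(ℝ, E) p) : M :=
  if h : ∃ γ : ℝ → M, g.IsGeodesicFrom p V γ 1 then h.choose 1 else p

/-! ### The foliation by a time function `t` -/

/-- The gradient of a function, `g(∇t, ·) = dt`. -/
def grad (t : M → ℝ) (x : M) : TangentSpace 𝓘(ℝ, E) x :=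
  (g.inner x).inverse (mfderiv 𝓘(ℝ, E) 𝓘(ℝ, ℝ) t x)

/-- `g(dt, dt)`, the square of the one-form `dt` in the metric induced on one-forms. -/
def normSqDiff (t : M → ℝ) (x : M) : ℝ :=
  g.inner x (g.grad t x) (g.grad t x)

/-- The lapse function `n = (-g(dt, dt))^{-1/2}`. -/
def lapse (t : M → ℝ) (x : M) : ℝ :=
  (Real.sqrt (-g.normSqDiff t x))⁻¹

/-- The future unit normal `T` of the foliation, `g(T, ·) = - n dt`. -/
def unitNormal (t : M → ℝ) (x : M) : TangentSpace 𝓘(ℝ, E) x :=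
  -(g.lapse t x • g.grad t x)

/-- The reference Riemannian metric `g_T = g + 2 g(T, ·) ⊗ g(T, ·)`. -/
def refMetric (t : M → ℝ) (x : M) (v w : TangentSpace 𝓘(ℝ, E) x) : ℝ :=
  g.inner x v w + 2 * (g.inner x (g.unitNormal t x) v * g.inner x (g.unitNormal t x) w)

/-- The Lie derivative `(L_T g)(v, w)` of the metric at `x`; in a chart,
`(L_T g)_{ij} = T^k ∂_k g_{ij} + g_{kj} ∂_i T^k + g_{ik} ∂_j T^k`. -/
def lieDerivMetric (T : ∀ x : M, TangentSpace 𝓘(ℝ, E) x) (x : M)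
    (v w : TangentSpace 𝓘(ℝ, E) x) : ℝ :=
  let y : E := extChartAt 𝓘(ℝ, E) x x
  let G : E → E →L[ℝ] E →L[ℝ] ℝ := g.coordMetric x
  let τ : E → E := coordField T x
  fderiv ℝ G y (τ y) v w + G y (fderiv ℝ τ y v) w + G y v (fderiv ℝ τ y w)

/-- The deformation tensor `π = L_T g` of the foliation. -/
def deformation (t : M → ℝ) (x : M) (v w : TangentSpace 𝓘(ℝ, E) x) : ℝ :=
  g.lieDerivMetric (g.unitNormal t) x v w

/-- A time orientation: a continuous timelike vector field, declared future directed. -/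
structure TimeOrientation where
  field (x : M) : TangentSpace 𝓘(ℝ, E) x
  continuous : Continuous (fun x ↦ (⟨x, field x⟩ : TangentBundle 𝓘(ℝ, E) M))
  timelike (x : M) : g.inner x (field x) (field x) < 0

variable {g} in
/-- `V` is a (nonzero) past-directed null vector. -/
def TimeOrientation.IsPastNull (o : g.TimeOrientation) (x : M) (V : TangentSpace 𝓘(ℝ, E) x) :
    Prop :=
  V ≠ 0 ∧ g.inner x V V = 0 ∧ 0 < g.inner x (o.field x) V

variable {g} in
/-- `t` is a smooth time function near every point of the region `Ω`: its differential is timelike,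
and `t` increases towards the future. -/
def TimeOrientation.IsTimeFunctionOn (o : g.TimeOrientation) (t : M → ℝ) (Ω : Set M) : Prop :=
  ∀ x ∈ Ω, ContMDiffAt 𝓘(ℝ, E) 𝓘(ℝ, ℝ) ∞ t x ∧ g.normSqDiff t x < 0 ∧
    (0 : ℝ) < mfderiv 𝓘(ℝ, E) 𝓘(ℝ, ℝ) t x (o.field x)

variable {g} in
/-- `γ`, restricted to `[0,b]`, is a past-directed null geodesic from `p` that stays in `Ω`. -/
def TimeOrientation.IsPastNullGeodesic (o : g.TimeOrientation) (Ω : Set M) (p : M)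
    (γ : ℝ → M) (b : ℝ) : Prop :=
  g.IsGeodesicOn γ (Icc 0 b) ∧ γ 0 = p ∧ o.IsPastNull (γ 0) (velocity γ 0) ∧
    ∀ s ∈ Icc 0 b, γ s ∈ Ω

/-! ### The bounds on the geometry -/

/-- Bound on the lapse. -/
def LapseBound (t : M → ℝ) (Ω : Set M) (Kn : ℝ) : Prop :=
  ∀ x ∈ Ω, g.lapse t x ≤ Kn

/-- Bound on the deformation tensor. -/
def DeformationBound (t : M → ℝ) (Ω : Set M) (Kπ : ℝ) : Prop :=
  ∀ x ∈ Ω, ∀ V : TangentSpace 𝓘(ℝ, E) x, |g.deformation t x V V| ≤ Kπ * g.refMetric t x V V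

variable {g} in
/-- Upper bound on the null curvature operator along the past null geodesics from `p`:
`⟨Rm(X, Y) Y, X⟩ ≤ K ⟨Y, Y⟩` for `Y ⊥ X`, where `X` is the tangent vector of the geodesic
normalized by `⟨T, X⟩ = 1`. -/
def TimeOrientation.NullCurvatureBound (o : g.TimeOrientation) (t : M → ℝ) (Ω : Set M) (p : M)
    (K : ℝ) : Prop :=
  ∀ (γ : ℝ → M) (b : ℝ), 0 < b → o.IsPastNullGeodesic Ω p γ b → ∀ s ∈ Icc 0 b,
    ∀ X Y : TangentSpace 𝓘(ℝ, E) (γ s), (∃ c : ℝ, X = c • velocity γ s) →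
      g.inner (γ s) (g.unitNormal t (γ s)) X = 1 → g.inner (γ s) X Y = 0 →
      g.inner (γ s) (g.curvature (γ s) X Y Y) X ≤ K * g.inner (γ s) Y Y

/-! ### The past null conjugacy radius -/

variable {g} in
/-- The pointed past null cone in the tangent space at `p`. -/
def TimeOrientation.pastNullCone (o : g.TimeOrientation) (p : M) : Set E :=
  {V : E | o.IsPastNull p V}

variable {g} in
/-- The part `N⁻_{t₀}(p)` of the pointed past null cone consisting of the vectors `V` whose radial
geodesic exists in `Ω` up to parameter `1` and for which `t₀ ≤ t(exp_p V) ≤ 0`. -/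
def TimeOrientation.truncatedCone (o : g.TimeOrientation) (t : M → ℝ) (Ω : Set M) (p : M)
    (t₀ : ℝ) : Set E :=
  {V : E | o.IsPastNull p V ∧
    (∃ γ : ℝ → M, g.IsGeodesicFrom p V γ 1 ∧ ∀ s ∈ Icc (0 : ℝ) 1, γ s ∈ Ω) ∧
    t (g.expMap p V) ∈ Icc t₀ 0}

end LorentzianMetric

/-- The restriction of `f` to `N ⊆ E` is, near `v`, a smooth diffeomorphism onto its image: on a
neighbourhood of `v` the map `f` is smooth and `f|N` has an inverse which extends to a
smooth map on a neighbourhood of the image. -/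
def IsLocalDiffeoOntoImageAt (f : E → M) (N : Set E) (v : E) : Prop :=
  ∃ (W : Set E) (O : Set M) (h : M → E), IsOpen W ∧ v ∈ W ∧ IsOpen O ∧
    ContMDiffOn 𝓘(ℝ, E) 𝓘(ℝ, E) ∞ f W ∧ ContMDiffOn 𝓘(ℝ, E) 𝓘(ℝ, E) ∞ h O ∧
    ∀ u ∈ W ∩ N, f u ∈ O ∧ h (f u) = u

/-- The past null conjugacy radius of `p` with respect to the foliation: the supremum of all `|t₀|`,
`t₀ ≤ 0`, such that the restriction of `exp_p` to the past null cone is a local diffeomorphism onto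
its image at every point of `N⁻_{t₀}(p)`. -/
def nullConjugacyRadius {g : LorentzianMetric E M} (o : g.TimeOrientation) (t : M → ℝ) (Ω : Set M)
    (p : M) : ℝ≥0∞ :=
  sSup {r : ℝ≥0∞ | ∃ t₀ : ℝ, t₀ ≤ 0 ∧ r = ENNReal.ofReal |t₀| ∧
    ∀ v ∈ o.truncatedCone t Ω p t₀,
      IsLocalDiffeoOntoImageAt (fun V : E ↦ g.expMap p V) (o.pastNullCone p) v}

/-- The (negative) value of the time function down to which there are no conjugate points. -/
def conjugacyTime (Kn KRm Kπ : ℝ) : ℝ :=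
  if 0 < Kπ then
    1 / (Kn * Kπ) * Real.log (Real.sqrt KRm / (Real.sqrt KRm + Real.pi * Kπ))
  else -(1 / Kn * (Real.pi / Real.sqrt KRm))

end NullConjugacy

end

/-!
The proof has two halves: a comparison theorem for Jacobi fields along null geodesics, and the
correspondence between critical points of `exp_p` and conjugate points.

Along a past-directed null geodesic `γ` from `p` put `w = ⟨T, γ'⟩ > 0`. Since `∇_{γ'} γ' = 0`, its
derivative is `½ π(γ', γ')`, and `g_T(γ', γ') = 2 w²`, so `|w'| ≤ K_π w²`; moreover
`(t ∘ γ)' = -w / n`. Thus `w` stays comparable to its maximum `Λ`, and as long as `t(γ(b))` is above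
the conjugacy time the parameter length satisfies `√K Λ b < π` (`exists_frequency_bound`). The null
curvature in the affine parametrization is at most `K Λ²`; for `K ≤ 0` it is at most `0` and no
restriction on `b` is needed. For a Jacobi field `J` vanishing at both
ends, `⟨J, γ'⟩` is affine and hence zero, so that `⟨J, J⟩ ≥ 0`; the index form argument with a
shifted cotangent (`eq_zero_of_index_form`) gives `⟨J, J⟩ = 0`. Then `J = f γ'`, the Jacobi equation
reads `f'' = 0`, and `J = 0` (`not_isConjugateAlong`).

For the radius, the geodesics from `p` are embedded in a family depending smoothly on the initial
velocity (`exists_isGeodesicFamily`), obtained by continuing local flows of the geodesic equation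
in charts along a given geodesic. This makes `exp_p` smooth, and the variation field of the family
in a direction in the kernel of its differential is a nonzero Jacobi field vanishing at both ends
(`exists_smooth_expMap`). The first half excludes this, and the inverse function theorem applies
(`isLocalDiffeoOntoImageAt_of_mfderiv`).

Smooth dependence of flows on the initial data is derived from the inverse function theorem on
the space of continuous curves (`exists_smooth_localFlow`).
-/

noncomputable section

namespace NullConjugacy

/-! ### Smooth dependence of solutions of ordinary differential equations -/

section Superposition

variable {K : Type*} [TopologicalSpace K] [CompactSpace K]

/-- Pointwise evaluation `(A, β) ↦ (k ↦ A k (β k))` on spaces of continuous functions, as a bounded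
bilinear map. -/
def pointwiseApply (K : Type*) [TopologicalSpace K] [CompactSpace K] (F G : Type*)
    [NormedAddCommGroup F] [NormedSpace ℝ F] [NormedAddCommGroup G] [NormedSpace ℝ G] :
    C(K, F →L[ℝ] G) →L[ℝ] C(K, F) →L[ℝ] C(K, G) :=
  LinearMap.mkContinuous₂
    (LinearMap.mk₂ ℝ
      (fun (A : C(K, F →L[ℝ] G)) (β : C(K, F)) ↦
        (⟨fun k ↦ A k (β k), A.continuous.clm_apply β.continuous⟩ : C(K, G)))
      (fun _ _ _ ↦ by ext; simp) (fun _ _ _ ↦ by ext; simp)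
      (fun _ _ _ ↦ by ext; simp) (fun _ _ _ ↦ by ext; simp)) 1
    (fun A β ↦ by
      rw [one_mul, ContinuousMap.norm_le _ (by positivity)]
      intro k
      exact ((A k).le_opNorm _).trans
        (mul_le_mul (A.norm_coe_le_norm k) (β.norm_coe_le_norm k) (norm_nonneg (β k))
          (norm_nonneg A)))

@[simp]
lemma pointwiseApply_apply {F G : Type*}
    [NormedAddCommGroup F] [NormedSpace ℝ F] [NormedAddCommGroup G] [NormedSpace ℝ G]
    (A : C(K, F →L[ℝ] G)) (β : C(K, F)) (k : K) : pointwiseApply K F G A β k = A k (β k) := rfl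

lemma hasFDerivAt_superposition {F G : Type*}
    [NormedAddCommGroup F] [NormedSpace ℝ F] [NormedAddCommGroup G] [NormedSpace ℝ G]
    (f : C(F, G)) (f' : C(F, F →L[ℝ] G)) (hf : ∀ x, HasFDerivAt f (f' x) x) (α : C(K, F)) :
    HasFDerivAt (fun a : C(K, F) ↦ f.comp a) (pointwiseApply K F G (f'.comp α)) α := by
  rw [hasFDerivAt_iff_isLittleO_nhds_zero, Asymptotics.isLittleO_iff]
  intro c hc
  have hcomp : IsCompact (range α) := isCompact_range α.continuous
  have := hcomp.uniformContinuousAt_of_continuousAt f' (fun a _ ↦ f'.continuous.continuousAt)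
    (Metric.dist_mem_uniformity hc)
  obtain ⟨δ, hδ, hδ'⟩ := Metric.mem_uniformity_dist.1 this
  filter_upwards [Metric.ball_mem_nhds (0 : C(K, F)) hδ] with h hh
  rw [ContinuousMap.norm_le _ (by positivity)]
  intro k
  have hk : ‖h k‖ < δ := (h.norm_coe_le_norm k).trans_lt (by simpa using hh)
  have key := (convex_ball (α k) δ).norm_image_sub_le_of_norm_hasFDerivWithin_le'
    (f := f) (f' := f') (φ := f' (α k)) (C := c) (x := α k) (y := α k + h k)
    (fun x _ ↦ (hf x).hasFDerivWithinAt)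
    (fun x hx ↦ by
      have := hδ' (a := α k) (b := x) (by rw [dist_comm]; exact hx) (mem_range_self k)
      rw [← dist_eq_norm, dist_comm]
      exact le_of_lt this)
    (Metric.mem_ball_self hδ) (by simpa [dist_eq_norm] using hk)
  simp only [add_sub_cancel_left] at key
  calc _ = ‖f (α k + h k) - f (α k) - f' (α k) (h k)‖ := by simp
    _ ≤ c * ‖h k‖ := key
    _ ≤ c * ‖h‖ := by gcongr; exact h.norm_coe_le_norm k

universe u in
lemma contDiff_superposition_nat {F : Type u} [NormedAddCommGroup F] [NormedSpace ℝ F] (n : ℕ) :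
    ∀ {G : Type u} [NormedAddCommGroup G] [NormedSpace ℝ G] (f : C(F, G)), ContDiff ℝ n f →
      ContDiff ℝ n (fun a : C(K, F) ↦ f.comp a) := by
  induction n with
  | zero =>
    intro G _ _ f _
    exact contDiff_zero.2 (ContinuousMap.continuous_postcomp f)
  | succ n ih =>
    intro G _ _ f hf
    obtain ⟨f', hf', hff'⟩ := contDiff_succ_iff_hasFDerivAt.1 (by exact_mod_cast hf)
    have := contDiff_succ_iff_hasFDerivAt (𝕜 := ℝ) (n := n)
      (f := fun a : C(K, F) ↦ f.comp a)
    push_cast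
    rw [this]
    have h1 := ContDiff.comp (pointwiseApply K F G).contDiff
      (ih (⟨f', hf'.continuous⟩ : C(F, F →L[ℝ] G)) hf')
    exact ⟨fun a ↦ pointwiseApply K F G ((⟨f', hf'.continuous⟩ : C(F, F →L[ℝ] G)).comp a), h1,
      fun a ↦ hasFDerivAt_superposition f ⟨f', hf'.continuous⟩ hff' a⟩

/-- The superposition operator `α ↦ f ∘ α` of a smooth function is smooth on the Banach space of
continuous functions. -/
lemma contDiff_superposition {F : Type*} [NormedAddCommGroup F] [NormedSpace ℝ F]
    (f : C(F, F)) (hf : ContDiff ℝ ∞ f) : ContDiff ℝ ∞ (fun a : C(K, F) ↦ f.comp a) :=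
  contDiff_infty.2 fun n ↦ contDiff_superposition_nat n f (contDiff_infty.1 hf n)

end Superposition

section LocalFlow

variable {F : Type*} [NormedAddCommGroup F] [NormedSpace ℝ F]

/-- The primitive `τ ↦ ∫₀^τ α` of a continuous function on `[0,1]`, as a bounded operator. -/
def primitive (F : Type*) [NormedAddCommGroup F] [NormedSpace ℝ F] [CompleteSpace F] :
    C(Icc (0 : ℝ) 1, F) →L[ℝ] C(Icc (0 : ℝ) 1, F) :=
  have hint (α : C(Icc (0 : ℝ) 1, F)) (a b : ℝ) :
      IntervalIntegrable (IccExtend zero_le_one α) MeasureTheory.volume a b :=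
    (α.continuous.Icc_extend' (h := zero_le_one)).intervalIntegrable a b
  LinearMap.mkContinuous
    { toFun := fun α ↦ ⟨fun τ ↦ ∫ r in (0 : ℝ)..τ, IccExtend zero_le_one α r,
        (intervalIntegral.continuous_primitive (hint α) 0).comp continuous_subtype_val⟩
      map_add' := fun α β ↦ by
        ext τ
        simp only [ContinuousMap.coe_mk, ContinuousMap.add_apply]
        rw [← intervalIntegral.integral_add (hint α _ _) (hint β _ _)]
        rfl
      map_smul' := fun c α ↦ by
        ext τ
        simp only [ContinuousMap.coe_mk, ContinuousMap.smul_apply, RingHom.id_apply]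
        rw [← intervalIntegral.integral_smul]
        rfl } 1
    (fun α ↦ by
      rw [one_mul, ContinuousMap.norm_le _ (norm_nonneg _)]
      intro τ
      have := intervalIntegral.norm_integral_le_of_norm_le_const (a := (0 : ℝ)) (b := τ)
        (f := IccExtend zero_le_one α) (C := ‖α‖) (fun x _ ↦ α.norm_coe_le_norm _)
      refine this.trans ?_
      rw [sub_zero, abs_of_nonneg τ.2.1]
      exact mul_le_of_le_one_right (norm_nonneg _) τ.2.2)

lemma primitive_apply [CompleteSpace F] (α : C(Icc (0 : ℝ) 1, F)) (τ : Icc (0 : ℝ) 1) :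
    primitive F α τ = ∫ r in (0 : ℝ)..τ, IccExtend zero_le_one α r := rfl

/-- The inverse function theorem with the inverse smooth on its whole domain and not only at the
image of the base point: the source is cut down to the points where the derivative is invertible. -/
lemma exists_smooth_localInverse {X Y : Type*} [NormedAddCommGroup X] [NormedSpace ℝ X]
    [CompleteSpace X] [NormedAddCommGroup Y] [NormedSpace ℝ Y] {Θ : X → Y} {U : Set X}
    (hU : IsOpen U) (hΘ : ContDiffOn ℝ ∞ Θ U) {a : X} (ha : a ∈ U) (L : X ≃L[ℝ] Y)
    (hL : HasFDerivAt Θ (L : X →L[ℝ] Y) a) :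
    ∃ θ : OpenPartialHomeomorph X Y, a ∈ θ.source ∧ θ.source ⊆ U ∧ (∀ x, θ x = Θ x) ∧
      ContDiffOn ℝ ∞ θ.symm θ.target := by
  have hat : ContDiffAt ℝ ∞ Θ a := hΘ.contDiffAt (hU.mem_nhds ha)
  let θ₀ := hat.toOpenPartialHomeomorph Θ hL (by simp)
  have hcont : ContinuousOn (fderiv ℝ Θ) U := hΘ.continuousOn_fderiv_of_isOpen hU (by simp)
  have hopen : IsOpen (U ∩ fderiv ℝ Θ ⁻¹' range ((↑) : (X ≃L[ℝ] Y) → X →L[ℝ] Y)) :=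
    hcont.isOpen_inter_preimage hU ContinuousLinearEquiv.isOpen
  let θ := θ₀.restrOpen _ hopen
  refine ⟨θ, ⟨hat.mem_toOpenPartialHomeomorph_source hL (by simp), ha, ⟨L, hL.fderiv.symm⟩⟩,
    fun x hx ↦ hx.2.1, fun x ↦ rfl, ?_⟩
  intro y hy
  have hx := θ.map_target hy
  obtain ⟨L', hL'⟩ := hx.2.2
  have hd : DifferentiableAt ℝ Θ (θ.symm y) :=
    (hΘ.contDiffAt (hU.mem_nhds hx.2.1)).differentiableAt (by simp)
  refine (θ.contDiffAt_symm hy (f₀' := L') ?_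
    (hΘ.contDiffAt (hU.mem_nhds hx.2.1))).contDiffWithinAt
  rw [hL']
  exact hd.hasFDerivAt

/-- Constant functions on `[0,1]`. -/
def constCLM (F : Type*) [NormedAddCommGroup F] [NormedSpace ℝ F] :
    F →L[ℝ] C(Icc (0 : ℝ) 1, F) :=
  LinearMap.mkContinuous
    { toFun := fun z ↦ ContinuousMap.const _ z
      map_add' := fun _ _ ↦ rfl
      map_smul' := fun _ _ ↦ rfl } 1
    (fun z ↦ by
      rw [one_mul, ContinuousMap.norm_le _ (norm_nonneg _)]
      exact fun _ ↦ le_rfl)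

@[simp]
lemma constCLM_apply (z : F) (τ : Icc (0 : ℝ) 1) : constCLM F z τ = z := rfl

/-- The shear `(q, α) ↦ (q, α - S q)`. -/
def shear {X Y : Type*} [NormedAddCommGroup X] [NormedSpace ℝ X] [NormedAddCommGroup Y]
    [NormedSpace ℝ Y] (S : X →L[ℝ] Y) : (X × Y) ≃L[ℝ] (X × Y) :=
  ContinuousLinearEquiv.equivOfInverse
    ((ContinuousLinearMap.fst ℝ X Y).prod
      (ContinuousLinearMap.snd ℝ X Y - S ∘L ContinuousLinearMap.fst ℝ X Y))
    ((ContinuousLinearMap.fst ℝ X Y).prod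
      (ContinuousLinearMap.snd ℝ X Y + S ∘L ContinuousLinearMap.fst ℝ X Y))
    (fun x ↦ by simp) (fun x ↦ by simp)

/-- The map whose zeros `((s, z), α)` in the second component are the time-rescaled solutions
`α(τ) = z + s ∫₀^τ f(α)` of `x' = f(x)`. -/
def rescaledFlowMap [CompleteSpace F] (f : C(F, F))
    (x : (ℝ × F) × C(Icc (0 : ℝ) 1, F)) : (ℝ × F) × C(Icc (0 : ℝ) 1, F) :=
  (x.1, x.2 - constCLM F x.1.2 - x.1.1 • primitive F (f.comp x.2))

lemma contDiff_rescaledFlowMap [CompleteSpace F] {f : C(F, F)} (hf : ContDiff ℝ ∞ f) :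
    ContDiff ℝ ∞ (rescaledFlowMap f) := by
  refine contDiff_fst.prodMk ((contDiff_snd.sub ((constCLM F).contDiff.comp
    (contDiff_snd.comp contDiff_fst))).sub ((contDiff_fst.comp contDiff_fst).smul
    ((primitive F).contDiff.comp ((contDiff_superposition f hf).comp contDiff_snd))))

/-- At time `0` the linearization of the fixed-point equation is a shear, hence invertible: this is
what makes the inverse function theorem applicable. -/
lemma hasFDerivAt_rescaledFlowMap [CompleteSpace F] {f : C(F, F)} (hf : ContDiff ℝ ∞ f)
    (z₀ : F) :
    ∃ L : ((ℝ × F) × C(Icc (0 : ℝ) 1, F)) ≃L[ℝ] ((ℝ × F) × C(Icc (0 : ℝ) 1, F)),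
      HasFDerivAt (rescaledFlowMap f) (L : _ →L[ℝ] _) ((0, z₀), constCLM F z₀) := by
  let P := primitive F (f.comp (constCLM F z₀))
  let S : (ℝ × F) →L[ℝ] C(Icc (0 : ℝ) 1, F) :=
    constCLM F ∘L ContinuousLinearMap.snd ℝ ℝ F + (ContinuousLinearMap.fst ℝ ℝ F).smulRight P
  refine ⟨shear S, ?_⟩
  set a : (ℝ × F) × C(Icc (0 : ℝ) 1, F) := ((0, z₀), constCLM F z₀)
  have h1 : HasFDerivAt (fun x : (ℝ × F) × C(Icc (0 : ℝ) 1, F) ↦ x.1)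
      (ContinuousLinearMap.fst ℝ _ _) a := hasFDerivAt_fst
  have h2 : HasFDerivAt (fun x : (ℝ × F) × C(Icc (0 : ℝ) 1, F) ↦ x.2)
      (ContinuousLinearMap.snd ℝ _ _) a := hasFDerivAt_snd
  have h3 : DifferentiableAt ℝ (fun x : (ℝ × F) × C(Icc (0 : ℝ) 1, F) ↦
      primitive F (f.comp x.2)) a :=
    (((primitive F).contDiff.comp ((contDiff_superposition f hf).comp contDiff_snd)).differentiable
      (by simp)).differentiableAt
  have h4 := ((h2.sub ((constCLM F).hasFDerivAt.comp a h1.snd))).sub (h1.fst.smul h3.hasFDerivAt)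
  convert! h1.prodMk h4 using 1
  ext x <;> simp [shear, S, P, a]

/-- Local flows of a smooth vector field on the whole space, by applying the inverse function
theorem to `rescaledFlowMap` at the constant solution at time `0`. Rescaling the time to `[0, 1]` puts
the time `s` on the same footing as the initial value `z`, so the flow is jointly smooth in both. -/
theorem exists_smooth_flow [CompleteSpace F] {f : F → F} (hf : ContDiff ℝ ∞ f) (z₀ : F) :
    ∃ ε > 0, ∃ Ψ : ℝ × F → F,
      ContDiffOn ℝ ∞ Ψ (Metric.ball 0 ε ×ˢ Metric.ball z₀ ε) ∧
      ∀ z ∈ Metric.ball z₀ ε, Ψ (0, z) = z ∧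
        ∀ s ∈ Metric.ball (0 : ℝ) ε, HasDerivAt (fun r ↦ Ψ (r, z)) (f (Ψ (s, z))) s := by
  let fc : C(F, F) := ⟨f, hf.continuous⟩
  obtain ⟨L, hL⟩ := hasFDerivAt_rescaledFlowMap (f := fc) hf z₀
  obtain ⟨θ, hθa, -, hθ, hsymm⟩ := exists_smooth_localInverse isOpen_univ
    (contDiff_rescaledFlowMap (f := fc) hf).contDiffOn (mem_univ _) L hL
  set a : (ℝ × F) × C(Icc (0 : ℝ) 1, F) := ((0, z₀), constCLM F z₀) with ha
  have hθa0 : θ a = ((0, z₀), 0) := by simp [hθ, rescaledFlowMap, ha]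
  obtain ⟨δ, hδ, hδs⟩ := Metric.isOpen_iff.1 θ.open_source a hθa
  -- `A q` is the rescaled solution with parameters `q = (s, z)`
  let A : ℝ × F → C(Icc (0 : ℝ) 1, F) := fun q ↦ (θ.symm (q, 0)).2
  have hsymm0 : θ.symm ((0, z₀), 0) = a := by rw [← hθa0, θ.left_inv hθa]
  have hmem0 : ((0, z₀), (0 : C(Icc (0 : ℝ) 1, F))) ∈ θ.target := by
    rw [← hθa0]; exact θ.map_source hθa
  have hO : IsOpen (θ.target ∩ θ.symm ⁻¹' Metric.ball a δ) :=
    θ.symm.isOpen_inter_preimage Metric.isOpen_ball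
  have hincl : Continuous (fun q : ℝ × F ↦ (q, (0 : C(Icc (0 : ℝ) 1, F)))) := by fun_prop
  obtain ⟨ε₀, hε₀, hε₀s⟩ := Metric.isOpen_iff.1 (hO.preimage hincl) (0, z₀)
    ⟨hmem0, by simp [hsymm0, hδ]⟩
  obtain ⟨ε, hε, hε1, hε2⟩ : ∃ ε > 0, ε ≤ ε₀ ∧ ε ≤ δ :=
    ⟨min ε₀ δ, lt_min hε₀ hδ, min_le_left _ _, min_le_right _ _⟩
  have hball (s : ℝ) (z : F) (hs : s ∈ Metric.ball (0 : ℝ) ε) (hz : z ∈ Metric.ball z₀ ε) :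
      (s, z) ∈ Metric.ball ((0 : ℝ), z₀) ε := by
    rw [Metric.mem_ball, Prod.dist_eq]; exact max_lt hs hz
  have hfix (q : ℝ × F) (hq : q ∈ Metric.ball ((0 : ℝ), z₀) ε) :
      θ.symm (q, 0) = (q, A q) ∧
        A q = constCLM F q.2 + q.1 • primitive F (fc.comp (A q)) ∧
        dist (A q) (constCLM F z₀) < δ := by
    obtain ⟨hq1, hq2⟩ := hε₀s (Metric.ball_subset_ball hε1 hq)
    have h1 := θ.right_inv hq1
    rw [hθ] at h1
    simp only [rescaledFlowMap, Prod.mk.injEq] at h1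
    refine ⟨Prod.ext h1.1 rfl, ?_, ?_⟩
    · have h2 := h1.2
      rw [h1.1, sub_sub, sub_eq_zero] at h2
      exact h2
    · rw [mem_preimage, Metric.mem_ball, Prod.dist_eq] at hq2
      exact (le_max_right _ _).trans_lt hq2
  -- the rescaled solution is the restriction of the flow line
  have hval (q : ℝ × F) (hq : q ∈ Metric.ball ((0 : ℝ), z₀) ε) (τ : Icc (0 : ℝ) 1) :
      A q τ = q.2 + q.1 • ∫ r in (0 : ℝ)..τ, IccExtend zero_le_one (fc.comp (A q)) r := by
    have := congrArg (fun b : C(Icc (0 : ℝ) 1, F) ↦ b τ) (hfix q hq).2.1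
    simpa [primitive_apply] using this
  let Ψ : ℝ × F → F := fun q ↦ A q ⟨1, by simp⟩
  have hscale (s : ℝ) (z : F) (hs : s ∈ Metric.ball (0 : ℝ) ε) (hz : z ∈ Metric.ball z₀ ε)
      (σ : Icc (0 : ℝ) 1) : A (s, z) σ = Ψ (σ * s, z) := by
    have hσs : (σ : ℝ) * s ∈ Metric.ball (0 : ℝ) ε := by
      rw [mem_ball_zero_iff, norm_mul] at *
      refine lt_of_le_of_lt (mul_le_of_le_one_left (norm_nonneg _) ?_) hs
      rw [Real.norm_eq_abs, abs_of_nonneg σ.2.1]; exact σ.2.2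
    let m : C(Icc (0 : ℝ) 1, Icc (0 : ℝ) 1) :=
      ⟨fun τ ↦ ⟨σ * τ, mul_nonneg σ.2.1 τ.2.1, mul_le_one₀ σ.2.2 τ.2.1 τ.2.2⟩, by fun_prop⟩
    -- `τ ↦ A (s, z) (σ τ)` solves the equation for the time `σ s`: use local uniqueness
    have hd : dist ((A (s, z)).comp m) (constCLM F z₀) < δ := by
      refine lt_of_le_of_lt ?_ (hfix (s, z) (hball s z hs hz)).2.2
      exact (ContinuousMap.dist_le dist_nonneg).2 fun τ ↦
        ContinuousMap.dist_apply_le_dist (f := A (s, z)) (g := constCLM F z₀) (m τ)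
    have hq := hball _ z hσs hz
    have heq : ((((σ : ℝ) * s, z) : ℝ × F), (A (s, z)).comp m) =
        (((σ : ℝ) * s, z), A ((σ : ℝ) * s, z)) := by
      apply θ.injOn
      · apply hδs
        rw [Metric.mem_ball, Prod.dist_eq]
        exact max_lt ((Metric.mem_ball.1 hq).trans_le hε2) hd
      · apply hδs
        rw [Metric.mem_ball, Prod.dist_eq]
        exact max_lt ((Metric.mem_ball.1 hq).trans_le hε2) (hfix _ hq).2.2
      · rw [hθ, hθ]
        simp only [rescaledFlowMap, Prod.mk.injEq, true_and]
        rw [sub_sub, sub_sub, sub_eq_zero.2 (hfix _ hq).2.1, sub_eq_zero]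
        ext τ
        have h1 := hval _ (hball s z hs hz) (m τ)
        simp only [ContinuousMap.comp_apply, ContinuousMap.add_apply, constCLM_apply,
          ContinuousMap.smul_apply, primitive_apply]
        rw [h1]
        congr 1
        simp only [m, ContinuousMap.coe_mk]
        rw [mul_comm (σ : ℝ) s, mul_smul]
        refine congrArg (fun x ↦ s • x) ?_
        have h2 := intervalIntegral.smul_integral_comp_mul_left
          (fun r ↦ IccExtend zero_le_one (fc.comp (A (s, z))) r) (a := 0) (b := τ) (σ : ℝ)
        rw [mul_zero] at h2
        rw [← h2]
        congr 1
        apply intervalIntegral.integral_congr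
        intro r hr
        rw [uIcc_of_le τ.2.1] at hr
        have hr1 : r ∈ Icc (0 : ℝ) 1 := ⟨hr.1, hr.2.trans τ.2.2⟩
        have hr2 : (σ : ℝ) * r ∈ Icc (0 : ℝ) 1 := (m ⟨r, hr1⟩).2
        simp only [IccExtend_of_mem _ _ hr1, IccExtend_of_mem _ _ hr2]
        rfl
    have h3 := congrArg (fun x : (ℝ × F) × C(Icc (0 : ℝ) 1, F) ↦ x.2 ⟨1, by simp⟩) heq
    simp only [ContinuousMap.comp_apply] at h3
    rw [← show A ((σ : ℝ) * s, z) ⟨1, by simp⟩ = Ψ (σ * s, z) from rfl, ← h3]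
    congr 1
    ext
    simp [m]
  have hsmooth : ContDiffOn ℝ ∞ Ψ (Metric.ball 0 ε ×ˢ Metric.ball z₀ ε) := by
    have h1 : ContDiffOn ℝ ∞ A (Metric.ball 0 ε ×ˢ Metric.ball z₀ ε) := by
      refine contDiff_snd.comp_contDiffOn (hsymm.comp ?_ ?_)
      · exact (contDiff_id.prodMk contDiff_const).contDiffOn
      · rintro ⟨s, z⟩ ⟨hs, hz⟩
        exact (hε₀s (Metric.ball_subset_ball hε1 (hball s z hs hz))).1
    exact (ContinuousMap.evalCLM ℝ (⟨1, by simp⟩ : Icc (0 : ℝ) 1)).contDiff.comp_contDiffOn h1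
  -- the integral equation, with the rescaling undone
  have hint (s : ℝ) (z : F) (hs : s ∈ Metric.ball (0 : ℝ) ε) (hz : z ∈ Metric.ball z₀ ε) :
      Ψ (s, z) = z + ∫ r in (0 : ℝ)..s, f (Ψ (r, z)) := by
    have h1 := hval _ (hball s z hs hz) ⟨1, by simp⟩
    simp only at h1
    have h2 := intervalIntegral.smul_integral_comp_mul_left
      (fun r ↦ f (Ψ (r, z))) (a := 0) (b := 1) s
    rw [mul_zero, mul_one] at h2
    rw [← h2, show Ψ (s, z) = A (s, z) ⟨1, by simp⟩ from rfl, h1]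
    congr 2
    apply intervalIntegral.integral_congr
    intro r hr
    rw [uIcc_of_le zero_le_one] at hr
    simp only [IccExtend_of_mem _ _ hr, ContinuousMap.comp_apply, fc, ContinuousMap.coe_mk]
    rw [hscale s z hs hz ⟨r, hr⟩, mul_comm]
  refine ⟨ε, hε, Ψ, hsmooth, fun z hz ↦ ⟨?_, fun s hs ↦ ?_⟩⟩
  · rw [hint 0 z (Metric.mem_ball_self hε) hz]; simp
  · have hcont : ContinuousOn (fun r ↦ f (Ψ (r, z))) (Metric.ball 0 ε) :=
      hf.continuous.comp_continuousOn (hsmooth.continuousOn.comp (by fun_prop)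
        (fun r hr ↦ ⟨hr, hz⟩))
    have hnhds : Metric.ball (0 : ℝ) ε ∈ 𝓝 s := Metric.isOpen_ball.mem_nhds hs
    have h1 : HasDerivAt (fun r ↦ ∫ r in (0 : ℝ)..r, f (Ψ (r, z))) (f (Ψ (s, z))) s := by
      refine intervalIntegral.integral_hasDerivAt_right ?_ ?_ (hcont.continuousAt hnhds)
      · refine (hcont.mono ?_).intervalIntegrable
        have := (convex_ball (0 : ℝ) ε).ordConnected.uIcc_subset (Metric.mem_ball_self hε) hs
        exact this
      · exact hcont.stronglyMeasurableAtFilter Metric.isOpen_ball s hs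
    refine (h1.const_add z).congr_of_eventuallyEq ?_
    filter_upwards [hnhds] with r hr using hint r z hr hz

/-- A vector field which is smooth on an open set has a smooth local flow at each point. -/
theorem exists_smooth_localFlow [FiniteDimensional ℝ F] {f : F → F} {U : Set F} (hU : IsOpen U)
    (hf : ContDiffOn ℝ ∞ f U) {z₀ : F} (hz₀ : z₀ ∈ U) :
    ∃ ε > 0, ∃ Ψ : ℝ × F → F,
      ContDiffOn ℝ ∞ Ψ (Metric.ball 0 ε ×ˢ Metric.ball z₀ ε) ∧
      ∀ z ∈ Metric.ball z₀ ε, Ψ (0, z) = z ∧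
        ∀ s ∈ Metric.ball (0 : ℝ) ε, Ψ (s, z) ∈ U ∧
          HasDerivAt (fun r ↦ Ψ (r, z)) (f (Ψ (s, z))) s := by
  have : CompleteSpace F := FiniteDimensional.complete ℝ F
  obtain ⟨δ, hδ, hδU⟩ := Metric.isOpen_iff.1 hU z₀ hz₀
  -- a cutoff extends the vector field to the whole space
  let χ : ContDiffBump z₀ := ⟨δ / 4, δ / 2, by positivity, by linarith⟩
  have hg : ContDiff ℝ ∞ (fun x ↦ χ x • f x) := by
    rw [contDiff_iff_contDiffAt]
    intro x
    by_cases hx : x ∈ U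
    · exact χ.contDiff.contDiffAt.smul (hf.contDiffAt (hU.mem_nhds hx))
    · have hx' : x ∉ tsupport χ := by
        rw [χ.tsupport_eq]
        intro h
        exact hx (hδU (Metric.closedBall_subset_ball (by simp only [χ]; linarith) h))
      refine contDiffAt_const (c := (0 : F)) |>.congr_of_eventuallyEq ?_
      filter_upwards [notMem_tsupport_iff_eventuallyEq.1 hx'] with y hy
      simp [hy]
  obtain ⟨ε, hε, Ψ, hΨ, hflow⟩ := exists_smooth_flow hg z₀
  have h0 : ((0 : ℝ), z₀) ∈ Metric.ball (0 : ℝ) ε ×ˢ Metric.ball z₀ ε :=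
    ⟨Metric.mem_ball_self hε, Metric.mem_ball_self hε⟩
  have hopen : IsOpen ((Metric.ball (0 : ℝ) ε ×ˢ Metric.ball z₀ ε) ∩
      Ψ ⁻¹' Metric.ball z₀ (δ / 4)) :=
    hΨ.continuousOn.isOpen_inter_preimage (Metric.isOpen_ball.prod Metric.isOpen_ball)
      Metric.isOpen_ball
  obtain ⟨η, hη, hηs⟩ := Metric.isOpen_iff.1 hopen (0, z₀) ⟨h0, by
    rw [mem_preimage, (hflow z₀ h0.2).1]; exact Metric.mem_ball_self (by positivity)⟩
  rw [← ball_prod_same] at hηs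
  refine ⟨η, hη, Ψ, hΨ.mono fun x hx ↦ (hηs hx).1, fun z hz ↦ ?_⟩
  have hz' := (hηs (mk_mem_prod (Metric.mem_ball_self hη) hz)).1.2
  refine ⟨(hflow z hz').1, fun s hs ↦ ?_⟩
  have hsz := hηs (mk_mem_prod hs hz)
  have hΨs : Ψ (s, z) ∈ Metric.ball z₀ (δ / 4) := hsz.2
  refine ⟨hδU (Metric.ball_subset_ball (by linarith) hΨs), ?_⟩
  have h1 := (hflow z hz').2 s hsz.1.1
  rwa [χ.one_of_mem_closedBall (Metric.ball_subset_closedBall hΨs), one_smul] at h1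

end LocalFlow

/-! ### Levi-Civita calculus in coordinates -/

section Coordinates

set_option maxSynthPendingDepth 3

variable {E : Type*} [NormedAddCommGroup E] [NormedSpace ℝ E]

/-- The components of a smooth pseudo-Riemannian metric on an open set `U` of coordinates. -/
structure IsSmoothMetricOn (G : E → E →L[ℝ] E →L[ℝ] ℝ) (U : Set E) : Prop where
  isOpen : IsOpen U
  contDiffOn : ContDiffOn ℝ ∞ G U
  symm : ∀ y ∈ U, ∀ v w, G y v w = G y w v
  nondegenerate : ∀ y ∈ U, ∀ v, (∀ w, G y v w = 0) → v = 0

/-- The Christoffel symbols of the metric components `G`, as a bilinear map: the Koszul formula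
solved by the inverse of `G y : E → E*`, which is the junk value `0` where `G y` is degenerate. -/
def christoffelCLM (G : E → E →L[ℝ] E →L[ℝ] ℝ) (y : E) : E →L[ℝ] E →L[ℝ] E :=
  ContinuousLinearMap.compL ℝ E (E →L[ℝ] ℝ) E (G y).inverse ∘L
    ((1 / 2 : ℝ) • (fderiv ℝ G y + (fderiv ℝ G y).flip -
      (ContinuousLinearMap.flipₗᵢ ℝ E E ℝ).toContinuousLinearEquiv.toContinuousLinearMap ∘L
        (fderiv ℝ G y).flip))

/-- The curvature tensor of the metric components `G`. -/
def curvatureOf (G : E → E →L[ℝ] E →L[ℝ] ℝ) (y X Y Z : E) : E :=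
  fderiv ℝ (christoffelCLM G) y X Y Z - fderiv ℝ (christoffelCLM G) y Y X Z
    + christoffelCLM G y X (christoffelCLM G y Y Z)
    - christoffelCLM G y Y (christoffelCLM G y X Z)

/-- The covariant derivative of a vector field `u` along a curve `c`, in coordinates. -/
def covDeriv (G : E → E →L[ℝ] E →L[ℝ] ℝ) (c u : ℝ → E) (s : ℝ) : E :=
  deriv u s + christoffelCLM G (c s) (deriv c s) (u s)

variable {G : E → E →L[ℝ] E →L[ℝ] ℝ} {U : Set E} {y : E}

namespace IsSmoothMetricOn

lemma contDiffAt (h : IsSmoothMetricOn G U) (hy : y ∈ U) : ContDiffAt ℝ ∞ G y :=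
  h.contDiffOn.contDiffAt (h.isOpen.mem_nhds hy)

lemma differentiableAt (h : IsSmoothMetricOn G U) (hy : y ∈ U) : DifferentiableAt ℝ G y :=
  (h.contDiffAt hy).differentiableAt (by simp)

lemma eq_of_forall (h : IsSmoothMetricOn G U) (hy : y ∈ U) {u u' : E}
    (huu : ∀ z, G y u z = G y u' z) : u = u' := by
  rw [← sub_eq_zero]
  exact h.nondegenerate y hy _ fun w ↦ by simp [huu w]

lemma fderiv_symm (h : IsSmoothMetricOn G U) (hy : y ∈ U) (u v w : E) :
    fderiv ℝ G y u v w = fderiv ℝ G y u w v := by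
  have h1 : HasFDerivAt (fun x ↦ G x v w) ((fderiv ℝ G y).flip v |>.flip w) y :=
    (((h.differentiableAt hy).hasFDerivAt.clm_apply (hasFDerivAt_const v y)).clm_apply
      (hasFDerivAt_const w y)).congr_fderiv (by ext; simp)
  have h2 : HasFDerivAt (fun x ↦ G x w v) ((fderiv ℝ G y).flip w |>.flip v) y :=
    (((h.differentiableAt hy).hasFDerivAt.clm_apply (hasFDerivAt_const w y)).clm_apply
      (hasFDerivAt_const v y)).congr_fderiv (by ext; simp)
  have h3 := h1.unique (h2.congr_of_eventuallyEq (by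
    filter_upwards [h.isOpen.mem_nhds hy] with x hx using h.symm x hx v w))
  simpa using congrArg (fun A : E →L[ℝ] ℝ ↦ A u) h3

variable [FiniteDimensional ℝ E]

lemma isInvertible (h : IsSmoothMetricOn G U) (hy : y ∈ U) : (G y).IsInvertible := by
  have hinj : Function.Injective (G y : E →ₗ[ℝ] E →L[ℝ] ℝ) := by
    rw [← LinearMap.ker_eq_bot, LinearMap.ker_eq_bot']
    intro v hv
    exact h.nondegenerate y hy v fun w ↦ by
      have := congrArg (fun A : E →L[ℝ] ℝ ↦ A w) hv
      simpa using this
  have hdim : Module.finrank ℝ E = Module.finrank ℝ (E →L[ℝ] ℝ) := by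
    rw [← (LinearMap.toContinuousLinearMap (𝕜 := ℝ) (E := E) (F' := ℝ)).finrank_eq]
    exact (Subspace.dual_finrank_eq (K := ℝ) (V := E)).symm
  let e := (LinearEquiv.ofInjective (G y : E →ₗ[ℝ] E →L[ℝ] ℝ) hinj)
  have hsurj := (LinearMap.injective_iff_surjective_of_finrank_eq_finrank hdim).1 hinj
  exact ⟨(LinearEquiv.ofBijective (G y : E →ₗ[ℝ] E →L[ℝ] ℝ) ⟨hinj, hsurj⟩).toContinuousLinearEquiv,
    by ext; rfl⟩

/-- The Koszul formula. -/
lemma koszul (h : IsSmoothMetricOn G U) (hy : y ∈ U) (v w z : E) :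
    G y (christoffelCLM G y v w) z =
      1 / 2 * (fderiv ℝ G y v w z + fderiv ℝ G y w v z - fderiv ℝ G y z v w) := by
  have := congrArg (fun A : E →L[ℝ] ℝ ↦ A z) ((h.isInvertible hy).self_apply_inverse
    ((1 / 2 : ℝ) • (fderiv ℝ G y v w + fderiv ℝ G y w v - ((fderiv ℝ G y).flip v).flip w)))
  simpa [christoffelCLM] using this

lemma christoffel_symm (h : IsSmoothMetricOn G U) (hy : y ∈ U) (v w : E) :
    christoffelCLM G y v w = christoffelCLM G y w v := by
  refine h.eq_of_forall hy fun z ↦ ?_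
  rw [h.koszul hy, h.koszul hy, h.fderiv_symm hy z v w]
  ring

lemma metric_compat (h : IsSmoothMetricOn G U) (hy : y ∈ U) (u v w : E) :
    fderiv ℝ G y u v w =
      G y (christoffelCLM G y u v) w + G y v (christoffelCLM G y u w) := by
  rw [h.symm y hy v, h.koszul hy, h.koszul hy, h.fderiv_symm hy u v w, h.fderiv_symm hy v u w,
    h.fderiv_symm hy w u v]
  ring

lemma contDiffAt_christoffel (h : IsSmoothMetricOn G U) (hy : y ∈ U) :
    ContDiffAt ℝ ∞ (christoffelCLM G) y := by
  have : CompleteSpace E := FiniteDimensional.complete ℝ E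
  have h1 : ContDiffAt ℝ ∞ (fun y ↦ (G y).inverse) y :=
    (h.isInvertible hy).contDiffAt_map_inverse.comp y (h.contDiffAt hy)
  have h2 : ContDiffAt ℝ ∞ (fderiv ℝ G) y := (h.contDiffAt hy).fderiv_right (by simp)
  have h3 : ContDiffAt ℝ ∞ (fun y ↦ (fderiv ℝ G y).flip) y :=
    (ContinuousLinearMap.flipₗᵢ ℝ E E (E →L[ℝ] ℝ)).contDiff.contDiffAt.comp y h2
  unfold christoffelCLM
  refine ContDiffAt.clm_comp ?_ ?_
  · exact (ContinuousLinearMap.compL ℝ E (E →L[ℝ] ℝ) E).contDiff.contDiffAt.comp y h1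
  · exact ((h2.add h3).sub (contDiffAt_const.clm_comp h3)).const_smul _

lemma differentiableAt_christoffel (h : IsSmoothMetricOn G U) (hy : y ∈ U) :
    DifferentiableAt ℝ (christoffelCLM G) y :=
  (h.contDiffAt_christoffel hy).differentiableAt (by simp)

lemma fderiv_christoffel_symm (h : IsSmoothMetricOn G U) (hy : y ∈ U) (u v w : E) :
    fderiv ℝ (christoffelCLM G) y u v w = fderiv ℝ (christoffelCLM G) y u w v := by
  have h0 := (h.differentiableAt_christoffel hy).hasFDerivAt
  have h1 : HasFDerivAt (fun x ↦ christoffelCLM G x v w)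
      ((fderiv ℝ (christoffelCLM G) y).flip v |>.flip w) y :=
    ((h0.clm_apply (hasFDerivAt_const v y)).clm_apply
      (hasFDerivAt_const w y)).congr_fderiv (by ext; simp)
  have h2 : HasFDerivAt (fun x ↦ christoffelCLM G x w v)
      ((fderiv ℝ (christoffelCLM G) y).flip w |>.flip v) y :=
    ((h0.clm_apply (hasFDerivAt_const w y)).clm_apply
      (hasFDerivAt_const v y)).congr_fderiv (by ext; simp)
  have h3 := h1.unique (h2.congr_of_eventuallyEq (by
    filter_upwards [h.isOpen.mem_nhds hy] with x hx using h.christoffel_symm hx v w))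
  simpa using congrArg (fun A : E →L[ℝ] E ↦ A u) h3

lemma inner_curvatureOf_self (h : IsSmoothMetricOn G U) (hy : y ∈ U) (X Y Z : E) :
    G y (curvatureOf G y X Y Z) Z = 0 := by
  -- the second derivative of `G(Z, Z)` expressed through Christoffel symbols
  have key (X Y : E) : fderiv ℝ (fderiv ℝ G) y X Y Z Z =
      2 * (G y (christoffelCLM G y X (christoffelCLM G y Y Z)) Z
        + G y (christoffelCLM G y Y Z) (christoffelCLM G y X Z)
        + G y (fderiv ℝ (christoffelCLM G) y X Y Z) Z) := by
    have hG := (h.differentiableAt hy).hasFDerivAt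
    have hG2 : HasFDerivAt (fderiv ℝ G) (fderiv ℝ (fderiv ℝ G) y) y :=
      (((h.contDiffAt hy).fderiv_right (m := ∞) (by simp)).differentiableAt
        (by simp)).hasFDerivAt
    have hΓ := (h.differentiableAt_christoffel hy).hasFDerivAt
    have h1 := ((hG2.clm_apply (hasFDerivAt_const Y y)).clm_apply
      (hasFDerivAt_const Z y)).clm_apply (hasFDerivAt_const Z y)
    have h2 := ((hG.clm_apply ((hΓ.clm_apply (hasFDerivAt_const Y y)).clm_apply
      (hasFDerivAt_const Z y))).clm_apply (hasFDerivAt_const Z y)).const_mul 2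
    have h3 := h1.unique (h2.congr_of_eventuallyEq (by
      filter_upwards [h.isOpen.mem_nhds hy] with x hx
      simp only [h.metric_compat hx]
      rw [h.symm x hx Z]
      ring))
    have h4 := congrArg (fun A : E →L[ℝ] ℝ ↦ A X) h3
    simp at h4
    rw [h4, h.metric_compat hy]
    ring
  have hsymm : fderiv ℝ (fderiv ℝ G) y X Y = fderiv ℝ (fderiv ℝ G) y Y X :=
    ((h.contDiffAt hy).isSymmSndFDerivAt (by simpa using ENat.LEInfty.out)) X Y
  have h1 := key X Y
  rw [hsymm, key Y X, h.symm y hy (christoffelCLM G y X Z)] at h1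
  simp only [curvatureOf, map_add, map_sub, add_apply,
    sub_apply]
  linarith

lemma inner_curvatureOf_antisymm (h : IsSmoothMetricOn G U) (hy : y ∈ U) (X Y Z W : E) :
    G y (curvatureOf G y X Y Z) W = - G y (curvatureOf G y X Y W) Z := by
  have hadd : curvatureOf G y X Y (Z + W) = curvatureOf G y X Y Z + curvatureOf G y X Y W := by
    simp only [curvatureOf, map_add]
    abel
  have h1 := h.inner_curvatureOf_self hy X Y (Z + W)
  rw [hadd] at h1
  simp only [map_add, add_apply, h.inner_curvatureOf_self hy X Y] at h1
  linarith

lemma hasDerivAt_inner (h : IsSmoothMetricOn G U) {c u w : ℝ → E} {s : ℝ} (hc : c s ∈ U)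
    (hc' : DifferentiableAt ℝ c s) (hu : DifferentiableAt ℝ u s) (hw : DifferentiableAt ℝ w s) :
    HasDerivAt (fun r ↦ G (c r) (u r) (w r))
      (G (c s) (covDeriv G c u s) (w s) + G (c s) (u s) (covDeriv G c w s)) s := by
  have h1 := (((h.differentiableAt hc).hasFDerivAt.comp_hasDerivAt s hc'.hasDerivAt).clm_apply
    hu.hasDerivAt).clm_apply hw.hasDerivAt
  refine h1.congr_deriv ?_
  simp only [covDeriv, map_add, add_apply, h.metric_compat hc, Function.comp_apply]
  ring

lemma hasDerivAt_christoffel (h : IsSmoothMetricOn G U) {c u w : ℝ → E} {s : ℝ} {c' u' w' : E}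
    (hc : c s ∈ U) (hc' : HasDerivAt c c' s) (hu : HasDerivAt u u' s) (hw : HasDerivAt w w' s) :
    HasDerivAt (fun r ↦ christoffelCLM G (c r) (u r) (w r))
      (fderiv ℝ (christoffelCLM G) (c s) c' (u s) (w s) + christoffelCLM G (c s) u' (w s)
        + christoffelCLM G (c s) (u s) w') s := by
  have h1 := (((h.differentiableAt_christoffel hc).hasFDerivAt.comp_hasDerivAt s hc').clm_apply
    hu).clm_apply hw
  simpa using h1

/-- The transformation law of the Christoffel symbols under a change of coordinates. -/
lemma christoffel_transform (h : IsSmoothMetricOn G U) (hy : y ∈ U)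
    {G' : E → E →L[ℝ] E →L[ℝ] ℝ} {U' : Set E} (h' : IsSmoothMetricOn G' U') {φ : E → E}
    (hφ : ContDiffAt ℝ ∞ φ y) (hφy : φ y ∈ U') (hsurj : Function.Surjective (fderiv ℝ φ y))
    (hG : ∀ᶠ x in 𝓝 y, ∀ v w, G x v w = G' (φ x) (fderiv ℝ φ x v) (fderiv ℝ φ x w)) (v w : E) :
    fderiv ℝ φ y (christoffelCLM G y v w) =
      fderiv ℝ (fderiv ℝ φ) y v w + christoffelCLM G' (φ y) (fderiv ℝ φ y v) (fderiv ℝ φ y w) := by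
  have hφ2 : HasFDerivAt (fderiv ℝ φ) (fderiv ℝ (fderiv ℝ φ) y) y :=
    ((hφ.fderiv_right (m := ∞) (by simp)).differentiableAt (by simp)).hasFDerivAt
  have hφ1 : HasFDerivAt φ (fderiv ℝ φ y) y := (hφ.differentiableAt (by simp)).hasFDerivAt
  have hsymm (u v : E) : fderiv ℝ (fderiv ℝ φ) y u v = fderiv ℝ (fderiv ℝ φ) y v u :=
    (hφ.isSymmSndFDerivAt (by simpa using ENat.LEInfty.out)) u v
  have hGy := hG.self_of_nhds
  have key (u v w : E) : fderiv ℝ G y u v w =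
      fderiv ℝ G' (φ y) (fderiv ℝ φ y u) (fderiv ℝ φ y v) (fderiv ℝ φ y w)
        + G' (φ y) (fderiv ℝ (fderiv ℝ φ) y u v) (fderiv ℝ φ y w)
        + G' (φ y) (fderiv ℝ φ y v) (fderiv ℝ (fderiv ℝ φ) y u w) := by
    have h1 := ((h.differentiableAt hy).hasFDerivAt.clm_apply (hasFDerivAt_const v y)).clm_apply
      (hasFDerivAt_const w y)
    have h5 : HasFDerivAt (fun x ↦ G' (φ x)) (fderiv ℝ G' (φ y) ∘L fderiv ℝ φ y) y :=
      (h'.differentiableAt hφy).hasFDerivAt.comp y hφ1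
    have h2 := (h5.clm_apply
      (hφ2.clm_apply (hasFDerivAt_const v y))).clm_apply (hφ2.clm_apply (hasFDerivAt_const w y))
    have h3 := h1.unique (h2.congr_of_eventuallyEq (by
      filter_upwards [hG] with x hx using hx v w))
    have h4 := congrArg (fun A : E →L[ℝ] ℝ ↦ A u) h3
    simp at h4
    rw [h4]
    ring
  refine h'.eq_of_forall hφy fun z' ↦ ?_
  obtain ⟨z, rfl⟩ := hsurj z'
  rw [← hGy, h.koszul hy, key, key, key, map_add, add_apply, h'.koszul hφy,
    hsymm w v, hsymm z v, hsymm z w, h'.symm _ hφy (fderiv ℝ φ y w),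
    h'.symm _ hφy (fderiv ℝ φ y v)]
  ring

/-- The covariant derivative along a curve does not depend on the coordinates. -/
lemma covDeriv_transform (h : IsSmoothMetricOn G U)
    {G' : E → E →L[ℝ] E →L[ℝ] ℝ} {U' : Set E} (h' : IsSmoothMetricOn G' U') {φ : E → E}
    {c u c₁ u₁ : ℝ → E} {s : ℝ} (hy : c s ∈ U)
    (hφ : ContDiffAt ℝ ∞ φ (c s)) (hφy : φ (c s) ∈ U')
    (hsurj : Function.Surjective (fderiv ℝ φ (c s)))
    (hG : ∀ᶠ x in 𝓝 (c s), ∀ v w, G x v w = G' (φ x) (fderiv ℝ φ x v) (fderiv ℝ φ x w))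
    (hc : DifferentiableAt ℝ c s) (hu : DifferentiableAt ℝ u s)
    (hc₁ : c₁ =ᶠ[𝓝 s] fun r ↦ φ (c r)) (hu₁ : u₁ =ᶠ[𝓝 s] fun r ↦ fderiv ℝ φ (c r) (u r)) :
    covDeriv G' c₁ u₁ s = fderiv ℝ φ (c s) (covDeriv G c u s) := by
  have hφ2 : HasFDerivAt (fderiv ℝ φ) (fderiv ℝ (fderiv ℝ φ) (c s)) (c s) :=
    ((hφ.fderiv_right (m := ∞) (by simp)).differentiableAt (by simp)).hasFDerivAt
  have hφ1 : HasFDerivAt φ (fderiv ℝ φ (c s)) (c s) :=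
    (hφ.differentiableAt (by simp)).hasFDerivAt
  have h1 : deriv c₁ s = fderiv ℝ φ (c s) (deriv c s) :=
    ((hφ1.comp_hasDerivAt s hc.hasDerivAt).congr_of_eventuallyEq hc₁).deriv
  have h2 : deriv u₁ s = fderiv ℝ (fderiv ℝ φ) (c s) (deriv c s) (u s)
      + fderiv ℝ φ (c s) (deriv u s) :=
    (((hφ2.comp_hasDerivAt s hc.hasDerivAt).clm_apply hu.hasDerivAt).congr_of_eventuallyEq
      hu₁).deriv
  simp only [covDeriv, h1, h2, map_add, hc₁.self_of_nhds, hu₁.self_of_nhds,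
    h.christoffel_transform hy h' hφ hφy hsurj hG]
  abel

/-- The variation field of a smooth family of geodesics satisfies the Jacobi equation. -/
lemma jacobi_of_variation (h : IsSmoothMetricOn G U) {x : ℝ × ℝ → E} {s : ℝ}
    (hx : ContDiffAt ℝ ∞ x (s, 0)) (hU : x (s, 0) ∈ U)
    (hgeo : ∀ᶠ q in 𝓝 (s, (0 : ℝ)), fderiv ℝ (fun q ↦ fderiv ℝ x q (1, 0)) q (1, 0)
      + christoffelCLM G (x q) (fderiv ℝ x q (1, 0)) (fderiv ℝ x q (1, 0)) = 0) :
    covDeriv G (fun r ↦ x (r, 0))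
      (covDeriv G (fun r ↦ x (r, 0)) (fun r ↦ fderiv ℝ x (r, 0) (0, 1))) s
      + curvatureOf G (x (s, 0)) (fderiv ℝ x (s, 0) (0, 1)) (deriv (fun r ↦ x (r, 0)) s)
        (deriv (fun r ↦ x (r, 0)) s) = 0 := by
  set xs : ℝ × ℝ → E := fun q ↦ fderiv ℝ x q (1, 0) with hxs
  set xe : ℝ × ℝ → E := fun q ↦ fderiv ℝ x q (0, 1) with hxe
  have hline (r : ℝ) : HasDerivAt (fun r : ℝ ↦ (r, (0 : ℝ))) ((1 : ℝ), (0 : ℝ)) r :=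
    (hasDerivAt_id r).prodMk (hasDerivAt_const r 0)
  have htend : Filter.Tendsto (fun r : ℝ ↦ (r, (0 : ℝ))) (𝓝 s) (𝓝 (s, 0)) :=
    (hline s).continuousAt
  have hev : ∀ᶠ q in 𝓝 (s, (0 : ℝ)), ContDiffAt ℝ 4 x q :=
    (hx.of_le ENat.LEInfty.out).eventually (by simp)
  have hsm (e : ℝ × ℝ) {q : ℝ × ℝ} (hq : ContDiffAt ℝ 4 x q) :
      ContDiffAt ℝ 3 (fun q ↦ fderiv ℝ x q e) q :=
    (hq.fderiv_right (m := 3) (by norm_num)).clm_apply contDiffAt_const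
  -- mixed partial derivatives commute
  have hcomm {q : ℝ × ℝ} (hq : ContDiffAt ℝ 4 x q) :
      fderiv ℝ xs q (0, 1) = fderiv ℝ xe q (1, 0) := by
    have hd : HasFDerivAt (fderiv ℝ x) (fderiv ℝ (fderiv ℝ x) q) q :=
      ((hq.fderiv_right (m := 3) (by norm_num)).differentiableAt (by norm_num)).hasFDerivAt
    have h1 := (hd.clm_apply (hasFDerivAt_const ((1 : ℝ), (0 : ℝ)) q)).fderiv
    have h2 := (hd.clm_apply (hasFDerivAt_const ((0 : ℝ), (1 : ℝ)) q)).fderiv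
    rw [hxs, hxe, h1, h2]
    simpa using (hq.isSymmSndFDerivAt (by simp; norm_cast)) (0, 1) (1, 0)
  have hs4 : ContDiffAt ℝ 4 x (s, 0) := hev.self_of_nhds
  have hdx {q : ℝ × ℝ} (hq : ContDiffAt ℝ 4 x q) : HasFDerivAt x (fderiv ℝ x q) q :=
    (hq.differentiableAt (by norm_num)).hasFDerivAt
  have hdxs {q : ℝ × ℝ} (hq : ContDiffAt ℝ 4 x q) : HasFDerivAt xs (fderiv ℝ xs q) q :=
    ((hsm _ hq).differentiableAt (by norm_num)).hasFDerivAt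
  have hdxe {q : ℝ × ℝ} (hq : ContDiffAt ℝ 4 x q) : HasFDerivAt xe (fderiv ℝ xe q) q :=
    ((hsm _ hq).differentiableAt (by norm_num)).hasFDerivAt
  have hdxes : HasFDerivAt (fun q ↦ fderiv ℝ xe q (1, 0))
      (fderiv ℝ (fun q ↦ fderiv ℝ xe q (1, 0)) (s, 0)) (s, 0) :=
    ((((hsm _ hs4).fderiv_right (m := 2) (by norm_num)).clm_apply
      contDiffAt_const).differentiableAt (by norm_num)).hasFDerivAt
  have hevr : ∀ᶠ r in 𝓝 s, ContDiffAt ℝ 4 x (r, 0) := htend.eventually hev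
  have hc {r : ℝ} (hr : ContDiffAt ℝ 4 x (r, 0)) : HasDerivAt (fun r ↦ x (r, 0)) (xs (r, 0)) r :=
    HasFDerivAt.comp_hasDerivAt (l := x) r (hdx hr) (hline r)
  have hu {r : ℝ} (hr : ContDiffAt ℝ 4 x (r, 0)) :
      HasDerivAt (fun r ↦ xe (r, 0)) (fderiv ℝ xe (r, 0) (1, 0)) r :=
    HasFDerivAt.comp_hasDerivAt (l := xe) r (hdxe hr) (hline r)
  have hc'' : HasDerivAt (fun r ↦ xs (r, 0)) (fderiv ℝ xs (s, 0) (1, 0)) s :=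
    HasFDerivAt.comp_hasDerivAt (l := xs) s (hdxs hs4) (hline s)
  have hu'' : HasDerivAt (fun r ↦ fderiv ℝ xe (r, 0) (1, 0))
      (fderiv ℝ (fun q ↦ fderiv ℝ xe q (1, 0)) (s, 0) (1, 0)) s :=
    HasFDerivAt.comp_hasDerivAt (l := fun q ↦ fderiv ℝ xe q (1, 0)) s hdxes (hline s)
  -- `∂_s ∂_s ∂_ε x = ∂_ε ∂_s ∂_s x`, where the latter is known from the geodesic equation
  have hthird : fderiv ℝ (fun q ↦ fderiv ℝ xe q (1, 0)) (s, 0) (1, 0) =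
      -(fderiv ℝ (christoffelCLM G) (x (s, 0)) (xe (s, 0)) (xs (s, 0)) (xs (s, 0))
        + christoffelCLM G (x (s, 0)) (fderiv ℝ xe (s, 0) (1, 0)) (xs (s, 0))
        + christoffelCLM G (x (s, 0)) (xs (s, 0)) (fderiv ℝ xe (s, 0) (1, 0))) := by
    have h1 : (fun q ↦ fderiv ℝ xe q (1, 0)) =ᶠ[𝓝 (s, 0)] fun q ↦ fderiv ℝ xs q (0, 1) := by
      filter_upwards [hev] with q hq using (hcomm hq).symm
    rw [h1.fderiv_eq]
    have hxs3 : ContDiffAt ℝ 3 xs (s, 0) := hsm _ hs4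
    have hd : HasFDerivAt (fderiv ℝ xs) (fderiv ℝ (fderiv ℝ xs) (s, 0)) (s, 0) :=
      ((hxs3.fderiv_right (m := 2) (by norm_num)).differentiableAt (by norm_num)).hasFDerivAt
    have h2 := (hd.clm_apply (hasFDerivAt_const ((0 : ℝ), (1 : ℝ)) (s, 0))).fderiv
    have h3 := hd.clm_apply (hasFDerivAt_const ((1 : ℝ), (0 : ℝ)) (s, (0 : ℝ)))
    have h8 : HasFDerivAt (fun q ↦ christoffelCLM G (x q))
        (fderiv ℝ (christoffelCLM G) (x (s, 0)) ∘L fderiv ℝ x (s, 0)) (s, 0) :=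
      (h.differentiableAt_christoffel hU).hasFDerivAt.comp (s, (0 : ℝ)) (hdx hs4)
    have h4 := (h8.clm_apply (hdxs hs4)).clm_apply (hdxs hs4)
    have h5 := h3.unique (h4.neg.congr_of_eventuallyEq (by
      filter_upwards [hgeo] with q hq using eq_neg_of_add_eq_zero_left hq))
    have h6 := congrArg (fun A : ℝ × ℝ →L[ℝ] E ↦ A (0, 1)) h5
    have h7 := (hxs3.isSymmSndFDerivAt (by simp; norm_cast)) (0, 1) (1, 0)
    rw [h2]
    simp only [add_apply, neg_apply,
      ContinuousLinearMap.comp_apply, ContinuousLinearMap.flip_apply, zero_apply,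
      map_zero, zero_add] at h6 ⊢
    rw [← h7, h6, hcomm hs4]
    rw [show fderiv ℝ x (s, 0) (0, 1) = xe (s, 0) from rfl]
    abel
  have hcov : (covDeriv G (fun r ↦ x (r, 0)) (fun r ↦ xe (r, 0))) =ᶠ[𝓝 s]
      fun r ↦ fderiv ℝ xe (r, 0) (1, 0) + christoffelCLM G (x (r, 0)) (xs (r, 0)) (xe (r, 0)) := by
    filter_upwards [hevr] with r hr
    rw [covDeriv, (hc hr).deriv, (hu hr).deriv]
  have hcov' := (hu''.add
    (h.hasDerivAt_christoffel hU (hc hs4) hc'' (hu hs4))).congr_of_eventuallyEq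
    hcov
  rw [covDeriv, hcov'.deriv, (hc hs4).deriv, hcov.self_of_nhds, hthird,
    eq_neg_of_add_eq_zero_left hgeo.self_of_nhds, curvatureOf,
    h.fderiv_christoffel_symm hU (xs (s, 0)) (xe (s, 0)),
    h.christoffel_symm hU (xe (s, 0)) (xs (s, 0)),
    h.christoffel_symm hU (fderiv ℝ xe (s, 0) (1, 0)) (xs (s, 0)),
    h.christoffel_symm hU (xe (s, 0)) (christoffelCLM G (x (s, 0)) (xs (s, 0)) (xs (s, 0)))]
  simp only [map_add, map_neg, neg_apply]
  rw [show fderiv ℝ x (s, 0) (1, 0) = xs (s, 0) from rfl]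
  abel

end IsSmoothMetricOn

end Coordinates

/-! ### Passing between the manifold and its charts -/

section Charts

set_option maxSynthPendingDepth 3
set_option linter.unusedSectionVars false

variable {E M : Type*} [NormedAddCommGroup E] [NormedSpace ℝ E]
  [TopologicalSpace M] [ChartedSpace E M] [IsManifold 𝓘(ℝ, E) ∞ M]

instance : IsManifold 𝓘(ℝ, E) 1 M := IsManifold.of_le (n := ∞) ENat.LEInfty.out
instance : IsManifold 𝓘(ℝ, E) 2 M := IsManifold.of_le (n := ∞) ENat.LEInfty.out

/-- A curve in the coordinates of the preferred chart at `x₀`. -/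
def chartCurve (x₀ : M) (γ : ℝ → M) (r : ℝ) : E := extChartAt 𝓘(ℝ, E) x₀ (γ r)

/-- The differential of the preferred chart at `x₀`. -/
def chartDeriv (x₀ x : M) : TangentSpace 𝓘(ℝ, E) x →L[ℝ] E :=
  mfderiv 𝓘(ℝ, E) 𝓘(ℝ, E) (extChartAt 𝓘(ℝ, E) x₀) x

/-- The components of a vector field along a curve in the preferred chart at `x₀`. -/
def chartVec (x₀ : M) (γ : ℝ → M) (V : ∀ s : ℝ, TangentSpace 𝓘(ℝ, E) (γ s)) (r : ℝ) : E :=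
  chartDeriv x₀ (γ r) (V r)

/-- The differential of the inverse of the preferred chart at `x₀`. -/
def chartSymmDeriv (x₀ : M) (y : E) :
    E →L[ℝ] TangentSpace 𝓘(ℝ, E) ((extChartAt 𝓘(ℝ, E) x₀).symm y) :=
  mfderiv 𝓘(ℝ, E) 𝓘(ℝ, E) (extChartAt 𝓘(ℝ, E) x₀).symm y

/-- The change of coordinates from the chart at `x₀` to the chart at `x₁`. -/
def chartChange (x₀ x₁ : M) : E → E :=
  extChartAt 𝓘(ℝ, E) x₁ ∘ (extChartAt 𝓘(ℝ, E) x₀).symm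

lemma isOpen_chart_target (x₀ : M) : IsOpen (extChartAt 𝓘(ℝ, E) x₀).target :=
  isOpen_extChartAt_target x₀

lemma isOpen_chart_source (x₀ : M) : IsOpen (extChartAt 𝓘(ℝ, E) x₀).source :=
  isOpen_extChartAt_source x₀

lemma mdifferentiableAt_chart {x₀ x : M} (hx : x ∈ (extChartAt 𝓘(ℝ, E) x₀).source) :
    MDifferentiableAt 𝓘(ℝ, E) 𝓘(ℝ, E) (extChartAt 𝓘(ℝ, E) x₀) x :=
  mdifferentiableAt_extChartAt (by rwa [extChartAt_source] at hx)

lemma contMDiffAt_chart_symm {x₀ : M} {y : E} (hy : y ∈ (extChartAt 𝓘(ℝ, E) x₀).target) :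
    ContMDiffAt 𝓘(ℝ, E) 𝓘(ℝ, E) ∞ (extChartAt 𝓘(ℝ, E) x₀).symm y :=
  (contMDiffOn_extChartAt_symm x₀).contMDiffAt ((isOpen_chart_target x₀).mem_nhds hy)

lemma contMDiffAt_chart {x₀ x : M} (hx : x ∈ (extChartAt 𝓘(ℝ, E) x₀).source) :
    ContMDiffAt 𝓘(ℝ, E) 𝓘(ℝ, E) ∞ (extChartAt 𝓘(ℝ, E) x₀) x :=
  contMDiffAt_extChartAt' (by rwa [extChartAt_source] at hx)

lemma mdifferentiableAt_chart_symm {x₀ : M} {y : E}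
    (hy : y ∈ (extChartAt 𝓘(ℝ, E) x₀).target) :
    MDifferentiableAt 𝓘(ℝ, E) 𝓘(ℝ, E) (extChartAt 𝓘(ℝ, E) x₀).symm y :=
  (contMDiffAt_chart_symm hy).mdifferentiableAt (by simp)

lemma chartDeriv_chartSymmDeriv {x₀ : M} {y : E} (hy : y ∈ (extChartAt 𝓘(ℝ, E) x₀).target)
    (v : E) : chartDeriv x₀ ((extChartAt 𝓘(ℝ, E) x₀).symm y) (chartSymmDeriv x₀ y v) = v := by
  have h := mfderiv_extChartAt_comp_mfderivWithin_extChartAt_symm (I := 𝓘(ℝ, E)) hy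
  rw [show range 𝓘(ℝ, E) = univ by simp, mfderivWithin_univ] at h
  exact congrArg (fun A : E →L[ℝ] E ↦ A v) h

lemma chartSymmDeriv_chartDeriv {x₀ : M} {y : E} (hy : y ∈ (extChartAt 𝓘(ℝ, E) x₀).target)
    (V : TangentSpace 𝓘(ℝ, E) ((extChartAt 𝓘(ℝ, E) x₀).symm y)) :
    chartSymmDeriv x₀ y (chartDeriv x₀ ((extChartAt 𝓘(ℝ, E) x₀).symm y) V) = V := by
  have h := mfderivWithin_extChartAt_symm_comp_mfderiv_extChartAt (I := 𝓘(ℝ, E)) hy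
  rw [show range 𝓘(ℝ, E) = univ by simp, mfderivWithin_univ] at h
  exact congrArg (fun A : E →L[ℝ] E ↦ A V) h

lemma chartDeriv_self (x : M) (V : TangentSpace 𝓘(ℝ, E) x) : chartDeriv x x V = V := by
  unfold chartDeriv
  rw [mfderiv_extChartAt_self]
  rfl

lemma chartDeriv_injective {x₀ x : M} (hx : x ∈ (extChartAt 𝓘(ℝ, E) x₀).source) :
    Function.Injective (chartDeriv x₀ x : TangentSpace 𝓘(ℝ, E) x → E) :=
  (isInvertible_mfderiv_extChartAt hx).injective

lemma contDiffAt_chartChange {x₀ x₁ : M} {y : E}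
    (hy : y ∈ (extChartAt 𝓘(ℝ, E) x₀).target)
    (hy' : (extChartAt 𝓘(ℝ, E) x₀).symm y ∈ (extChartAt 𝓘(ℝ, E) x₁).source) :
    ContDiffAt ℝ ∞ (chartChange x₀ x₁ : E → E) y :=
  contMDiffAt_iff_contDiffAt.1
    (ContMDiffAt.comp y (contMDiffAt_chart hy') (contMDiffAt_chart_symm hy))

lemma fderiv_chartChange {x₀ x₁ : M} {y : E}
    (hy : y ∈ (extChartAt 𝓘(ℝ, E) x₀).target)
    (hy' : (extChartAt 𝓘(ℝ, E) x₀).symm y ∈ (extChartAt 𝓘(ℝ, E) x₁).source) (v : E) :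
    fderiv ℝ (chartChange x₀ x₁ : E → E) y v =
      chartDeriv x₁ ((extChartAt 𝓘(ℝ, E) x₀).symm y) (chartSymmDeriv x₀ y v) := by
  rw [← mfderiv_eq_fderiv, chartChange,
    mfderiv_comp y (mdifferentiableAt_chart hy') (mdifferentiableAt_chart_symm hy)]
  rfl

lemma fderiv_chartChange_chartDeriv {x₀ x₁ x : M}
    (hx : x ∈ (extChartAt 𝓘(ℝ, E) x₀).source) (hx' : x ∈ (extChartAt 𝓘(ℝ, E) x₁).source)
    (V : TangentSpace 𝓘(ℝ, E) x) :
    fderiv ℝ (chartChange x₀ x₁ : E → E) (extChartAt 𝓘(ℝ, E) x₀ x) (chartDeriv x₀ x V) =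
      chartDeriv x₁ x V := by
  obtain ⟨y, hy, rfl⟩ : ∃ y ∈ (extChartAt 𝓘(ℝ, E) x₀).target,
      (extChartAt 𝓘(ℝ, E) x₀).symm y = x :=
    ⟨_, (extChartAt 𝓘(ℝ, E) x₀).map_source hx, (extChartAt 𝓘(ℝ, E) x₀).left_inv hx⟩
  rw [(extChartAt 𝓘(ℝ, E) x₀).right_inv hy, fderiv_chartChange hy hx',
    chartSymmDeriv_chartDeriv hy]

lemma fderiv_chartChange_surjective {x₀ x₁ x : M}
    (hx : x ∈ (extChartAt 𝓘(ℝ, E) x₀).source) (hx' : x ∈ (extChartAt 𝓘(ℝ, E) x₁).source) :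
    Function.Surjective (fderiv ℝ (chartChange x₀ x₁ : E → E) (extChartAt 𝓘(ℝ, E) x₀ x)) := by
  intro v
  obtain ⟨V, hV⟩ := (isInvertible_mfderiv_extChartAt (I := 𝓘(ℝ, E)) hx').surjective v
  exact ⟨chartDeriv x₀ x V, (fderiv_chartChange_chartDeriv hx hx' V).trans hV⟩

/-- Smoothness of a map into the tangent bundle, read off in a chart. -/
lemma contMDiffAt_tangentBundle_iff {F N : Type*} [NormedAddCommGroup F] [NormedSpace ℝ F]
    [TopologicalSpace N] [ChartedSpace F N] {n : WithTop ℕ∞} [IsManifold 𝓘(ℝ, E) (n + 1) M]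
    {f : N → TangentBundle 𝓘(ℝ, E) M} {q : N} {x₀ : M}
    (hq : (f q).proj ∈ (extChartAt 𝓘(ℝ, E) x₀).source) :
    ContMDiffAt 𝓘(ℝ, F) 𝓘(ℝ, E).tangent n f q ↔
      ContMDiffAt 𝓘(ℝ, F) 𝓘(ℝ, E) n (fun x ↦ (f x).proj) q ∧
      ContMDiffAt 𝓘(ℝ, F) 𝓘(ℝ, E) n (fun x ↦ chartDeriv x₀ (f x).proj (f x).2) q := by
  have : ContMDiffVectorBundle n E (TangentSpace 𝓘(ℝ, E) : M → Type _) 𝓘(ℝ, E) :=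
    TangentBundle.contMDiffVectorBundle
  rw [(trivializationAt E (TangentSpace 𝓘(ℝ, E)) x₀).contMDiffAt_iff (n := n)
    (by rwa [Bundle.Trivialization.mem_source, TangentBundle.trivializationAt_baseSet,
      ← extChartAt_source 𝓘(ℝ, E)])]
  refine and_congr_right fun h ↦ ?_
  have hev : ∀ᶠ x in 𝓝 q, (f x).proj ∈ (extChartAt 𝓘(ℝ, E) x₀).source :=
    h.continuousAt.eventually ((isOpen_chart_source x₀).mem_nhds hq)
  have heq : (fun x ↦ (trivializationAt E (TangentSpace 𝓘(ℝ, E)) x₀ (f x)).2) =ᶠ[𝓝 q]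
      fun x ↦ chartDeriv x₀ (f x).proj (f x).2 := by
    filter_upwards [hev] with x hx
    have hx' : (f x).proj ∈ (chartAt E x₀).source := by rwa [extChartAt_source] at hx
    have hb : (f x).proj ∈ (trivializationAt E (TangentSpace 𝓘(ℝ, E)) x₀).baseSet := by
      rwa [TangentBundle.trivializationAt_baseSet]
    unfold chartDeriv
    rw [← TangentBundle.continuousLinearMapAt_trivializationAt hx',
      Bundle.Trivialization.continuousLinearMapAt_apply,
      Bundle.Trivialization.linearMapAt_apply, if_pos hb]
  exact ⟨fun h ↦ h.congr_of_eventuallyEq heq.symm, fun h ↦ h.congr_of_eventuallyEq heq⟩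

lemma contDiffAt_chartCurve {γ : ℝ → M} {s : ℝ} {n : WithTop ℕ∞} (hn : n ≤ (∞ : WithTop ℕ∞))
    (hγ : ContMDiffAt 𝓘(ℝ, ℝ) 𝓘(ℝ, E) n γ s) {x₀ : M}
    (hx : γ s ∈ (extChartAt 𝓘(ℝ, E) x₀).source) : ContDiffAt ℝ n (chartCurve x₀ γ : ℝ → E) s :=
  contMDiffAt_iff_contDiffAt.1 (ContMDiffAt.comp s ((contMDiffAt_chart hx).of_le hn) hγ)

lemma eventually_mem_source {γ : ℝ → M} {s : ℝ} (hγ : ContinuousAt γ s) {x₀ : M}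
    (hx : γ s ∈ (extChartAt 𝓘(ℝ, E) x₀).source) :
    ∀ᶠ r in 𝓝 s, γ r ∈ (extChartAt 𝓘(ℝ, E) x₀).source :=
  hγ.eventually ((isOpen_chart_source x₀).mem_nhds hx)

lemma chartVec_velocity {γ : ℝ → M} {s : ℝ} (hγ : MDifferentiableAt 𝓘(ℝ, ℝ) 𝓘(ℝ, E) γ s) {x₀ : M}
    (hx : γ s ∈ (extChartAt 𝓘(ℝ, E) x₀).source) :
    chartVec x₀ γ (velocity γ) s = deriv (chartCurve x₀ γ : ℝ → E) s := by
  have h1 := mfderiv_comp s (mdifferentiableAt_chart hx) hγ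
  have h2 : deriv (chartCurve x₀ γ : ℝ → E) s =
      mfderiv 𝓘(ℝ, ℝ) 𝓘(ℝ, E) (extChartAt 𝓘(ℝ, E) x₀ ∘ γ) s (1 : ℝ) := by
    rw [mfderiv_eq_fderiv]
    exact fderiv_apply_one_eq_deriv.symm
  rw [h2, h1]
  rfl

lemma chart_symm_chartCurve {γ : ℝ → M} {x₀ : M} {r : ℝ}
    (hx : γ r ∈ (extChartAt 𝓘(ℝ, E) x₀).source) :
    (extChartAt 𝓘(ℝ, E) x₀).symm (chartCurve x₀ γ r) = γ r :=
  (extChartAt 𝓘(ℝ, E) x₀).left_inv hx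

lemma chartCurve_change {γ : ℝ → M} {x₀ x₁ : M} {r : ℝ}
    (hx : γ r ∈ (extChartAt 𝓘(ℝ, E) x₀).source) :
    (chartCurve x₁ γ r : E) = chartChange x₀ x₁ (chartCurve x₀ γ r : E) := by
  simp only [chartCurve, chartChange, Function.comp_apply, (extChartAt 𝓘(ℝ, E) x₀).left_inv hx]

lemma chartVec_change {γ : ℝ → M} {V : ∀ s : ℝ, TangentSpace 𝓘(ℝ, E) (γ s)} {x₀ x₁ : M} {r : ℝ}
    (hx : γ r ∈ (extChartAt 𝓘(ℝ, E) x₀).source) (hx' : γ r ∈ (extChartAt 𝓘(ℝ, E) x₁).source) :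
    chartVec x₁ γ V r = fderiv ℝ (chartChange x₀ x₁) (chartCurve x₀ γ r) (chartVec x₀ γ V r) :=
  (fderiv_chartChange_chartDeriv hx hx' _).symm

lemma differentiableAt_chartVec_change {γ : ℝ → M} {V : ∀ s : ℝ, TangentSpace 𝓘(ℝ, E) (γ s)}
    {x₀ x₁ : M} {s : ℝ} (hγ : ContMDiffAt 𝓘(ℝ, ℝ) 𝓘(ℝ, E) 1 γ s)
    (hx : γ s ∈ (extChartAt 𝓘(ℝ, E) x₀).source) (hx' : γ s ∈ (extChartAt 𝓘(ℝ, E) x₁).source)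
    (hV : DifferentiableAt ℝ (chartVec x₀ γ V) s) : DifferentiableAt ℝ (chartVec x₁ γ V) s := by
  have h1 := (contDiffAt_chartCurve ENat.LEInfty.out hγ hx).differentiableAt one_ne_zero
  have h2 : ContDiffAt ℝ ∞ (fderiv ℝ (chartChange x₀ x₁ : E → E)) (chartCurve x₀ γ s) :=
    (contDiffAt_chartChange ((extChartAt 𝓘(ℝ, E) x₀).map_source hx)
      (by rwa [(extChartAt 𝓘(ℝ, E) x₀).left_inv hx])).fderiv_right (by simp)
  refine ((DifferentiableAt.comp s (h2.differentiableAt (by simp)) h1).clm_apply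
    hV).congr_of_eventuallyEq ?_
  filter_upwards [eventually_mem_source hγ.continuousAt hx,
    eventually_mem_source hγ.continuousAt hx'] with r hr hr'
  exact chartVec_change hr hr'

namespace LorentzianMetric

variable (g : LorentzianMetric E M)

lemma nondegenerate (x : M) (v : TangentSpace 𝓘(ℝ, E) x) (h : ∀ w, g.inner x v w = 0) : v = 0 := by
  obtain ⟨u, -, hu⟩ := g.lorentzian x
  by_contra hv
  exact (hu v (by rw [g.symm, h]) hv).ne' (h v)

lemma coordMetric_apply (x₀ : M) (y v w : E) :
    g.coordMetric x₀ y v w = g.inner ((extChartAt 𝓘(ℝ, E) x₀).symm y)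
      (chartSymmDeriv x₀ y v) (chartSymmDeriv x₀ y w) := rfl

lemma inner_eq_coordMetric {x₀ x : M} (hx : x ∈ (extChartAt 𝓘(ℝ, E) x₀).source)
    (V W : TangentSpace 𝓘(ℝ, E) x) :
    g.inner x V W = g.coordMetric x₀ (extChartAt 𝓘(ℝ, E) x₀ x) (chartDeriv x₀ x V)
      (chartDeriv x₀ x W) := by
  obtain ⟨y, hy, rfl⟩ : ∃ y ∈ (extChartAt 𝓘(ℝ, E) x₀).target,
      (extChartAt 𝓘(ℝ, E) x₀).symm y = x :=
    ⟨_, (extChartAt 𝓘(ℝ, E) x₀).map_source hx, (extChartAt 𝓘(ℝ, E) x₀).left_inv hx⟩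
  rw [(extChartAt 𝓘(ℝ, E) x₀).right_inv hy, coordMetric_apply, chartSymmDeriv_chartDeriv hy,
    chartSymmDeriv_chartDeriv hy]

lemma coordMetric_self (x : M) (V W : TangentSpace 𝓘(ℝ, E) x) :
    g.coordMetric x (extChartAt 𝓘(ℝ, E) x x) V W = g.inner x V W := by
  rw [g.inner_eq_coordMetric (mem_extChartAt_source x), chartDeriv_self, chartDeriv_self]

variable [FiniteDimensional ℝ E]

/-- Constant vector fields in a chart are smooth. -/
lemma _root_.NullConjugacy.contMDiffAt_chartSymmDeriv {x₀ : M} {y : E}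
    (hy : y ∈ (extChartAt 𝓘(ℝ, E) x₀).target) (v : E) :
    ContMDiffAt 𝓘(ℝ, E) 𝓘(ℝ, E).tangent ∞
      (fun y ↦ (⟨(extChartAt 𝓘(ℝ, E) x₀).symm y, chartSymmDeriv x₀ y v⟩ :
        TangentBundle 𝓘(ℝ, E) M)) y := by
  have : IsManifold 𝓘(ℝ, E) ((∞ : WithTop ℕ∞) + 1) M := by simpa
  rw [contMDiffAt_tangentBundle_iff (x₀ := x₀) ((extChartAt 𝓘(ℝ, E) x₀).map_target hy)]
  refine ⟨contMDiffAt_chart_symm hy, contMDiffAt_const (c := v) |>.congr_of_eventuallyEq ?_⟩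
  filter_upwards [(isOpen_chart_target x₀).mem_nhds hy] with z hz
  exact chartDeriv_chartSymmDeriv hz v

lemma contDiffAt_coordMetric_apply {x₀ : M} {y : E}
    (hy : y ∈ (extChartAt 𝓘(ℝ, E) x₀).target) (v w : E) :
    ContDiffAt ℝ ∞ (fun y ↦ g.coordMetric x₀ y v w) y := by
  have hg := ContMDiffAt.comp y (g.contMDiff.contMDiffAt) (contMDiffAt_chart_symm hy)
  have h : ContMDiffAt 𝓘(ℝ, E) (𝓘(ℝ, E).prod 𝓘(ℝ)) ∞
      (fun m ↦ Bundle.TotalSpace.mk' ℝ (E := Bundle.Trivial M ℝ)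
        ((extChartAt 𝓘(ℝ, E) x₀).symm m) (g.inner ((extChartAt 𝓘(ℝ, E) x₀).symm m)
          (chartSymmDeriv x₀ m v) (chartSymmDeriv x₀ m w))) y := by
    apply ContMDiffAt.clm_bundle_apply₂ (F₁ := E) (F₂ := E)
    · exact hg
    · exact contMDiffAt_chartSymmDeriv hy v
    · exact contMDiffAt_chartSymmDeriv hy w
  rw [Bundle.contMDiffAt_totalSpace] at h
  exact contMDiffAt_iff_contDiffAt.1 h.2

lemma coordMetric_symm (x₀ : M) (y v w : E) :
    g.coordMetric x₀ y v w = g.coordMetric x₀ y w v := by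
  rw [coordMetric_apply, coordMetric_apply, g.symm]

lemma coordMetric_nondegenerate {x₀ : M} {y : E} (hy : y ∈ (extChartAt 𝓘(ℝ, E) x₀).target) (v : E)
    (hv : ∀ w, g.coordMetric x₀ y v w = 0) : v = 0 := by
  have h1 : chartSymmDeriv x₀ y v = 0 := g.nondegenerate _ _ fun W ↦ by
    have h2 := hv (chartDeriv x₀ _ W)
    rwa [coordMetric_apply, chartSymmDeriv_chartDeriv hy W] at h2
  rw [← chartDeriv_chartSymmDeriv hy v, h1, map_zero]

lemma contDiffOn_coordMetric (x₀ : M) :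
    ContDiffOn ℝ ∞ (g.coordMetric x₀) (extChartAt 𝓘(ℝ, E) x₀).target :=
  contDiffOn_clm_apply.2 fun v ↦ contDiffOn_clm_apply.2 fun w _ hy ↦
    (g.contDiffAt_coordMetric_apply hy v w).contDiffWithinAt

lemma isSmoothMetricOn (x₀ : M) :
    IsSmoothMetricOn (g.coordMetric x₀) (extChartAt 𝓘(ℝ, E) x₀).target :=
  ⟨isOpen_chart_target x₀, g.contDiffOn_coordMetric x₀, fun y _ ↦ g.coordMetric_symm x₀ y,
    fun _ hy ↦ g.coordMetric_nondegenerate hy⟩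

lemma curvature_eq (x : M) (X Y Z : TangentSpace 𝓘(ℝ, E) x) :
    g.curvature x X Y Z = curvatureOf (g.coordMetric x) (extChartAt 𝓘(ℝ, E) x x) X Y Z := by
  have hΓ := ((g.isSmoothMetricOn x).differentiableAt_christoffel
    (mem_extChartAt_target x)).hasFDerivAt
  have h (v w u : E) : fderiv ℝ (fun y ↦ g.christoffel x y v w) (extChartAt 𝓘(ℝ, E) x x) u =
      fderiv ℝ (christoffelCLM (g.coordMetric x)) (extChartAt 𝓘(ℝ, E) x x) u v w := by
    have := ((hΓ.clm_apply (hasFDerivAt_const v _)).clm_apply (hasFDerivAt_const w _)).fderiv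
    have h2 := congrArg (fun A : E →L[ℝ] E ↦ A u) this
    simp only [ContinuousLinearMap.comp_zero, zero_add, ContinuousLinearMap.flip_apply] at h2
    exact h2
  unfold curvatureOf
  rw [← h Y Z X, ← h X Z Y]
  rfl

lemma coordMetric_change {x₀ x₁ x : M}
    (hx : x ∈ (extChartAt 𝓘(ℝ, E) x₀).source) (hx' : x ∈ (extChartAt 𝓘(ℝ, E) x₁).source) :
    ∀ᶠ y in 𝓝 (extChartAt 𝓘(ℝ, E) x₀ x), ∀ v w, g.coordMetric x₀ y v w =
      g.coordMetric x₁ (chartChange x₀ x₁ y) (fderiv ℝ (chartChange x₀ x₁) y v)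
        (fderiv ℝ (chartChange x₀ x₁) y w) := by
  have hxt := (extChartAt 𝓘(ℝ, E) x₀).map_source hx
  have h1 : ∀ᶠ y in 𝓝 (extChartAt 𝓘(ℝ, E) x₀ x),
      (extChartAt 𝓘(ℝ, E) x₀).symm y ∈ (extChartAt 𝓘(ℝ, E) x₁).source := by
    refine (contMDiffAt_chart_symm hxt).continuousAt.eventually
      ((isOpen_chart_source x₁).mem_nhds ?_)
    rwa [(extChartAt 𝓘(ℝ, E) x₀).left_inv hx]
  filter_upwards [h1, (isOpen_chart_target x₀).mem_nhds hxt] with y hy hyt v w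
  rw [coordMetric_apply, g.inner_eq_coordMetric hy, fderiv_chartChange hyt hy,
    fderiv_chartChange hyt hy]
  rfl

/-- The covariant derivative along a curve, computed in an arbitrary chart. -/
lemma chartDeriv_covDerivAlong {γ : ℝ → M} {V : ∀ s : ℝ, TangentSpace 𝓘(ℝ, E) (γ s)} {s : ℝ}
    {x₀ : M} (hγ : ContMDiffAt 𝓘(ℝ, ℝ) 𝓘(ℝ, E) 1 γ s)
    (hx : γ s ∈ (extChartAt 𝓘(ℝ, E) x₀).source) (hV : DifferentiableAt ℝ (chartVec x₀ γ V) s) :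
    chartDeriv x₀ (γ s) (g.covDerivAlong γ V s) =
      covDeriv (g.coordMetric x₀) (chartCurve x₀ γ) (chartVec x₀ γ V) s := by
  have hself := mem_extChartAt_source (I := 𝓘(ℝ, E)) (γ s)
  have hcov : g.covDerivAlong γ V s =
      covDeriv (g.coordMetric (γ s)) (chartCurve (γ s) γ) (chartVec (γ s) γ V) s := by
    have h1 := chartVec_velocity (hγ.mdifferentiableAt one_ne_zero) hself
    rw [chartVec, chartDeriv_self] at h1
    have h2 : chartVec (γ s) γ V s = V s := chartDeriv_self _ _
    rw [covDeriv, ← h1, h2]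
    rfl
  have h2 := (g.isSmoothMetricOn x₀).covDeriv_transform (g.isSmoothMetricOn (γ s))
    (φ := chartChange x₀ (γ s)) (c := chartCurve x₀ γ) (u := chartVec x₀ γ V)
    (c₁ := chartCurve (γ s) γ) (u₁ := chartVec (γ s) γ V) (s := s)
    ((extChartAt 𝓘(ℝ, E) x₀).map_source hx)
    (contDiffAt_chartChange ((extChartAt 𝓘(ℝ, E) x₀).map_source hx)
      (by rw [chart_symm_chartCurve hx]; exact hself))
    (by rw [← chartCurve_change hx]; exact (extChartAt 𝓘(ℝ, E) (γ s)).map_source hself)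
    (fderiv_chartChange_surjective hx hself) (g.coordMetric_change hx hself)
    ((contDiffAt_chartCurve ENat.LEInfty.out hγ hx).differentiableAt one_ne_zero) hV
    (by
      filter_upwards [eventually_mem_source hγ.continuousAt hx] with r hr
      exact chartCurve_change hr)
    (by
      filter_upwards [eventually_mem_source hγ.continuousAt hx,
        eventually_mem_source hγ.continuousAt hself] with r hr hr'
      exact chartVec_change hr hr')
  have h3 : fderiv ℝ (chartChange x₀ (γ s)) (chartCurve x₀ γ s)
      (chartDeriv x₀ (γ s) (g.covDerivAlong γ V s)) = g.covDerivAlong γ V s :=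
    (fderiv_chartChange_chartDeriv hx hself _).trans (chartDeriv_self _ _)
  have hinj : Function.Injective (fderiv ℝ (chartChange x₀ (γ s)) (chartCurve x₀ γ s)) :=
    (LinearMap.injective_iff_surjective (f := (fderiv ℝ (chartChange x₀ (γ s))
      (chartCurve x₀ γ s)).toLinearMap)).2 (fderiv_chartChange_surjective hx hself)
  exact hinj (h3.trans (hcov.trans h2))

/-- The vector field `V` along `γ` is differentiable at parameter `s`, expressed in the preferred
chart at `γ s`. -/
def DiffAlong (γ : ℝ → M) (V : ∀ s : ℝ, TangentSpace 𝓘(ℝ, E) (γ s)) (s : ℝ) : Prop :=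
  DifferentiableAt ℝ (chartVec (γ s) γ V) s

/-- The Levi-Civita connection is metric. -/
lemma hasDerivAt_inner {γ : ℝ → M} {V W : ∀ s : ℝ, TangentSpace 𝓘(ℝ, E) (γ s)} {s : ℝ}
    (hγ : ContMDiffAt 𝓘(ℝ, ℝ) 𝓘(ℝ, E) 1 γ s) (hV : DiffAlong γ V s) (hW : DiffAlong γ W s) :
    HasDerivAt (fun r ↦ g.inner (γ r) (V r) (W r))
      (g.inner (γ s) (g.covDerivAlong γ V s) (W s)
        + g.inner (γ s) (V s) (g.covDerivAlong γ W s)) s := by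
  have hself := mem_extChartAt_source (I := 𝓘(ℝ, E)) (γ s)
  have h1 := (g.isSmoothMetricOn (γ s)).hasDerivAt_inner (c := chartCurve (γ s) γ)
    (u := chartVec (γ s) γ V) (w := chartVec (γ s) γ W) (s := s)
    ((extChartAt 𝓘(ℝ, E) (γ s)).map_source hself)
    ((contDiffAt_chartCurve ENat.LEInfty.out hγ hself).differentiableAt one_ne_zero) hV hW
  rw [g.inner_eq_coordMetric hself, g.inner_eq_coordMetric hself,
    g.chartDeriv_covDerivAlong hγ hself hV, g.chartDeriv_covDerivAlong hγ hself hW]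
  refine h1.congr_of_eventuallyEq ?_
  filter_upwards [eventually_mem_source hγ.continuousAt hself] with r hr
  exact g.inner_eq_coordMetric hr _ _

end LorentzianMetric

end Charts

/-! ### Vector fields along curves -/

section Along

set_option maxSynthPendingDepth 3
set_option linter.unusedSectionVars false

variable {E M : Type*} [NormedAddCommGroup E] [NormedSpace ℝ E]
  [TopologicalSpace M] [ChartedSpace E M] [IsManifold 𝓘(ℝ, E) ∞ M]

lemma contDiffAt_deriv {f : ℝ → E} {s : ℝ} (hf : ContDiffAt ℝ 2 f s) :
    ContDiffAt ℝ 1 (deriv f) s :=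
  (hf.fderiv_right (m := 1) (by norm_num)).clm_apply contDiffAt_const

lemma eventually_contMDiffAt {γ : ℝ → M} {s : ℝ} (hγ : ContMDiffAt 𝓘(ℝ, ℝ) 𝓘(ℝ, E) 2 γ s) :
    ∀ᶠ r in 𝓝 s, ContMDiffAt 𝓘(ℝ, ℝ) 𝓘(ℝ, E) 2 γ r :=
  (contMDiffAt_iff_contMDiffAt_nhds (by simp)).1 hγ

/-- The differential of a function, with values in `ℝ`. -/
def differential (t : M → ℝ) (x : M) : TangentSpace 𝓘(ℝ, E) x →L[ℝ] ℝ :=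
  mfderiv 𝓘(ℝ, E) 𝓘(ℝ, ℝ) t x

lemma covDeriv_smul (G : E → E →L[ℝ] E →L[ℝ] ℝ) (c : ℝ → E) {u : ℝ → E} {s : ℝ}
    (hu : DifferentiableAt ℝ u s) {f : ℝ → ℝ} {f' : ℝ} (hf : HasDerivAt f f' s) :
    covDeriv G c (fun r ↦ f r • u r) s = f' • u s + f s • covDeriv G c u s := by
  rw [covDeriv, covDeriv, show deriv (fun r ↦ f r • u r) s = _ from
    (hf.smul hu.hasDerivAt).deriv, map_smul]
  module

namespace LorentzianMetric

variable (g : LorentzianMetric E M) [FiniteDimensional ℝ E]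

variable {γ : ℝ → M} {V W : ∀ s : ℝ, TangentSpace 𝓘(ℝ, E) (γ s)} {s : ℝ}

lemma covDerivAlong_congr (h : ∀ᶠ r in 𝓝 s, V r = W r) :
    g.covDerivAlong γ V s = g.covDerivAlong γ W s := by
  have h1 : (fun r ↦ chartDeriv (γ s) (γ r) (V r)) =ᶠ[𝓝 s]
      fun r ↦ chartDeriv (γ s) (γ r) (W r) := by
    filter_upwards [h] with r hr
    rw [hr]
  have h2 := h1.deriv_eq
  have h3 := h.self_of_nhds
  unfold covDerivAlong
  rw [h3]
  exact congrArg (· + g.christoffel (γ s) (extChartAt 𝓘(ℝ, E) (γ s) (γ s)) (velocity γ s) (W s)) h2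

lemma covDerivAlong_eq_covDeriv (hγ : ContMDiffAt 𝓘(ℝ, ℝ) 𝓘(ℝ, E) 1 γ s) (hV : DiffAlong γ V s) :
    g.covDerivAlong γ V s =
      covDeriv (g.coordMetric (γ s)) (chartCurve (γ s) γ) (chartVec (γ s) γ V) s := by
  rw [← g.chartDeriv_covDerivAlong hγ (mem_extChartAt_source _) hV, chartDeriv_self]

lemma covDerivAlong_smul (hγ : ContMDiffAt 𝓘(ℝ, ℝ) 𝓘(ℝ, E) 1 γ s) (hV : DiffAlong γ V s)
    {f : ℝ → ℝ} {f' : ℝ} (hf : HasDerivAt f f' s) :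
    g.covDerivAlong γ (fun r ↦ f r • V r) s = f' • V s + f s • g.covDerivAlong γ V s := by
  have h1 : chartVec (γ s) γ (fun r ↦ f r • V r) = fun r ↦ f r • chartVec (γ s) γ V r := by
    ext r
    simp only [chartVec, map_smul]
  have h2 : DiffAlong γ (fun r ↦ f r • V r) s := by
    rw [DiffAlong, h1]
    exact hf.differentiableAt.smul hV
  have h3 := covDeriv_smul (g.coordMetric (γ s)) (chartCurve (γ s) γ) hV hf
  have h4 : chartVec (γ s) γ V s = V s := chartDeriv_self _ _
  rw [h4, ← h1, ← g.covDerivAlong_eq_covDeriv hγ h2, ← g.covDerivAlong_eq_covDeriv hγ hV] at h3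
  exact h3

/-- The covariant derivative of a `C²` vector field along a `C²` curve is `C¹`. -/
lemma contDiffAt_chartVec_covDerivAlong {x₀ : M} (hγ : ContMDiffAt 𝓘(ℝ, ℝ) 𝓘(ℝ, E) 2 γ s)
    (hx : γ s ∈ (extChartAt 𝓘(ℝ, E) x₀).source) (hV : ContDiffAt ℝ 2 (chartVec x₀ γ V) s) :
    ContDiffAt ℝ 1 (chartVec x₀ γ (g.covDerivAlong γ V)) s := by
  have hc := contDiffAt_chartCurve ENat.LEInfty.out hγ hx
  have hc' : ContDiffAt ℝ 1 (deriv (chartCurve x₀ γ : ℝ → E)) s :=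
    contDiffAt_deriv hc
  have hV' : ContDiffAt ℝ 1 (deriv (chartVec x₀ γ V)) s := contDiffAt_deriv hV
  have hΓ := (g.isSmoothMetricOn x₀).contDiffAt_christoffel
    ((extChartAt 𝓘(ℝ, E) x₀).map_source hx)
  have hΓc : ContDiffAt ℝ 1 (fun r ↦ christoffelCLM (g.coordMetric x₀) (chartCurve x₀ γ r)) s :=
    ContDiffAt.comp (g := christoffelCLM (g.coordMetric x₀)) s (hΓ.of_le ENat.LEInfty.out)
      (hc.of_le one_le_two)
  refine (hV'.add ((hΓc.clm_apply hc').clm_apply (hV.of_le one_le_two))).congr_of_eventuallyEq ?_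
  filter_upwards [eventually_contMDiffAt hγ, eventually_mem_source hγ.continuousAt hx,
    hV.eventually (by simp)] with r hr hrx hVr
  exact g.chartDeriv_covDerivAlong (hr.of_le one_le_two) hrx
    (hVr.differentiableAt (by simp))

lemma diffAlong_velocity {γ : ℝ → M} {s : ℝ} (hγ : ContMDiffAt 𝓘(ℝ, ℝ) 𝓘(ℝ, E) 2 γ s) :
    DiffAlong γ (velocity (E := E) γ) s := by
  have hself := mem_extChartAt_source (I := 𝓘(ℝ, E)) (γ s)
  have hc := contDiffAt_chartCurve ENat.LEInfty.out hγ hself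
  have hc' : ContDiffAt ℝ 1 (deriv (chartCurve (γ s) γ : ℝ → E)) s := contDiffAt_deriv hc
  refine (hc'.differentiableAt one_ne_zero).congr_of_eventuallyEq ?_
  filter_upwards [eventually_contMDiffAt hγ, eventually_mem_source hγ.continuousAt hself]
    with r hr hrx
  exact chartVec_velocity (hr.mdifferentiableAt (by simp)) hrx

lemma contMDiffAt_along {J : ∀ s : ℝ, TangentSpace 𝓘(ℝ, E) (γ s)}
    (hJ : ContMDiffAt 𝓘(ℝ, ℝ) 𝓘(ℝ, E).tangent 2
      (fun r ↦ (⟨γ r, J r⟩ : TangentBundle 𝓘(ℝ, E) M)) s) :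
    ContMDiffAt 𝓘(ℝ, ℝ) 𝓘(ℝ, E) 2 γ s ∧ ContDiffAt ℝ 2 (chartVec (γ s) γ J) s := by
  have : IsManifold 𝓘(ℝ, E) (2 + 1) M := IsManifold.of_le (n := ∞)
    (by rw [show (2 : WithTop ℕ∞) + 1 = 3 by norm_num]; exact ENat.LEInfty.out)
  obtain ⟨h1, h2⟩ := (contMDiffAt_tangentBundle_iff (x₀ := γ s)
    (mem_extChartAt_source (I := 𝓘(ℝ, E)) (γ s))).1 hJ
  exact ⟨h1, contMDiffAt_iff_contDiffAt.1 h2⟩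

/-! ### Algebraic properties of the curvature tensor -/

lemma _root_.NullConjugacy.curvatureOf_smul (G : E → E →L[ℝ] E →L[ℝ] ℝ) (y : E) (c : ℝ)
    (X Y Z : E) : curvatureOf G y (c • X) Y Z = c • curvatureOf G y X Y Z := by
  simp only [curvatureOf, map_smul, smul_apply, smul_add, smul_sub]

lemma inner_curvature_antisymm (x : M) (X Y Z W : TangentSpace 𝓘(ℝ, E) x) :
    g.inner x (g.curvature x X Y Z) W = -g.inner x (g.curvature x X Y W) Z := by
  rw [← g.coordMetric_self, ← g.coordMetric_self, g.curvature_eq, g.curvature_eq]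
  exact (g.isSmoothMetricOn x).inner_curvatureOf_antisymm (mem_extChartAt_target x) X Y Z W

lemma curvature_antisymm (x : M) (X Y Z : TangentSpace 𝓘(ℝ, E) x) :
    g.curvature x X Y Z = -g.curvature x Y X Z := by
  rw [g.curvature_eq, g.curvature_eq]
  unfold curvatureOf
  abel

lemma inner_curvature_jacobi (x : M) (X Y : TangentSpace 𝓘(ℝ, E) x) :
    g.inner x (g.curvature x Y X X) Y = g.inner x (g.curvature x X Y Y) X := by
  rw [g.inner_curvature_antisymm, g.curvature_antisymm x Y X Y]
  simp

lemma inner_curvature_self (x : M) (X Y Z : TangentSpace 𝓘(ℝ, E) x) :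
    g.inner x (g.curvature x X Y Z) Z = 0 := by
  have := g.inner_curvature_antisymm x X Y Z Z
  linarith

lemma curvature_smul₁ (x : M) (c : ℝ) (X Y Z : TangentSpace 𝓘(ℝ, E) x) :
    g.curvature x (c • X) Y Z = c • g.curvature x X Y Z := by
  rw [g.curvature_eq, g.curvature_eq]
  exact curvatureOf_smul (E := E) _ _ c X Y Z

lemma curvature_self (x : M) (X Z : TangentSpace 𝓘(ℝ, E) x) : g.curvature x X X Z = 0 := by
  rw [g.curvature_eq]
  unfold curvatureOf
  abel

lemma inner_curvature_smul (x : M) (c : ℝ) (X Y : TangentSpace 𝓘(ℝ, E) x) :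
    g.inner x (g.curvature x (c • X) Y Y) (c • X) =
      c ^ 2 * g.inner x (g.curvature x X Y Y) X := by
  rw [curvature_smul₁]
  simp only [map_smul, smul_apply, smul_eq_mul]
  ring

/-! ### Lorentzian linear algebra -/

lemma inner_pos_or (x : M) : ∃ u : TangentSpace 𝓘(ℝ, E) x,
    ∀ w : TangentSpace 𝓘(ℝ, E) x, g.inner x u w = 0 → 0 ≤ g.inner x w w ∧
      (g.inner x w w = 0 → w = 0) := by
  obtain ⟨u, -, hu⟩ := g.lorentzian x
  refine ⟨u, fun w hw ↦ ?_⟩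
  by_cases h : w = 0
  · simp [h]
  · exact ⟨(hu w hw h).le, fun h' ↦ absurd h' (hu w hw h).ne'⟩

/-- A vector orthogonal to a nonzero null vector is spacelike or a multiple of it. -/
lemma orthogonal_null {x : M} {X Y : TangentSpace 𝓘(ℝ, E) x} (hX : X ≠ 0)
    (hXX : g.inner x X X = 0) (hXY : g.inner x X Y = 0) :
    0 ≤ g.inner x Y Y ∧ (g.inner x Y Y = 0 → ∃ c : ℝ, Y = c • X) := by
  obtain ⟨u, hu⟩ := g.inner_pos_or x
  have huX : g.inner x u X ≠ 0 := fun h ↦ hX ((hu X h).2 hXX)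
  set c := g.inner x u Y / g.inner x u X with hc
  have h1 : g.inner x u (Y - c • X) = 0 := by
    simp only [map_sub, map_smul, smul_eq_mul, hc]
    field_simp
    ring
  have h2 : g.inner x (Y - c • X) (Y - c • X) = g.inner x Y Y := by
    simp only [map_sub, map_smul, smul_eq_mul, sub_apply,
      smul_apply, hXX, hXY, g.symm x Y X]
    ring
  have h3 := hu _ h1
  rw [h2] at h3
  exact ⟨h3.1, fun h ↦ ⟨c, sub_eq_zero.1 (h3.2 h)⟩⟩

lemma inner_timelike_null_ne_zero {x : M} {T X : TangentSpace 𝓘(ℝ, E) x}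
    (hT : g.inner x T T < 0) (hX : X ≠ 0) (hXX : g.inner x X X = 0) : g.inner x T X ≠ 0 := by
  intro h
  have h1 := (g.orthogonal_null hX hXX (Y := T) (by rw [g.symm, h])).1
  linarith

/-- Two timelike vectors in the same cone have products of the same sign with a null vector. -/
lemma inner_null_pos {x : M} {T F X : TangentSpace 𝓘(ℝ, E) x}
    (hT : g.inner x T T < 0) (hF : g.inner x F F < 0) (hTF : g.inner x T F < 0)
    (hX : X ≠ 0) (hXX : g.inner x X X = 0) (hFX : 0 < g.inner x F X) : 0 < g.inner x T X := by
  by_contra! h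
  -- otherwise a timelike combination of `T` and `F` would be orthogonal to `X`
  set l : ℝ := -g.inner x T X / g.inner x F X with hl
  have hl0 : 0 ≤ l := div_nonneg (by linarith) hFX.le
  refine g.inner_timelike_null_ne_zero (T := T + l • F) ?_ hX hXX ?_
  · simp only [map_add, map_smul, smul_eq_mul, add_apply,
      smul_apply, g.symm x F T]
    nlinarith [mul_nonneg hl0 hl0, mul_nonneg hl0 (neg_nonneg.2 hTF.le)]
  · simp only [map_add, map_smul, smul_eq_mul, add_apply,
      smul_apply, hl]
    field_simp
    ring

/-! ### The unit normal of the foliation -/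

lemma isInvertible_inner (x : M) : (g.inner x).IsInvertible := by
  have h : g.coordMetric x (extChartAt 𝓘(ℝ, E) x x) = g.inner x :=
    ContinuousLinearMap.ext fun v ↦ ContinuousLinearMap.ext fun w ↦ g.coordMetric_self x v w
  exact h ▸ (g.isSmoothMetricOn x).isInvertible (mem_extChartAt_target x)

lemma inner_grad (t : M → ℝ) (x : M) (v : TangentSpace 𝓘(ℝ, E) x) :
    g.inner x (g.grad t x) v = differential t x v :=
  congrArg (fun A : E →L[ℝ] ℝ ↦ A v) ((g.isInvertible_inner x).self_apply_inverse _)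

lemma lapse_pos {t : M → ℝ} {x : M} (h : g.normSqDiff t x < 0) : 0 < g.lapse t x :=
  inv_pos.2 (Real.sqrt_pos.2 (neg_pos.2 h))

lemma inner_unitNormal (t : M → ℝ) (x : M) (v : TangentSpace 𝓘(ℝ, E) x) :
    g.inner x (g.unitNormal t x) v = -(g.lapse t x * differential t x v) := by
  rw [← g.inner_grad]
  simp [unitNormal]

lemma inner_unitNormal_self {t : M → ℝ} {x : M} (h : g.normSqDiff t x < 0) :
    g.inner x (g.unitNormal t x) (g.unitNormal t x) = -1 := by
  have h1 : g.inner x (g.unitNormal t x) (g.unitNormal t x) =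
      g.lapse t x ^ 2 * g.normSqDiff t x := by
    simp only [unitNormal, normSqDiff, map_neg, map_smul, neg_apply,
      smul_apply, smul_eq_mul]
    ring
  rw [h1, lapse, inv_pow, Real.sq_sqrt (by linarith)]
  field_simp
  rw [div_self h.ne]

end LorentzianMetric
end Along

/-! ### The unit normal along a null geodesic -/

section Normal

set_option maxSynthPendingDepth 3
set_option linter.unusedSectionVars false

variable {E M : Type*} [NormedAddCommGroup E] [NormedSpace ℝ E]
  [TopologicalSpace M] [ChartedSpace E M] [IsManifold 𝓘(ℝ, E) ∞ M]

lemma coordField_chart (T : ∀ x : M, TangentSpace 𝓘(ℝ, E) x) {x₀ z : M}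
    (hz : z ∈ (extChartAt 𝓘(ℝ, E) x₀).source) :
    coordField T x₀ (extChartAt 𝓘(ℝ, E) x₀ z) = chartDeriv x₀ z (T z) := by
  unfold coordField
  rw [(extChartAt 𝓘(ℝ, E) x₀).left_inv hz]
  rfl

lemma contDiffAt_comp_chart_symm {t : M → ℝ} {x : M}
    (ht : ContMDiffAt 𝓘(ℝ, E) 𝓘(ℝ, ℝ) ∞ t x) :
    ContDiffAt ℝ ∞ (t ∘ (extChartAt 𝓘(ℝ, E) x).symm) (extChartAt 𝓘(ℝ, E) x x) := by
  refine contMDiffAt_iff_contDiffAt.1 (ContMDiffAt.comp _ ?_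
    (contMDiffAt_chart_symm (mem_extChartAt_target x)))
  rwa [extChartAt_to_inv x]

lemma hasDerivAt_comp_curve {t : M → ℝ} {γ : ℝ → M} {s : ℝ}
    (ht : MDifferentiableAt 𝓘(ℝ, E) 𝓘(ℝ, ℝ) t (γ s))
    (hγ : MDifferentiableAt 𝓘(ℝ, ℝ) 𝓘(ℝ, E) γ s) :
    HasDerivAt (fun r ↦ t (γ r)) (differential t (γ s) (velocity (E := E) γ s)) s := by
  have h1 := (MDifferentiableAt.comp s ht hγ)
  have h2 : DifferentiableAt ℝ (t ∘ γ) s := mdifferentiableAt_iff_differentiableAt.1 h1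
  have h3 : deriv (t ∘ γ) s = differential t (γ s) (velocity (E := E) γ s) := by
    have h4 := mfderiv_comp s ht hγ
    rw [← fderiv_apply_one_eq_deriv, ← mfderiv_eq_fderiv, h4]
    rfl
  rw [← h3]
  exact h2.hasDerivAt

namespace LorentzianMetric

variable (g : LorentzianMetric E M) [FiniteDimensional ℝ E]

/-- The gradient of `t` in a chart. -/
lemma coordField_grad {t : M → ℝ} {x : M} (ht : ContMDiffAt 𝓘(ℝ, E) 𝓘(ℝ, ℝ) ∞ t x) :
    ∀ᶠ y in 𝓝 (extChartAt 𝓘(ℝ, E) x x), chartDeriv x ((extChartAt 𝓘(ℝ, E) x).symm y)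
      (g.grad t ((extChartAt 𝓘(ℝ, E) x).symm y)) =
      (g.coordMetric x y).inverse (fderiv ℝ (t ∘ (extChartAt 𝓘(ℝ, E) x).symm) y) := by
  have hxt := mem_extChartAt_target (I := 𝓘(ℝ, E)) x
  have h1 : ∀ᶠ z in 𝓝 x, MDifferentiableAt 𝓘(ℝ, E) 𝓘(ℝ, ℝ) t z := by
    filter_upwards [(contMDiffAt_iff_contMDiffAt_nhds (n := 1) (by simp)).1
      (ht.of_le ENat.LEInfty.out)] with z hz using hz.mdifferentiableAt one_ne_zero
  have h2 : Filter.Tendsto (extChartAt 𝓘(ℝ, E) x).symm (𝓝 (extChartAt 𝓘(ℝ, E) x x)) (𝓝 x) := by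
    have := (contMDiffAt_chart_symm hxt).continuousAt
    rwa [ContinuousAt, extChartAt_to_inv x] at this
  filter_upwards [h2.eventually h1, (isOpen_chart_target x).mem_nhds hxt] with y hy hyt
  refine (g.isSmoothMetricOn x).eq_of_forall hyt fun w ↦ ?_
  rw [((g.isSmoothMetricOn x).isInvertible hyt).self_apply_inverse, coordMetric_apply,
    chartSymmDeriv_chartDeriv hyt, g.inner_grad, ← mfderiv_eq_fderiv,
    mfderiv_comp y hy (mdifferentiableAt_chart_symm hyt)]
  rfl

/-- The unit normal is a differentiable vector field. -/
lemma differentiableAt_coordField_unitNormal {t : M → ℝ} {x : M}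
    (ht : ContMDiffAt 𝓘(ℝ, E) 𝓘(ℝ, ℝ) ∞ t x) (hN : g.normSqDiff t x < 0) :
    DifferentiableAt ℝ (coordField (g.unitNormal t) x) (extChartAt 𝓘(ℝ, E) x x) := by
  have : CompleteSpace E := FiniteDimensional.complete ℝ E
  have hxt := mem_extChartAt_target (I := 𝓘(ℝ, E)) x
  set v : E → E := fun y ↦
    (g.coordMetric x y).inverse (fderiv ℝ (t ∘ (extChartAt 𝓘(ℝ, E) x).symm) y) with hv
  have hG := (g.isSmoothMetricOn x).contDiffAt hxt
  have hv1 : ContDiffAt ℝ ∞ v (extChartAt 𝓘(ℝ, E) x x) :=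
    ContDiffAt.clm_apply ((((g.isSmoothMetricOn x).isInvertible hxt).contDiffAt_map_inverse).comp _
      hG) ((contDiffAt_comp_chart_symm ht).fderiv_right (by simp))
  have hgrad : ∀ᶠ y in 𝓝 (extChartAt 𝓘(ℝ, E) x x), chartDeriv x ((extChartAt 𝓘(ℝ, E) x).symm y)
      (g.grad t ((extChartAt 𝓘(ℝ, E) x).symm y)) = v y := g.coordField_grad ht
  set N : E → ℝ := fun y ↦ g.coordMetric x y (v y) (v y) with hNdef
  have hNd : DifferentiableAt ℝ N (extChartAt 𝓘(ℝ, E) x x) :=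
    ((hG.clm_apply hv1).clm_apply hv1).differentiableAt (by simp)
  have hNx : ∀ᶠ y in 𝓝 (extChartAt 𝓘(ℝ, E) x x),
      g.normSqDiff t ((extChartAt 𝓘(ℝ, E) x).symm y) = N y := by
    filter_upwards [hgrad, (isOpen_chart_target x).mem_nhds hxt] with y hy hyt
    simp only [hNdef]
    rw [← hy, coordMetric_apply, chartSymmDeriv_chartDeriv hyt]
    rfl
  have hN0 : -N (extChartAt 𝓘(ℝ, E) x x) ≠ 0 := by
    rw [← hNx.self_of_nhds, extChartAt_to_inv x]
    linarith
  have hmain : DifferentiableAt ℝ (fun y ↦ -((Real.sqrt (-N y))⁻¹ • v y))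
      (extChartAt 𝓘(ℝ, E) x x) := by
    refine (DifferentiableAt.smul (DifferentiableAt.inv (hNd.neg.sqrt hN0) ?_)
      (hv1.differentiableAt (by simp))).neg
    refine (Real.sqrt_pos.2 ?_).ne'
    have h1 := hNx.self_of_nhds
    rw [extChartAt_to_inv x] at h1
    rw [Pi.neg_apply, ← h1]
    linarith
  refine hmain.congr_of_eventuallyEq ?_
  filter_upwards [hgrad, hNx] with y hy hNy
  have h1 : coordField (g.unitNormal t) x y = chartDeriv x ((extChartAt 𝓘(ℝ, E) x).symm y)
      (-(g.lapse t ((extChartAt 𝓘(ℝ, E) x).symm y) •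
        g.grad t ((extChartAt 𝓘(ℝ, E) x).symm y))) := rfl
  rw [h1, map_neg, map_smul, hy, lapse, hNy]

variable {γ : ℝ → M} {s : ℝ}

lemma chartVec_comp (T : ∀ x : M, TangentSpace 𝓘(ℝ, E) x)
    (hγ : ContinuousAt γ s) : chartVec (γ s) γ (fun r ↦ T (γ r)) =ᶠ[𝓝 s]
      fun r ↦ coordField T (γ s) (chartCurve (γ s) γ r) := by
  filter_upwards [eventually_mem_source (E := E) hγ (mem_extChartAt_source (γ s))] with r hr
  exact (coordField_chart T hr).symm

lemma diffAlong_comp {T : ∀ x : M, TangentSpace 𝓘(ℝ, E) x}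
    (hγ : ContMDiffAt 𝓘(ℝ, ℝ) 𝓘(ℝ, E) 1 γ s)
    (hT : DifferentiableAt ℝ (coordField T (γ s)) (extChartAt 𝓘(ℝ, E) (γ s) (γ s))) :
    DiffAlong γ (fun r ↦ T (γ r)) s := by
  have hc := (contDiffAt_chartCurve ENat.LEInfty.out hγ
    (mem_extChartAt_source (γ s))).differentiableAt one_ne_zero
  exact (DifferentiableAt.comp (g := coordField T (γ s)) s hT hc).congr_of_eventuallyEq
    (chartVec_comp T hγ.continuousAt)

/-- `⟨∇_{γ'} T, γ'⟩ = ½ (L_T g)(γ', γ')`. -/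
lemma inner_covDerivAlong_comp {T : ∀ x : M, TangentSpace 𝓘(ℝ, E) x}
    (hγ : ContMDiffAt 𝓘(ℝ, ℝ) 𝓘(ℝ, E) 1 γ s)
    (hT : DifferentiableAt ℝ (coordField T (γ s)) (extChartAt 𝓘(ℝ, E) (γ s) (γ s))) :
    g.inner (γ s) (g.covDerivAlong γ (fun r ↦ T (γ r)) s) (velocity γ s) =
      1 / 2 * g.lieDerivMetric T (γ s) (velocity γ s) (velocity γ s) := by
  have hself := mem_extChartAt_source (I := 𝓘(ℝ, E)) (γ s)
  have hyt := mem_extChartAt_target (I := 𝓘(ℝ, E)) (γ s)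
  have hc := (contDiffAt_chartCurve ENat.LEInfty.out hγ hself).differentiableAt one_ne_zero
  have h1 := chartVec_velocity (hγ.mdifferentiableAt one_ne_zero) hself
  rw [chartVec, chartDeriv_self] at h1
  have h2 := chartVec_comp T hγ.continuousAt
  have h3 : deriv (chartVec (γ s) γ (fun r ↦ T (γ r))) s =
      fderiv ℝ (coordField T (γ s)) (chartCurve (γ s) γ s) (deriv (chartCurve (γ s) γ) s) :=
    ((HasFDerivAt.comp_hasDerivAt (l := coordField T (γ s)) s hT.hasFDerivAt
      hc.hasDerivAt).congr_of_eventuallyEq h2).deriv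
  have h4 := h2.self_of_nhds
  rw [← g.coordMetric_self, g.covDerivAlong_eq_covDeriv hγ (diffAlong_comp hγ hT), covDeriv, h3, h4,
    h1]
  unfold lieDerivMetric
  have hG := g.isSmoothMetricOn (γ s)
  have hk := hG.koszul hyt (deriv (chartCurve (γ s) γ) s)
    (coordField T (γ s) (extChartAt 𝓘(ℝ, E) (γ s) (γ s))) (deriv (chartCurve (γ s) γ) s)
  have hsym := hG.symm _ hyt (deriv (chartCurve (γ s) γ) s)
    (fderiv ℝ (coordField T (γ s)) (extChartAt 𝓘(ℝ, E) (γ s) (γ s)) (deriv (chartCurve (γ s) γ) s))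
  have hfs := hG.fderiv_symm hyt (deriv (chartCurve (γ s) γ) s)
    (deriv (chartCurve (γ s) γ) s) (coordField T (γ s) (extChartAt 𝓘(ℝ, E) (γ s) (γ s)))
  have hcs : (chartCurve (γ s) γ s : E) = extChartAt 𝓘(ℝ, E) (γ s) (γ s) := rfl
  simp only [hcs, map_add, add_apply]
  linarith

end LorentzianMetric
end Normal

/-! ### One-variable comparison arguments -/

section Comparison

lemma eq_left_of_hasDerivAt_zero {f : ℝ → ℝ} {b : ℝ} (h : ∀ s ∈ Icc 0 b, HasDerivAt f 0 s) :
    ∀ s ∈ Icc 0 b, f s = f 0 :=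
  constant_of_has_deriv_right_zero (fun s hs ↦ (h s hs).continuousAt.continuousWithinAt)
    (fun s hs ↦ (h s (Ico_subset_Icc_self hs)).hasDerivWithinAt)

/-- A function with vanishing second derivative and zero boundary values vanishes. -/
lemma eq_zero_of_deriv2_zero {f f' : ℝ → ℝ} {b : ℝ} (hb : 0 < b) (hf : ContinuousOn f (Icc 0 b))
    (hff' : ∀ s ∈ Ioo 0 b, HasDerivAt f (f' s) s) (hf' : ∀ s ∈ Ioo 0 b, HasDerivAt f' 0 s)
    (h0 : f 0 = 0) (h1 : f b = 0) : ∀ s ∈ Icc 0 b, f s = 0 := by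
  obtain ⟨c, hc, hc0⟩ := exists_hasDerivAt_eq_zero hb hf (h0.trans h1.symm) hff'
  have hzero (s : ℝ) (hs : s ∈ Ioo 0 b) : f' s = 0 := by
    rw [← hc0]
    exact isOpen_Ioo.is_const_of_deriv_eq_zero isPreconnected_Ioo
      (fun r hr ↦ (hf' r hr).differentiableAt.differentiableWithinAt)
      (fun r hr ↦ (hf' r hr).deriv) hs hc
  have hd (s : ℝ) (hs : s ∈ interior (Icc 0 b)) : HasDerivAt f 0 s := by
    rw [interior_Icc] at hs
    exact hzero s hs ▸ hff' s hs
  intro s hs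
  have hmono : MonotoneOn f (Icc 0 b) := monotoneOn_of_deriv_nonneg (convex_Icc 0 b) hf
    (fun r hr ↦ (hd r hr).differentiableAt.differentiableWithinAt)
    (fun r hr ↦ (hd r hr).deriv.ge)
  exact le_antisymm (h1 ▸ hmono hs ⟨hb.le, le_rfl⟩ hs.2) (h0 ▸ hmono ⟨le_rfl, hb.le⟩ hs hs.1)

/-- The index form argument, in Riccati form. Here `P = |J|²`, `Q = ⟨J, J'⟩` and `S = |J'|²` for a
Jacobi field `J`. The shifted cotangent `μ(s) = a cot(a s + δ)`, which is smooth on the whole of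
`[0, b]` because `a b < π`, makes `Q - μ P` monotone. -/
lemma eq_zero_of_index_form {P Q S : ℝ → ℝ} {b κ a : ℝ} (ha : 0 < a)
    (hab : a * b < Real.pi) (hκ : κ < a ^ 2)
    (hP : ∀ s ∈ Icc 0 b, HasDerivAt P (2 * Q s) s)
    (hQ : ∀ s ∈ Icc 0 b, ∃ q, HasDerivAt Q q s ∧ S s - κ * P s ≤ q)
    (hS : ∀ s ∈ Icc 0 b, ∀ μ : ℝ, 0 ≤ S s - 2 * μ * Q s + μ ^ 2 * P s)
    (hPnn : ∀ s ∈ Icc 0 b, 0 ≤ P s) (hP0 : P 0 = 0) (hPb : P b = 0) (hQ0 : Q 0 = 0)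
    (hQb : Q b = 0) : ∀ s ∈ Icc 0 b, P s = 0 := by
  -- the phase `δ` centres `[δ, a b + δ]` in `(0, π)`
  set δ := (Real.pi - a * b) / 2 with hδ
  have hδ0 : 0 < δ := by rw [hδ]; linarith
  have hsin (s : ℝ) (hs : s ∈ Icc 0 b) : 0 < Real.sin (a * s + δ) := by
    apply Real.sin_pos_of_pos_of_lt_pi
    · have := mul_nonneg ha.le hs.1
      linarith
    · have := mul_le_mul_of_nonneg_left hs.2 ha.le
      linarith
  set μ : ℝ → ℝ := fun s ↦ a * Real.cos (a * s + δ) / Real.sin (a * s + δ) with hμ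
  have hμ' (s : ℝ) (hs : s ∈ Icc 0 b) : HasDerivAt μ (-(a ^ 2 + μ s ^ 2)) s := by
    have hlin : HasDerivAt (fun s ↦ a * s + δ) a s := by
      simpa using ((hasDerivAt_id s).const_mul a).add_const δ
    have h0 := (hsin s hs).ne'
    refine (((hlin.cos).const_mul a).div hlin.sin h0).congr_deriv ?_
    simp only [hμ]
    field_simp
    ring
  set F : ℝ → ℝ := fun s ↦ Q s - μ s * P s with hF
  have hF' (s : ℝ) (hs : s ∈ Icc 0 b) :
      ∃ F', HasDerivAt F F' s ∧ (a ^ 2 - κ) * P s ≤ F' := by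
    obtain ⟨q, hq, hqle⟩ := hQ s hs
    refine ⟨_, hq.sub ((hμ' s hs).mul (hP s hs)), ?_⟩
    have := hS s hs (μ s)
    nlinarith
  have hmono : MonotoneOn F (Icc 0 b) := by
    apply monotoneOn_of_deriv_nonneg (convex_Icc 0 b)
    · intro s hs
      obtain ⟨F', h1, -⟩ := hF' s hs
      exact h1.continuousAt.continuousWithinAt
    · intro s hs
      obtain ⟨F', h1, -⟩ := hF' s (interior_subset hs)
      exact h1.differentiableAt.differentiableWithinAt
    · intro s hs
      obtain ⟨F', h1, h2⟩ := hF' s (interior_subset hs)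
      rw [h1.deriv]
      exact (mul_nonneg (by linarith) (hPnn s (interior_subset hs))).trans h2
  have hF0 : F 0 = 0 := by simp [hF, hQ0, hP0]
  have hFb : F b = 0 := by simp [hF, hQb, hPb]
  intro s hs
  have hb : (0 : ℝ) ≤ b := hs.1.trans hs.2
  have hFz (r : ℝ) (hr : r ∈ Icc 0 b) : F r = 0 :=
    le_antisymm (hFb ▸ hmono hr ⟨hb, le_rfl⟩ hr.2) (hF0 ▸ hmono ⟨le_rfl, hb⟩ hr hr.1)
  rcases eq_or_lt_of_le hs.1 with rfl | h1
  · exact hP0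
  rcases eq_or_lt_of_le hs.2 with rfl | h2
  · exact hPb
  obtain ⟨F', h3, h4⟩ := hF' s hs
  have h5 : HasDerivAt F 0 s := (hasDerivAt_const s (0 : ℝ)).congr_of_eventuallyEq (by
    filter_upwards [Icc_mem_nhds h1 h2] with r hr using hFz r hr)
  rw [h3.unique h5] at h4
  have h6 := hPnn s hs
  by_contra hne
  have h7 : 0 < P s := lt_of_le_of_ne h6 (Ne.symm hne)
  nlinarith

lemma conjugacyTime_neg {Kn K k : ℝ} (hKn : 0 < Kn) (hK : 0 < K) : conjugacyTime Kn K k < 0 := by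
  have hs : 0 < Real.sqrt K := Real.sqrt_pos.2 hK
  unfold conjugacyTime
  split_ifs with hk
  · have hpk := mul_pos Real.pi_pos hk
    refine mul_neg_of_pos_of_neg (by positivity) (Real.log_neg (by positivity) ?_)
    rw [div_lt_one (by positivity)]
    linarith
  · have := Real.pi_pos
    rw [neg_lt_zero]
    positivity

/-- The frequency `w = ⟨T, γ'⟩` has a maximum `Λ`, and above the conjugacy time `√K Λ b < π`: since
`|(1/w)'| ≤ k`, `w` stays above `Λ / (1 + k Λ |s - s₀|)`, and integrating `w / n` over `[0, b]` on
both sides of the maximum `s₀` bounds the elapsed time below by `log (1 + k Λ b) / (k K_n)`. -/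
lemma exists_frequency_bound {w w' θ n : ℝ → ℝ} {b k Kn K : ℝ} (hb : 0 < b) (hKn : 0 < Kn)
    (hk : 0 ≤ k) (hK : 0 < K) (hw : ∀ s ∈ Icc 0 b, HasDerivAt w (w' s) s)
    (hw' : ∀ s ∈ Icc 0 b, |w' s| ≤ k * w s ^ 2) (hpos : ∀ s ∈ Icc 0 b, 0 < w s)
    (hθ : ∀ s ∈ Icc 0 b, HasDerivAt θ (-(w s / n s)) s) (hn : ∀ s ∈ Icc 0 b, 0 < n s ∧ n s ≤ Kn)
    (hθ0 : θ 0 = 0) (hlt : conjugacyTime Kn K k < θ b) :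
    ∃ Λ > 0, (∀ s ∈ Icc 0 b, w s ≤ Λ) ∧ Real.sqrt K * (Λ * b) < Real.pi := by
  obtain ⟨m, hm, hmax⟩ := isCompact_Icc.exists_isMaxOn (nonempty_Icc.2 hb.le)
    (fun s hs ↦ (hw s hs).continuousAt.continuousWithinAt)
  set Λ := w m with hΛ
  have hΛ0 : 0 < Λ := hpos m hm
  refine ⟨Λ, hΛ0, fun s hs ↦ hmax hs, ?_⟩
  have hsK : 0 < Real.sqrt K := Real.sqrt_pos.2 hK
  -- the reciprocal of the frequency is `k`-Lipschitz
  have hlow (s : ℝ) (hs : s ∈ Icc 0 b) : Λ / (1 + k * Λ * |s - m|) ≤ w s := by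
    have h1 : ‖(w s)⁻¹ - (w m)⁻¹‖ ≤ k * ‖s - m‖ := by
      refine (convex_Icc 0 b).norm_image_sub_le_of_norm_hasDerivWithin_le
        (f := fun r ↦ (w r)⁻¹) (f' := fun r ↦ -w' r / w r ^ 2)
        (fun r hr ↦ ((hw r hr).inv (hpos r hr).ne').hasDerivWithinAt) (fun r hr ↦ ?_) hm hs
      rw [Real.norm_eq_abs, abs_div, abs_neg, abs_of_pos (pow_pos (hpos r hr) 2),
        div_le_iff₀ (pow_pos (hpos r hr) 2)]
      exact hw' r hr
    rw [Real.norm_eq_abs, Real.norm_eq_abs] at h1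
    have h2 := (abs_le.1 h1).2
    have hws := hpos s hs
    have h3 : 0 ≤ k * Λ * |s - m| := by positivity
    rw [div_le_iff₀ (by linarith)]
    have h4 : (w s)⁻¹ * (w s * Λ) ≤ (Λ⁻¹ + k * |s - m|) * (w s * Λ) :=
      mul_le_mul_of_nonneg_right (by rw [hΛ]; linarith) (by positivity)
    have h5 : (w s)⁻¹ * (w s * Λ) = Λ := by field_simp
    have h6 : (Λ⁻¹ + k * |s - m|) * (w s * Λ) = w s * (1 + k * Λ * |s - m|) := by field_simp
    linarith
  have hrate (s : ℝ) (hs : s ∈ Icc 0 b) : -(w s / n s) ≤ -(Λ / (1 + k * Λ * |s - m|) / Kn) := by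
    have h1 : Λ / (1 + k * Λ * |s - m|) / Kn ≤ w s / Kn :=
      div_le_div_of_nonneg_right (hlow s hs) hKn.le
    have h2 : w s / Kn ≤ w s / n s :=
      div_le_div_of_nonneg_left (hpos s hs).le (hn s hs).1 (hn s hs).2
    linarith
  -- comparison of the elapsed time with an antiderivative `A` of the lower rate bound
  have hanti {A A' : ℝ → ℝ} {x y : ℝ} (hx : 0 ≤ x) (hy : y ≤ b) (hxy : x ≤ y)
      (hA : ∀ s ∈ Icc x y, HasDerivAt A (A' s) s)
      (hA' : ∀ s ∈ Icc x y, A' s ≤ Λ / (1 + k * Λ * |s - m|) / Kn) :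
      θ y + A y ≤ θ x + A x := by
    have hsub : Icc x y ⊆ Icc 0 b := Icc_subset_Icc hx hy
    have hd (s : ℝ) (hs : s ∈ Icc x y) := (hθ s (hsub hs)).add (hA s hs)
    refine antitoneOn_of_deriv_nonpos (f := fun s ↦ θ s + A s) (convex_Icc x y)
      (fun s hs ↦ (hd s hs).continuousAt.continuousWithinAt)
      (fun s hs ↦ (hd s (interior_subset hs)).differentiableAt.differentiableWithinAt)
      (fun s hs ↦ ?_) ⟨le_rfl, hxy⟩ ⟨hxy, le_rfl⟩ hxy
    have hs' := interior_subset hs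
    rw [show deriv (fun s ↦ θ s + A s) s = _ from (hd s hs').deriv]
    have h1 := hrate s (hsub hs')
    have h2 := hA' s hs'
    linarith
  unfold conjugacyTime at hlt
  split_ifs at hlt with hk0
  · have hc : 0 < k * Λ := mul_pos hk0 hΛ0
    have hlogd (s u : ℝ) (hu : 0 < 1 + k * Λ * u) (σ : ℝ)
        (hσ : HasDerivAt (fun s ↦ 1 + k * Λ * (σ * (s - m))) (k * Λ * σ) s)
        (hus : u = σ * (s - m)) :
        HasDerivAt (fun s ↦ Real.log (1 + k * Λ * (σ * (s - m))) / (k * Kn))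
          (σ * (Λ / (1 + k * Λ * u) / Kn)) s := by
      subst hus
      refine ((hσ.log hu.ne').div_const (k * Kn)).congr_deriv ?_
      field_simp
    have hlin (σ s : ℝ) : HasDerivAt (fun s ↦ 1 + k * Λ * (σ * (s - m))) (k * Λ * σ) s := by
      simpa using ((((hasDerivAt_id s).sub_const m).const_mul σ).const_mul (k * Λ)).const_add 1
    have h1 := hanti (A := fun s ↦ Real.log (1 + k * Λ * (1 * (s - m))) / (k * Kn))
      (A' := fun s ↦ 1 * (Λ / (1 + k * Λ * |s - m|) / Kn)) hm.1 le_rfl hm.2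
      (fun s hs ↦ hlogd s |s - m| (by positivity) 1 (hlin 1 s)
        (by rw [abs_of_nonneg (by linarith [hs.1]), one_mul])) (fun s hs ↦ by simp)
    have h2 := hanti (A := fun s ↦ -(Real.log (1 + k * Λ * (-1 * (s - m))) / (k * Kn)))
      (A' := fun s ↦ -(-1 * (Λ / (1 + k * Λ * |s - m|) / Kn))) le_rfl hm.2 hm.1
      (fun s hs ↦ (hlogd s |s - m| (by positivity) (-1) (hlin (-1) s)
        (by rw [abs_of_nonpos (by linarith [hs.2])]; ring)).neg) (fun s hs ↦ by simp)
    simp only [sub_self, mul_zero, add_zero, Real.log_one, zero_div, neg_zero, hθ0, zero_add,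
      one_mul, zero_sub, neg_mul, neg_neg] at h1 h2
    have hkK : 0 < k * Kn := by positivity
    have hp1 : 0 < 1 + k * Λ * (b - m) := by
      have := mul_nonneg hc.le (sub_nonneg.2 hm.2)
      linarith
    have hp2 : 0 < 1 + k * Λ * m := by
      have := mul_nonneg hc.le hm.1
      linarith
    have h3 : Real.log (1 + k * Λ * b) ≤
        Real.log (1 + k * Λ * (b - m)) + Real.log (1 + k * Λ * m) := by
      rw [← Real.log_mul hp1.ne' hp2.ne']
      refine Real.log_le_log (by positivity) ?_
      have := mul_nonneg (mul_nonneg hc.le (sub_nonneg.2 hm.2)) (mul_nonneg hc.le hm.1)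
      nlinarith
    have h4 : Real.log (1 + k * Λ * b) / (k * Kn) ≤ -θ b := by
      have := div_le_div_of_nonneg_right h3 hkK.le
      rw [add_div] at this
      linarith
    have hpk : 0 < Real.pi * k := mul_pos Real.pi_pos hk0
    have h5 : Real.log (Real.sqrt K / (Real.sqrt K + Real.pi * k)) =
        -Real.log (1 + Real.pi * k / Real.sqrt K) := by
      rw [← Real.log_inv]
      congr 1
      field_simp
    rw [h5] at hlt
    have h6 : Real.log (1 + k * Λ * b) < Real.log (1 + Real.pi * k / Real.sqrt K) := by
      have h7 : Real.log (1 + k * Λ * b) / (k * Kn) <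
          Real.log (1 + Real.pi * k / Real.sqrt K) / (k * Kn) := by
        refine h4.trans_lt ?_
        rw [div_eq_mul_inv, mul_comm, ← one_div, mul_comm k Kn]
        linarith
      exact (div_lt_div_iff_of_pos_right hkK).1 h7
    have h8 := (Real.log_lt_log_iff (by positivity) (by positivity)).1 h6
    have h9 : k * Λ * b < Real.pi * k / Real.sqrt K := by linarith
    rw [lt_div_iff₀ hsK] at h9
    have h10 : k * (Real.sqrt K * (Λ * b)) < k * Real.pi := by linarith
    exact lt_of_mul_lt_mul_left h10 hk
  · have hk1 : k = 0 := le_antisymm (not_lt.1 hk0) hk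
    have h1 := hanti (A := fun s ↦ Λ / Kn * s) (A' := fun s ↦ Λ / Kn) le_rfl le_rfl hb.le
      (fun s _ ↦ by simpa using (hasDerivAt_id s).const_mul (Λ / Kn))
      (fun s _ ↦ by simp [hk1])
    rw [hθ0, mul_zero, add_zero] at h1
    have h2 : Λ / Kn * b < 1 / Kn * (Real.pi / Real.sqrt K) := by linarith
    have h3 : Kn * (Λ / Kn * b) < Kn * (1 / Kn * (Real.pi / Real.sqrt K)) :=
      mul_lt_mul_of_pos_left h2 hKn
    have h4 : Kn * (Λ / Kn * b) = Λ * b := by field_simp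
    have h5 : Kn * (1 / Kn * (Real.pi / Real.sqrt K)) = Real.pi / Real.sqrt K := by field_simp
    rw [h4, h5, lt_div_iff₀ hsK] at h3
    linarith

/-- A function with `|w'| ≤ k w²` on an interval which is positive at the left end stays
positive. -/
lemma pos_of_abs_deriv_le {w w' : ℝ → ℝ} {b k : ℝ} (hk : 0 ≤ k)
    (hw : ∀ s ∈ Icc 0 b, HasDerivAt w (w' s) s)
    (hw' : ∀ s ∈ Icc 0 b, |w' s| ≤ k * w s ^ 2) (h0 : 0 < w 0) : ∀ s ∈ Icc 0 b, 0 < w s := by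
  have hcont : ContinuousOn w (Icc 0 b) := fun s hs ↦ (hw s hs).continuousAt.continuousWithinAt
  have hne : ∀ s ∈ Icc 0 b, w s ≠ 0 := by
    intro s hs hzero
    obtain ⟨C, hC⟩ := isCompact_Icc.exists_bound_of_continuousOn hcont
    -- Grönwall's inequality for the reversed function
    have h1 (r : ℝ) (hr : r ∈ Icc 0 s) : s - r ∈ Icc 0 b :=
      ⟨by linarith [hr.2], by linarith [hr.1, hs.2]⟩
    have hd (r : ℝ) (hr : r ∈ Icc 0 s) : HasDerivAt (fun r ↦ w (s - r)) (-w' (s - r)) r := by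
      have := HasDerivAt.comp_const_sub s r (hw (s - r) (h1 r hr))
      exact this
    have h2 := eq_zero_of_abs_deriv_le_mul_abs_self_of_eq_zero_right
      (f := fun r ↦ w (s - r)) (f' := fun r ↦ -w' (s - r)) (K := k * C) (a := 0) (b := s)
      (fun r hr ↦ (hd r hr).continuousAt.continuousWithinAt)
      (fun r hr ↦ (hd r (Ico_subset_Icc_self hr)).hasDerivWithinAt) (by simpa using hzero)
      (fun r hr ↦ by
        have h3 := hw' _ (h1 r (Ico_subset_Icc_self hr))
        have h4 := hC _ (h1 r (Ico_subset_Icc_self hr))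
        rw [norm_neg, Real.norm_eq_abs]
        refine h3.trans ?_
        rw [← sq_abs, mul_assoc, sq, ← Real.norm_eq_abs]
        exact mul_le_mul_of_nonneg_left (mul_le_mul_of_nonneg_right h4 (norm_nonneg _)) hk)
    have h3 := h2 s ⟨hs.1, le_rfl⟩
    simp only [sub_self] at h3
    exact h0.ne' h3
  intro s hs
  by_contra! hle
  have hb : (0 : ℝ) ≤ b := hs.1.trans hs.2
  obtain ⟨r, hr, hr0⟩ := isPreconnected_Icc.intermediate_value hs (left_mem_Icc.2 hb) hcont
    ⟨hle, h0.le⟩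
  exact hne r hr hr0

end Comparison

/-! ### Absence of conjugate points along null geodesics -/

section Conjugate

set_option maxSynthPendingDepth 3
set_option linter.unusedSectionVars false

variable {E M : Type*} [NormedAddCommGroup E] [NormedSpace ℝ E] [FiniteDimensional ℝ E]
  [TopologicalSpace M] [ChartedSpace E M] [IsManifold 𝓘(ℝ, E) ∞ M]

namespace LorentzianMetric

lemma inner_sub_smul (g : LorentzianMetric E M) (x : M)
    (Y Z : TangentSpace 𝓘(ℝ, E) x) (μ : ℝ) :
    g.inner x (Y - μ • Z) (Y - μ • Z) =
      g.inner x Y Y - 2 * μ * g.inner x Y Z + μ ^ 2 * g.inner x Z Z := by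
  simp only [map_sub, map_smul, sub_apply, smul_apply, smul_eq_mul]
  rw [g.symm x Z Y]
  ring

variable {g : LorentzianMetric E M} {γ : ℝ → M} {b : ℝ}

lemma IsGeodesicOn.contMDiffAt_one {S : Set ℝ} (hγ : g.IsGeodesicOn γ S) {s : ℝ} (hs : s ∈ S) :
    ContMDiffAt 𝓘(ℝ, ℝ) 𝓘(ℝ, E) 1 γ s :=
  (hγ s hs).1.of_le (by norm_num)

lemma IsGeodesicOn.inner_velocity (hγ : g.IsGeodesicOn γ (Icc 0 b)) :
    ∀ s ∈ Icc 0 b, g.inner (γ s) (velocity γ s) (velocity γ s) =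
      g.inner (γ 0) (velocity γ 0) (velocity γ 0) := by
  refine eq_left_of_hasDerivAt_zero
    (f := fun s ↦ g.inner (γ s) (velocity γ s) (velocity γ s)) fun s hs ↦ ?_
  have hV := diffAlong_velocity (hγ s hs).1
  refine (g.hasDerivAt_inner (hγ.contMDiffAt_one hs) hV hV).congr_deriv ?_
  rw [(hγ s hs).2]
  simp

variable (g) in
/-- The frequency `⟨T, γ'⟩` of a curve, measured by the observers normal to the foliation. -/
def frequency (t : M → ℝ) (γ : ℝ → M) (s : ℝ) : ℝ :=
  g.inner (γ s) (g.unitNormal t (γ s)) (velocity γ s)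

variable {o : g.TimeOrientation} {t : M → ℝ} {Ω : Set M} {p : M}

lemma TimeOrientation.IsTimeFunctionOn.diffAlong_unitNormal (ht : o.IsTimeFunctionOn t Ω) {s : ℝ}
    (hγ : ContMDiffAt 𝓘(ℝ, ℝ) 𝓘(ℝ, E) 1 γ s) (hs : γ s ∈ Ω) :
    DiffAlong γ (fun r ↦ g.unitNormal t (γ r)) s :=
  diffAlong_comp hγ (g.differentiableAt_coordField_unitNormal (ht _ hs).1 (ht _ hs).2.1)

namespace TimeOrientation.IsPastNullGeodesic

lemma velocity_null (hγ : o.IsPastNullGeodesic Ω p γ b) {s : ℝ} (hs : s ∈ Icc 0 b) :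
    g.inner (γ s) (velocity γ s) (velocity γ s) = 0 :=
  (hγ.1.inner_velocity s hs).trans hγ.2.2.1.2.1

lemma hasDerivAt_frequency (ht : o.IsTimeFunctionOn t Ω) (hγ : o.IsPastNullGeodesic Ω p γ b)
    {s : ℝ} (hs : s ∈ Icc 0 b) : HasDerivAt (g.frequency t γ)
      (1 / 2 * g.deformation t (γ s) (velocity γ s) (velocity γ s)) s := by
  have h1 := hγ.1.contMDiffAt_one hs
  have hΩ := hγ.2.2.2 s hs
  refine (g.hasDerivAt_inner h1 (ht.diffAlong_unitNormal h1 hΩ)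
    (diffAlong_velocity (hγ.1 s hs).1)).congr_deriv ?_
  rw [(hγ.1 s hs).2, g.inner_covDerivAlong_comp h1
    (g.differentiableAt_coordField_unitNormal (ht _ hΩ).1 (ht _ hΩ).2.1)]
  simp only [map_zero, add_zero]
  rfl

lemma abs_deriv_frequency_le {Kπ : ℝ} (hπ : g.DeformationBound t Ω Kπ)
    (hγ : o.IsPastNullGeodesic Ω p γ b) {s : ℝ} (hs : s ∈ Icc 0 b) :
    |1 / 2 * g.deformation t (γ s) (velocity γ s) (velocity γ s)| ≤
      Kπ * g.frequency t γ s ^ 2 := by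
  have h1 := hπ _ (hγ.2.2.2 s hs) (velocity γ s)
  rw [refMetric, hγ.velocity_null hs, zero_add] at h1
  rw [abs_mul, abs_of_pos (by norm_num : (0 : ℝ) < 1 / 2), frequency]
  linarith

lemma frequency_pos (ht : o.IsTimeFunctionOn t Ω) {Kπ : ℝ} (hKπ : 0 ≤ Kπ)
    (hπ : g.DeformationBound t Ω Kπ) (hγ : o.IsPastNullGeodesic Ω p γ b) :
    ∀ s ∈ Icc 0 b, 0 < g.frequency t γ s := by
  intro s hs
  have h0 : (0 : ℝ) ∈ Icc 0 b := ⟨le_rfl, hs.1.trans hs.2⟩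
  have hΩ := ht _ (hγ.2.2.2 0 h0)
  refine pos_of_abs_deriv_le hKπ (fun r hr ↦ hγ.hasDerivAt_frequency ht hr)
    (fun r hr ↦ hγ.abs_deriv_frequency_le hπ hr) ?_ s hs
  refine g.inner_null_pos (F := o.field (γ 0)) ?_ (o.timelike _) ?_ hγ.2.2.1.1 hγ.2.2.1.2.1
    hγ.2.2.1.2.2
  · rw [g.inner_unitNormal_self hΩ.2.1]
    norm_num
  · rw [g.inner_unitNormal, neg_lt_zero]
    exact mul_pos (g.lapse_pos hΩ.2.1) hΩ.2.2

lemma hasDerivAt_time (ht : o.IsTimeFunctionOn t Ω) (hγ : o.IsPastNullGeodesic Ω p γ b)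
    {s : ℝ} (hs : s ∈ Icc 0 b) :
    HasDerivAt (fun r ↦ t (γ r)) (-(g.frequency t γ s / g.lapse t (γ s))) s := by
  have hΩ := ht _ (hγ.2.2.2 s hs)
  refine (hasDerivAt_comp_curve (hΩ.1.mdifferentiableAt (by simp))
    ((hγ.1.contMDiffAt_one hs).mdifferentiableAt one_ne_zero)).congr_deriv ?_
  have h1 := (g.lapse_pos hΩ.2.1).ne'
  rw [frequency, g.inner_unitNormal]
  field_simp

/-- The curvature bound for `γ'` itself instead of its multiple `X` with `⟨T, X⟩ = 1`. -/
lemma inner_curvature_le {K : ℝ} (hRm : o.NullCurvatureBound t Ω p K) (hb : 0 < b)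
    (hγ : o.IsPastNullGeodesic Ω p γ b) {s : ℝ} (hs : s ∈ Icc 0 b)
    (hw : 0 < g.frequency t γ s) (Y : TangentSpace 𝓘(ℝ, E) (γ s))
    (hY : g.inner (γ s) (velocity γ s) Y = 0) :
    g.inner (γ s) (g.curvature (γ s) (velocity γ s) Y Y) (velocity γ s) ≤
      K * g.frequency t γ s ^ 2 * g.inner (γ s) Y Y := by
  have h1 := hRm γ b hb hγ s hs ((g.frequency t γ s)⁻¹ • velocity γ s) Y ⟨_, rfl⟩
    (by rw [map_smul, smul_eq_mul]; exact inv_mul_cancel₀ hw.ne')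
    (by rw [map_smul, smul_apply, hY, smul_zero])
  rw [g.inner_curvature_smul, inv_pow, inv_mul_le_iff₀ (pow_pos hw 2)] at h1
  linarith

/-- The null version of the Rauch comparison: with curvature at most `κ < a²` and `a b < π`, no
Jacobi field vanishes at both ends. The index form argument shows that such a field is everywhere
tangent to the geodesic, and a tangential Jacobi field is an affine multiple of `γ'`. -/
lemma not_isConjugateAlong {a κ Kπ : ℝ} (ht : o.IsTimeFunctionOn t Ω) (hKπ : 0 ≤ Kπ)
    (hπ : g.DeformationBound t Ω Kπ) (hb : 0 < b)
    (hγ : o.IsPastNullGeodesic Ω p γ b) (ha : 0 < a) (hab : a * b < Real.pi) (hκ : κ < a ^ 2)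
    (hR : ∀ s ∈ Icc 0 b, ∀ Y : TangentSpace 𝓘(ℝ, E) (γ s),
      g.inner (γ s) (velocity γ s) Y = 0 → 0 ≤ g.inner (γ s) Y Y →
      g.inner (γ s) (g.curvature (γ s) (velocity γ s) Y Y) (velocity γ s) ≤
        κ * g.inner (γ s) Y Y) : ¬ g.IsConjugateAlong γ b := by
  rintro ⟨J, hJ, hJ0, hJb, s₁, hs₁, hJs₁⟩
  have hw := hγ.frequency_pos ht hKπ hπ
  have hvel (s : ℝ) (hs : s ∈ Icc 0 b) : velocity (E := E) γ s ≠ 0 := by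
    intro h
    have := hw s hs
    rw [frequency, h, map_zero] at this
    exact this.ne' rfl
  have hC (s : ℝ) (hs : s ∈ Icc 0 b) := hγ.1.contMDiffAt_one hs
  have hV (s : ℝ) (hs : s ∈ Icc 0 b) := diffAlong_velocity (hγ.1 s hs).1
  have hJd (s : ℝ) (hs : s ∈ Icc 0 b) : DiffAlong γ J s :=
    (contMDiffAt_along (hJ s hs).1).2.differentiableAt two_ne_zero
  have hJ'd (s : ℝ) (hs : s ∈ Icc 0 b) : DiffAlong γ (g.covDerivAlong γ J) s :=
    (g.contDiffAt_chartVec_covDerivAlong (contMDiffAt_along (hJ s hs).1).1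
      (mem_extChartAt_source _) (contMDiffAt_along (hJ s hs).1).2).differentiableAt one_ne_zero
  have hJeq (s : ℝ) (hs : s ∈ Icc 0 b) : g.covDerivAlong γ (g.covDerivAlong γ J) s =
      -g.curvature (γ s) (J s) (velocity γ s) (velocity γ s) :=
    eq_neg_of_add_eq_zero_left (hJ s hs).2
  have h0 : (0 : ℝ) ∈ Icc 0 b := ⟨le_rfl, hb.le⟩
  have hbb : b ∈ Icc 0 b := ⟨hb.le, le_rfl⟩
  -- `⟨J, γ'⟩` is affine and vanishes at both ends
  have hJ'v (s : ℝ) (hs : s ∈ Icc 0 b) :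
      HasDerivAt (fun r ↦ g.inner (γ r) (g.covDerivAlong γ J r) (velocity γ r)) 0 s := by
    refine (g.hasDerivAt_inner (hC s hs) (hJ'd s hs) (hV s hs)).congr_deriv ?_
    rw [(hγ.1 s hs).2, hJeq s hs, map_neg, neg_apply, g.inner_curvature_self]
    simp
  have hJv (s : ℝ) (hs : s ∈ Icc 0 b) : HasDerivAt (fun r ↦ g.inner (γ r) (J r) (velocity γ r))
      (g.inner (γ s) (g.covDerivAlong γ J s) (velocity γ s)) s := by
    refine (g.hasDerivAt_inner (hC s hs) (hJd s hs) (hV s hs)).congr_deriv ?_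
    rw [(hγ.1 s hs).2]
    simp
  have hperp := eq_zero_of_deriv2_zero hb (fun s hs ↦ (hJv s hs).continuousAt.continuousWithinAt)
    (fun s hs ↦ hJv s (Ioo_subset_Icc_self hs)) (fun s hs ↦ hJ'v s (Ioo_subset_Icc_self hs))
    (by rw [hJ0]; simp) (by rw [hJb]; simp)
  have hperp' : ∀ s ∈ Icc 0 b, g.inner (γ s) (g.covDerivAlong γ J s) (velocity γ s) = 0 := by
    obtain ⟨c, hc, hc0⟩ := exists_hasDerivAt_eq_zero hb
      (fun s hs ↦ (hJv s hs).continuousAt.continuousWithinAt)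
      (by rw [hperp 0 h0, hperp b hbb]) (fun s hs ↦ hJv s (Ioo_subset_Icc_self hs))
    have h1 := eq_left_of_hasDerivAt_zero hJ'v
    intro s hs
    rw [h1 s hs, ← h1 c (Ioo_subset_Icc_self hc), hc0]
  have hnn (s : ℝ) (hs : s ∈ Icc 0 b) := (g.orthogonal_null (hvel s hs) (hγ.velocity_null hs)
    (Y := J s) (by rw [g.symm]; exact hperp s hs))
  -- the transversal part of the Jacobi field vanishes
  have hP0 := eq_zero_of_index_form (P := fun s ↦ g.inner (γ s) (J s) (J s))
    (Q := fun s ↦ g.inner (γ s) (g.covDerivAlong γ J s) (J s))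
    (S := fun s ↦ g.inner (γ s) (g.covDerivAlong γ J s) (g.covDerivAlong γ J s))
    ha hab hκ
    (fun s hs ↦ (g.hasDerivAt_inner (hC s hs) (hJd s hs) (hJd s hs)).congr_deriv (by
      rw [g.symm (γ s) (J s)]; ring))
    (fun s hs ↦ ⟨_, g.hasDerivAt_inner (hC s hs) (hJ'd s hs) (hJd s hs), by
      have h1 := hR s hs (J s) (by rw [g.symm]; exact hperp s hs) (hnn s hs).1
      rw [← g.inner_curvature_jacobi] at h1
      rw [hJeq s hs, map_neg, neg_apply]
      linarith⟩)
    (fun s hs μ ↦ by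
      rw [← g.inner_sub_smul]
      refine (g.orthogonal_null (hvel s hs) (hγ.velocity_null hs) ?_).1
      rw [g.symm, map_sub, map_smul, sub_apply, smul_apply, hperp s hs, hperp' s hs]
      simp)
    (fun s hs ↦ (hnn s hs).1) (by simp [hJ0]) (by simp [hJb]) (by simp [hJ0]) (by simp [hJb])
  -- hence `J = f γ'`
  set f : ℝ → ℝ := fun s ↦ g.inner (γ s) (g.unitNormal t (γ s)) (J s) / g.frequency t γ s with hf
  set f' : ℝ → ℝ := fun s ↦
    g.inner (γ s) (g.unitNormal t (γ s)) (g.covDerivAlong γ J s) / g.frequency t γ s with hf'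
  have hT (s : ℝ) (hs : s ∈ Icc 0 b) := ht.diffAlong_unitNormal (hC s hs) (hγ.2.2.2 s hs)
  have hfd (s : ℝ) (hs : s ∈ Icc 0 b) : DifferentiableAt ℝ f s :=
    (g.hasDerivAt_inner (hC s hs) (hT s hs) (hJd s hs)).differentiableAt.div
      (hγ.hasDerivAt_frequency ht hs).differentiableAt (hw s hs).ne'
  have hfd' (s : ℝ) (hs : s ∈ Icc 0 b) : DifferentiableAt ℝ f' s :=
    (g.hasDerivAt_inner (hC s hs) (hT s hs) (hJ'd s hs)).differentiableAt.div
      (hγ.hasDerivAt_frequency ht hs).differentiableAt (hw s hs).ne'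
  have hcoef (s : ℝ) (hs : s ∈ Icc 0 b) (c : ℝ) :
      g.inner (γ s) (g.unitNormal t (γ s)) (c • velocity γ s) / g.frequency t γ s = c := by
    rw [map_smul, smul_eq_mul, mul_div_assoc]
    exact (congrArg (c * ·) (div_self (hw s hs).ne')).trans (mul_one c)
  have hJf (s : ℝ) (hs : s ∈ Icc 0 b) : J s = f s • velocity γ s := by
    obtain ⟨c, hc⟩ := (hnn s hs).2 (hP0 s hs)
    have h1 : f s = c := by
      rw [hf, ← hcoef s hs c, ← hc]
    rw [h1, hc]
  have hJf' (s : ℝ) (hs : s ∈ Ioo 0 b) :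
      g.covDerivAlong γ J s = deriv f s • velocity γ s := by
    have hs' := Ioo_subset_Icc_self hs
    rw [g.covDerivAlong_congr (W := fun r ↦ f r • velocity γ r) (by
      filter_upwards [Icc_mem_nhds hs.1 hs.2] with r hr using hJf r hr),
      g.covDerivAlong_smul (hC s hs') (hV s hs') (hfd s hs').hasDerivAt, (hγ.1 s hs').2,
      smul_zero, add_zero]
  have hff' (s : ℝ) (hs : s ∈ Ioo 0 b) : deriv f s = f' s := by
    rw [hf', ← hcoef s (Ioo_subset_Icc_self hs) (deriv f s), ← hJf' s hs]
  have hf'0 (s : ℝ) (hs : s ∈ Ioo 0 b) : deriv f' s = 0 := by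
    have hs' := Ioo_subset_Icc_self hs
    have h1 : g.covDerivAlong γ (g.covDerivAlong γ J) s = deriv f' s • velocity γ s := by
      rw [g.covDerivAlong_congr (W := fun r ↦ f' r • velocity γ r) (by
        filter_upwards [Ioo_mem_nhds hs.1 hs.2] with r hr
        rw [hJf' r hr, hff' r hr]),
        g.covDerivAlong_smul (hC s hs') (hV s hs') (hfd' s hs').hasDerivAt, (hγ.1 s hs').2,
        smul_zero, add_zero]
    rw [hJeq s hs', hJf s hs', curvature_smul₁, curvature_self, smul_zero, neg_zero] at h1
    exact (smul_eq_zero.1 h1.symm).resolve_right (hvel s hs')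
  have hfin := eq_zero_of_deriv2_zero hb
    (fun s hs ↦ (hfd s hs).continuousAt.continuousWithinAt)
    (fun s hs ↦ hff' s hs ▸ (hfd s (Ioo_subset_Icc_self hs)).hasDerivAt)
    (fun s hs ↦ hf'0 s hs ▸ (hfd' s (Ioo_subset_Icc_self hs)).hasDerivAt)
    (by simp [hf, hJ0]) (by simp [hf, hJb])
  exact hJs₁ (by rw [hJf s₁ hs₁, hfin s₁ hs₁, zero_smul])

lemma not_isConjugateAlong_of_nonpos {KRm Kπ : ℝ} (ht : o.IsTimeFunctionOn t Ω) (hKπ : 0 ≤ Kπ)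
    (hRm : o.NullCurvatureBound t Ω p KRm) (hπ : g.DeformationBound t Ω Kπ) (hK : KRm ≤ 0)
    (hb : 0 < b) (hγ : o.IsPastNullGeodesic Ω p γ b) : ¬ g.IsConjugateAlong γ b := by
  have ha : 0 < Real.pi / (2 * b) := div_pos Real.pi_pos (by linarith)
  refine hγ.not_isConjugateAlong (a := Real.pi / (2 * b)) (κ := 0) ht hKπ hπ hb ha ?_
    (pow_pos ha 2) fun s hs Y hY hYY ↦ ?_
  · have h1 : Real.pi / (2 * b) * b = Real.pi / 2 := by field_simp
    linarith [Real.pi_pos]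
  · have h1 := hγ.inner_curvature_le hRm hb hs (hγ.frequency_pos ht hKπ hπ s hs) Y hY
    have h2 : KRm * g.frequency t γ s ^ 2 * g.inner (γ s) Y Y ≤ 0 :=
      mul_nonpos_of_nonpos_of_nonneg (mul_nonpos_of_nonpos_of_nonneg hK (sq_nonneg _)) hYY
    linarith

lemma not_isConjugateAlong_of_pos {Kn KRm Kπ : ℝ} (ht : o.IsTimeFunctionOn t Ω) (htp : t p = 0)
    (hKn : 0 < Kn) (hKπ : 0 ≤ Kπ) (hlapse : g.LapseBound t Ω Kn)
    (hRm : o.NullCurvatureBound t Ω p KRm) (hπ : g.DeformationBound t Ω Kπ) (hK : 0 < KRm)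
    (hb : 0 < b) (hγ : o.IsPastNullGeodesic Ω p γ b) (htb : conjugacyTime Kn KRm Kπ < t (γ b)) :
    ¬ g.IsConjugateAlong γ b := by
  have hw := hγ.frequency_pos ht hKπ hπ
  obtain ⟨Λ, hΛ0, hΛ, hlt⟩ := exists_frequency_bound hb hKn hKπ hK
    (fun s hs ↦ hγ.hasDerivAt_frequency ht hs) (fun s hs ↦ hγ.abs_deriv_frequency_le hπ hs)
    hw (fun s hs ↦ hγ.hasDerivAt_time ht hs)
    (fun s hs ↦ ⟨g.lapse_pos (ht _ (hγ.2.2.2 s hs)).2.1, hlapse _ (hγ.2.2.2 s hs)⟩)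
    (by rw [hγ.2.1, htp]) htb
  have hsK : 0 < Real.sqrt KRm * Λ := mul_pos (Real.sqrt_pos.2 hK) hΛ0
  have h1 : Real.sqrt KRm * Λ < Real.pi / b := by
    rw [lt_div_iff₀ hb]
    linarith
  -- any `a` strictly between `√K Λ` and `π / b` works
  refine hγ.not_isConjugateAlong (a := (Real.sqrt KRm * Λ + Real.pi / b) / 2)
    (κ := (Real.sqrt KRm * Λ) ^ 2) ht hKπ hπ hb (by linarith) ?_
    (pow_lt_pow_left₀ (by linarith) hsK.le two_ne_zero) fun s hs Y hY hYY ↦ ?_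
  · have h2 : Real.pi / b * b = Real.pi := by field_simp
    nlinarith
  · refine (hγ.inner_curvature_le hRm hb hs (hw s hs) Y hY).trans
      (mul_le_mul_of_nonneg_right ?_ hYY)
    rw [mul_pow, Real.sq_sqrt hK.le]
    exact mul_le_mul_of_nonneg_left (pow_le_pow_left₀ (hw s hs).le (hΛ s hs) 2) hK.le

end TimeOrientation.IsPastNullGeodesic
end LorentzianMetric
end Conjugate

/-! ### The geodesic equation as a first-order system in a chart -/

section Geodesics

set_option maxSynthPendingDepth 3
set_option linter.unusedSectionVars false

variable {E M : Type*} [NormedAddCommGroup E] [NormedSpace ℝ E]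
  [TopologicalSpace M] [ChartedSpace E M] [IsManifold 𝓘(ℝ, E) ∞ M]

/-- The right-hand side `(v, -Γ(v, v))` of the geodesic equation for position and velocity. -/
def geodesicField (G : E → E →L[ℝ] E →L[ℝ] ℝ) (z : E × E) : E × E :=
  (z.2, -christoffelCLM G z.1 z.2 z.2)

/-- The lift of a curve to the tangent bundle by its velocity. -/
def velocityLift (γ : ℝ → M) (s : ℝ) : TangentBundle 𝓘(ℝ, E) M := ⟨γ s, velocity γ s⟩

/-- Position and components of a tangent vector in the preferred chart at `x₀`. -/
def chartState (x₀ : M) (z : TangentBundle 𝓘(ℝ, E) M) : E × E :=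
  (extChartAt 𝓘(ℝ, E) x₀ z.1, chartDeriv x₀ z.1 z.2)

lemma chartState_injective {x₀ : M} {z z' : TangentBundle 𝓘(ℝ, E) M}
    (hz : z.1 ∈ (extChartAt 𝓘(ℝ, E) x₀).source) (hz' : z'.1 ∈ (extChartAt 𝓘(ℝ, E) x₀).source)
    (h : chartState x₀ z = chartState x₀ z') : z = z' := by
  obtain ⟨x, v⟩ := z
  obtain ⟨x', v'⟩ := z'
  obtain rfl : x = x' := (extChartAt 𝓘(ℝ, E) x₀).injOn hz hz' (congrArg Prod.fst h)
  obtain rfl : v = v' := chartDeriv_injective hz (congrArg Prod.snd h)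
  rfl

lemma chartState_velocityLift {x₀ : M} {γ : ℝ → M} {s : ℝ}
    (hγ : MDifferentiableAt 𝓘(ℝ, ℝ) 𝓘(ℝ, E) γ s)
    (hx : γ s ∈ (extChartAt 𝓘(ℝ, E) x₀).source) :
    chartState x₀ (velocityLift γ s) = (chartCurve x₀ γ s, deriv (chartCurve x₀ γ : ℝ → E) s) :=
  Prod.ext rfl (chartVec_velocity hγ hx)

lemma velocityLift_congr {γ γ' : ℝ → M} {s : ℝ} (hγ : MDifferentiableAt 𝓘(ℝ, ℝ) 𝓘(ℝ, E) γ s)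
    (h : γ' =ᶠ[𝓝 s] γ) : velocityLift (E := E) γ' s = velocityLift γ s := by
  have hx := mem_extChartAt_source (I := 𝓘(ℝ, E)) (γ s)
  have hx' : γ' s ∈ (extChartAt 𝓘(ℝ, E) (γ s)).source := by rwa [h.self_of_nhds]
  refine chartState_injective (x₀ := γ s) hx' hx ?_
  have h1 : (chartCurve (γ s) γ' : ℝ → E) =ᶠ[𝓝 s] chartCurve (γ s) γ := by
    filter_upwards [h] with r hr
    rw [chartCurve, hr, chartCurve]
  rw [chartState_velocityLift (hγ.congr_of_eventuallyEq h) hx', chartState_velocityLift hγ hx,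
    h1.deriv_eq, h1.self_of_nhds]

variable [FiniteDimensional ℝ E]

lemma IsSmoothMetricOn.contDiffOn_geodesicField {G : E → E →L[ℝ] E →L[ℝ] ℝ} {U : Set E}
    (h : IsSmoothMetricOn G U) : ContDiffOn ℝ ∞ (geodesicField G) (U ×ˢ univ) := by
  intro z hz
  have h1 : ContDiffAt ℝ ∞ (fun z : E × E ↦ christoffelCLM G z.1) z :=
    ContDiffAt.comp z (h.contDiffAt_christoffel hz.1) contDiffAt_fst
  exact (contDiffAt_snd.prodMk ((h1.clm_apply contDiffAt_snd).clm_apply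
    contDiffAt_snd).neg).contDiffWithinAt

namespace LorentzianMetric

variable (g : LorentzianMetric E M)

/-- The geodesic equation in an arbitrary chart. -/
lemma covDerivAlong_velocity_eq_zero_iff {γ : ℝ → M} {s : ℝ} {x₀ : M}
    (hγ : ContMDiffAt 𝓘(ℝ, ℝ) 𝓘(ℝ, E) 2 γ s) (hx : γ s ∈ (extChartAt 𝓘(ℝ, E) x₀).source) :
    g.covDerivAlong γ (velocity γ) s = 0 ↔
      deriv (deriv (chartCurve x₀ γ : ℝ → E)) s + christoffelCLM (g.coordMetric x₀)
        (chartCurve x₀ γ s) (deriv (chartCurve x₀ γ) s) (deriv (chartCurve x₀ γ) s) = 0 := by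
  have hγ1 : ContMDiffAt 𝓘(ℝ, ℝ) 𝓘(ℝ, E) 1 γ s := hγ.of_le (by norm_num)
  have h1 : chartVec x₀ γ (velocity (E := E) γ) =ᶠ[𝓝 s] deriv (chartCurve x₀ γ : ℝ → E) := by
    filter_upwards [eventually_contMDiffAt hγ, eventually_mem_source hγ.continuousAt hx]
      with r hr hr'
    exact chartVec_velocity (hr.mdifferentiableAt two_ne_zero) hr'
  have h2 := g.chartDeriv_covDerivAlong hγ1 hx (differentiableAt_chartVec_change hγ1
    (mem_extChartAt_source _) hx (diffAlong_velocity hγ))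
  rw [covDeriv, h1.deriv_eq, h1.self_of_nhds] at h2
  rw [← h2]
  exact (map_eq_zero_iff _ (chartDeriv_injective hx)).symm

variable {g}

lemma IsGeodesicOn.mono {γ : ℝ → M} {S S' : Set ℝ} (h : g.IsGeodesicOn γ S) (hS : S' ⊆ S) :
    g.IsGeodesicOn γ S' := fun s hs ↦ h s (hS hs)

lemma IsGeodesicOn.congr {γ γ' : ℝ → M} {s : ℝ} (h : g.IsGeodesicOn γ {s})
    (heq : γ' =ᶠ[𝓝 s] γ) : ContMDiffAt 𝓘(ℝ, ℝ) 𝓘(ℝ, E) 2 γ' s ∧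
      g.covDerivAlong γ' (velocity γ') s = 0 := by
  obtain ⟨h1, h2⟩ := h s rfl
  have h3 := h1.congr_of_eventuallyEq heq
  have hx := mem_extChartAt_source (I := 𝓘(ℝ, E)) (γ s)
  refine ⟨h3, ?_⟩
  have hc : (chartCurve (γ s) γ' : ℝ → E) =ᶠ[𝓝 s] chartCurve (γ s) γ := by
    filter_upwards [heq] with r hr
    rw [chartCurve, hr, chartCurve]
  rw [g.covDerivAlong_velocity_eq_zero_iff h3 (x₀ := γ s) (by rwa [heq.self_of_nhds]),
    hc.deriv.deriv_eq, hc.deriv_eq, hc.self_of_nhds]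
  exact (g.covDerivAlong_velocity_eq_zero_iff h1 hx).1 h2

lemma IsGeodesicOn.hasDerivAt_chartState {γ : ℝ → M} {s : ℝ} {x₀ : M} {S : Set ℝ}
    (hγ : g.IsGeodesicOn γ S) (hs : s ∈ S) (hx : γ s ∈ (extChartAt 𝓘(ℝ, E) x₀).source) :
    HasDerivAt (fun r ↦ chartState x₀ (velocityLift (E := E) γ r))
      (geodesicField (g.coordMetric x₀) (chartState x₀ (velocityLift γ s))) s := by
  have hc := contDiffAt_chartCurve ENat.LEInfty.out (hγ s hs).1 hx
  have h1 : (fun r ↦ chartState x₀ (velocityLift (E := E) γ r)) =ᶠ[𝓝 s]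
      fun r ↦ (chartCurve x₀ γ r, deriv (chartCurve x₀ γ : ℝ → E) r) := by
    filter_upwards [eventually_contMDiffAt (hγ s hs).1,
      eventually_mem_source (hγ s hs).1.continuousAt hx] with r hr hr'
    exact chartState_velocityLift (hr.mdifferentiableAt two_ne_zero) hr'
  refine HasDerivAt.congr_of_eventuallyEq (HasDerivAt.congr_deriv
    ((hc.differentiableAt two_ne_zero).hasDerivAt.prodMk
      ((contDiffAt_deriv hc).differentiableAt one_ne_zero).hasDerivAt) ?_) h1
  rw [show chartState x₀ (velocityLift (E := E) γ s) = _ from h1.self_of_nhds]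
  exact Prod.ext rfl (eq_neg_of_add_eq_zero_left
    ((g.covDerivAlong_velocity_eq_zero_iff (hγ s hs).1 hx).1 (hγ s hs).2))

/-- A solution of the first-order system in a chart gives a geodesic. -/
lemma isGeodesicOn_of_hasDerivAt {x₀ : M} {S : Set ℝ} (hS : IsOpen S) {ψ : ℝ → E × E}
    (hψ : ContDiffOn ℝ 2 ψ S) (ht : ∀ s ∈ S, (ψ s).1 ∈ (extChartAt 𝓘(ℝ, E) x₀).target)
    (hd : ∀ s ∈ S, HasDerivAt ψ (geodesicField (g.coordMetric x₀) (ψ s)) s) :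
    g.IsGeodesicOn (fun s ↦ (extChartAt 𝓘(ℝ, E) x₀).symm (ψ s).1) S ∧
      ∀ s ∈ S, chartState x₀
        (velocityLift (fun s ↦ (extChartAt 𝓘(ℝ, E) x₀).symm (ψ s).1) s) = ψ s := by
  set γ : ℝ → M := fun s ↦ (extChartAt 𝓘(ℝ, E) x₀).symm (ψ s).1 with hγ
  have hx (s : ℝ) (hs : s ∈ S) : γ s ∈ (extChartAt 𝓘(ℝ, E) x₀).source :=
    (extChartAt 𝓘(ℝ, E) x₀).map_target (ht s hs)
  have hc (s : ℝ) (hs : s ∈ S) : chartCurve x₀ γ s = (ψ s).1 :=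
    (extChartAt 𝓘(ℝ, E) x₀).right_inv (ht s hs)
  have hc' (s : ℝ) (hs : s ∈ S) : deriv (chartCurve x₀ γ : ℝ → E) s = (ψ s).2 := by
    have h1 : (chartCurve x₀ γ : ℝ → E) =ᶠ[𝓝 s] fun r ↦ (ψ r).1 := by
      filter_upwards [hS.mem_nhds hs] with r hr using hc r hr
    rw [h1.deriv_eq]
    exact ((ContinuousLinearMap.fst ℝ E E).hasFDerivAt.comp_hasDerivAt s (hd s hs)).deriv
  have hγ2 (s : ℝ) (hs : s ∈ S) : ContMDiffAt 𝓘(ℝ, ℝ) 𝓘(ℝ, E) 2 γ s :=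
    ContMDiffAt.comp (g := (extChartAt 𝓘(ℝ, E) x₀).symm) s
      ((contMDiffAt_chart_symm (ht s hs)).of_le ENat.LEInfty.out)
      (hψ.contDiffAt (hS.mem_nhds hs)).fst.contMDiffAt
  refine ⟨fun s hs ↦ ⟨hγ2 s hs, ?_⟩, fun s hs ↦ ?_⟩
  · rw [g.covDerivAlong_velocity_eq_zero_iff (hγ2 s hs) (hx s hs), hc' s hs, hc s hs]
    have h1 : deriv (chartCurve x₀ γ : ℝ → E) =ᶠ[𝓝 s] fun r ↦ (ψ r).2 := by
      filter_upwards [hS.mem_nhds hs] with r hr using hc' r hr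
    rw [h1.deriv_eq, show deriv (fun r ↦ (ψ r).2) s = _ from
      ((ContinuousLinearMap.snd ℝ E E).hasFDerivAt.comp_hasDerivAt s (hd s hs)).deriv]
    exact neg_add_cancel _
  · rw [chartState_velocityLift ((hγ2 s hs).mdifferentiableAt two_ne_zero) (hx s hs), hc s hs,
      hc' s hs]

/-- Geodesics with the same initial position and velocity agree. -/
lemma IsGeodesicOn.velocityLift_eq [T2Space M] {γ₁ γ₂ : ℝ → M} {a b : ℝ}
    (h₁ : g.IsGeodesicOn γ₁ (Icc a b)) (h₂ : g.IsGeodesicOn γ₂ (Icc a b))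
    (h : velocityLift (E := E) γ₁ a = velocityLift γ₂ a) :
    ∀ s ∈ Icc a b, velocityLift (E := E) γ₁ s = velocityLift γ₂ s := by
  set S : Set ℝ := {s | velocityLift (E := E) γ₁ s = velocityLift γ₂ s} with hS
  have hproj {s : ℝ} (hs : s ∈ S) : γ₁ s = γ₂ s :=
    congrArg (fun z : TangentBundle 𝓘(ℝ, E) M ↦ z.1) hs
  have hclosed : IsClosed (S ∩ Icc a b) := by
    refine isClosed_of_closure_subset fun s hs ↦ ?_
    have hsI : s ∈ Icc a b := isClosed_Icc.closure_subset_iff.2 inter_subset_right hs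
    have hne := mem_closure_iff_nhdsWithin_neBot.1 hs
    have hmem : ∀ᶠ r in 𝓝[S ∩ Icc a b] s, r ∈ S := by
      filter_upwards [self_mem_nhdsWithin] with r hr using hr.1
    have hpos : γ₁ s = γ₂ s := tendsto_nhds_unique_of_eventuallyEq
      ((h₁ s hsI).1.continuousAt.tendsto.mono_left nhdsWithin_le_nhds)
      ((h₂ s hsI).1.continuousAt.tendsto.mono_left nhdsWithin_le_nhds)
      (by filter_upwards [hmem] with r hr using hproj hr)
    have hx := mem_extChartAt_source (I := 𝓘(ℝ, E)) (γ₁ s)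
    have hx' : γ₂ s ∈ (extChartAt 𝓘(ℝ, E) (γ₁ s)).source := by rwa [← hpos]
    refine ⟨chartState_injective (x₀ := γ₁ s) hx hx' ?_, hsI⟩
    exact tendsto_nhds_unique_of_eventuallyEq
      ((h₁.hasDerivAt_chartState hsI hx).continuousAt.tendsto.mono_left nhdsWithin_le_nhds)
      ((h₂.hasDerivAt_chartState hsI hx').continuousAt.tendsto.mono_left nhdsWithin_le_nhds)
      (by filter_upwards [hmem] with r hr using congrArg (chartState (γ₁ s)) hr)
  refine hclosed.Icc_subset_of_forall_mem_nhdsWithin h fun s ⟨hs, hsI⟩ ↦ ?_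
  have hsI' := Ico_subset_Icc_self hsI
  have hx := mem_extChartAt_source (I := 𝓘(ℝ, E)) (γ₁ s)
  have hx' : γ₂ s ∈ (extChartAt 𝓘(ℝ, E) (γ₁ s)).source := by rwa [← hproj hs]
  have hU := g.isSmoothMetricOn (γ₁ s)
  obtain ⟨K, N, hN, hK⟩ := ((hU.contDiffOn_geodesicField.contDiffAt
    (x := chartState (γ₁ s) (velocityLift γ₁ s)) ((hU.isOpen.prod isOpen_univ).mem_nhds
      ⟨(extChartAt 𝓘(ℝ, E) (γ₁ s)).map_source hx, trivial⟩)).of_le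
        (m := 1) ENat.LEInfty.out).exists_lipschitzOnWith
  have hs' : chartState (γ₁ s) (velocityLift (E := E) γ₁ s) =
    chartState (γ₁ s) (velocityLift γ₂ s) := congrArg (chartState (γ₁ s)) hs
  have hev : ∀ᶠ r in 𝓝 s, (γ₁ r ∈ (extChartAt 𝓘(ℝ, E) (γ₁ s)).source ∧
      γ₂ r ∈ (extChartAt 𝓘(ℝ, E) (γ₁ s)).source) ∧
      chartState (γ₁ s) (velocityLift γ₁ r) ∈ N ∧ chartState (γ₁ s) (velocityLift γ₂ r) ∈ N :=
    ((eventually_mem_source (h₁ s hsI').1.continuousAt hx).and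
      (eventually_mem_source (h₂ s hsI').1.continuousAt hx')).and
      (((h₁.hasDerivAt_chartState hsI' hx).continuousAt.eventually_mem hN).and
      ((h₂.hasDerivAt_chartState hsI' hx').continuousAt.eventually_mem (hs' ▸ hN)))
  obtain ⟨ε, hε, hball⟩ := Metric.eventually_nhds_iff.1 hev
  set c := min b (s + ε / 2) with hc
  have hsc : s < c := lt_min hsI.2 (by linarith)
  have hin {r : ℝ} (hr : r ∈ Icc s c) : r ∈ Icc a b ∧ dist r s < ε := by
    refine ⟨⟨hsI.1.trans hr.1, hr.2.trans (min_le_left _ _)⟩, ?_⟩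
    have := hr.2.trans (min_le_right _ _)
    rw [Real.dist_eq, abs_of_nonneg (by linarith [hr.1])]
    linarith
  have huniq := ODE_solution_unique_of_mem_Icc_right
    (v := fun _ ↦ geodesicField (g.coordMetric (γ₁ s))) (s := fun _ ↦ N) (K := K)
    (f := fun r ↦ chartState (γ₁ s) (velocityLift γ₁ r))
    (g := fun r ↦ chartState (γ₁ s) (velocityLift γ₂ r)) (a := s) (b := c) (fun _ _ ↦ hK)
    (fun r hr ↦ (h₁.hasDerivAt_chartState (hin hr).1
      (hball (hin hr).2).1.1).continuousAt.continuousWithinAt)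
    (fun r hr ↦ (h₁.hasDerivAt_chartState (hin (Ico_subset_Icc_self hr)).1
      (hball (hin (Ico_subset_Icc_self hr)).2).1.1).hasDerivWithinAt)
    (fun r hr ↦ (hball (hin (Ico_subset_Icc_self hr)).2).2.1)
    (fun r hr ↦ (h₂.hasDerivAt_chartState (hin hr).1
      (hball (hin hr).2).1.2).continuousAt.continuousWithinAt)
    (fun r hr ↦ (h₂.hasDerivAt_chartState (hin (Ico_subset_Icc_self hr)).1
      (hball (hin (Ico_subset_Icc_self hr)).2).1.2).hasDerivWithinAt)
    (fun r hr ↦ (hball (hin (Ico_subset_Icc_self hr)).2).2.2) hs'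
  filter_upwards [Icc_mem_nhdsGT hsc] with r hr
  exact chartState_injective (hball (hin hr).2).1.1 (hball (hin hr).2).1.2 (huniq hr)

end LorentzianMetric
end Geodesics

/-! ### Smooth dependence of geodesics on the initial velocity -/

section Family

set_option maxSynthPendingDepth 3
set_option linter.unusedSectionVars false

variable {E M : Type*} [NormedAddCommGroup E] [NormedSpace ℝ E] [FiniteDimensional ℝ E]
  [TopologicalSpace M] [ChartedSpace E M] [IsManifold 𝓘(ℝ, E) ∞ M]

namespace LorentzianMetric

variable (g : LorentzianMetric E M)

/-- A smooth family of geodesics `Φ(·, v)`, `v ∈ W`, on the parameter interval `(a, b)`. -/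
structure IsGeodesicFamily (W : Set E) (a b : ℝ) (Φ : ℝ × E → M) : Prop where
  isOpen : IsOpen W
  contMDiffOn : ContMDiffOn 𝓘(ℝ, ℝ × E) 𝓘(ℝ, E) ∞ Φ (Ioo a b ×ˢ W)
  isGeodesicOn : ∀ v ∈ W, g.IsGeodesicOn (fun r ↦ Φ (r, v)) (Ioo a b)

variable {g} {W : Set E} {a b : ℝ} {Φ : ℝ × E → M}

namespace IsGeodesicFamily

lemma mono (h : g.IsGeodesicFamily W a b Φ) {W' : Set E} {a' b' : ℝ} (hW' : IsOpen W')
    (hW : W' ⊆ W) (ha : a ≤ a') (hb : b' ≤ b) : g.IsGeodesicFamily W' a' b' Φ :=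
  ⟨hW', h.contMDiffOn.mono (prod_mono (Ioo_subset_Ioo ha hb) hW),
    fun v hv ↦ (h.isGeodesicOn v (hW hv)).mono (Ioo_subset_Ioo ha hb)⟩

lemma contMDiffAt (h : g.IsGeodesicFamily W a b Φ) {s : ℝ} {v : E} (hs : s ∈ Ioo a b)
    (hv : v ∈ W) : ContMDiffAt 𝓘(ℝ, ℝ × E) 𝓘(ℝ, E) ∞ Φ (s, v) :=
  h.contMDiffOn.contMDiffAt ((isOpen_Ioo.prod h.isOpen).mem_nhds ⟨hs, hv⟩)

lemma contDiffAt_chart (h : g.IsGeodesicFamily W a b Φ) {s : ℝ} {v : E} (hs : s ∈ Ioo a b)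
    (hv : v ∈ W) {x₀ : M} (hx : Φ (s, v) ∈ (extChartAt 𝓘(ℝ, E) x₀).source) :
    ContDiffAt ℝ ∞ (fun q ↦ (extChartAt 𝓘(ℝ, E) x₀ (Φ q) : E)) (s, v) :=
  contMDiffAt_iff_contDiffAt.1
    (ContMDiffAt.comp (g := extChartAt 𝓘(ℝ, E) x₀) (s, v) (contMDiffAt_chart hx)
      (h.contMDiffAt hs hv))

lemma deriv_chartCurve (h : g.IsGeodesicFamily W a b Φ) {s : ℝ} {v : E} (hs : s ∈ Ioo a b)
    (hv : v ∈ W) {x₀ : M} (hx : Φ (s, v) ∈ (extChartAt 𝓘(ℝ, E) x₀).source) :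
    deriv (chartCurve x₀ (fun r ↦ Φ (r, v)) : ℝ → E) s =
      fderiv ℝ (fun q ↦ (extChartAt 𝓘(ℝ, E) x₀ (Φ q) : E)) (s, v) (1, 0) :=
  (HasFDerivAt.comp_hasDerivAt (l := fun q ↦ (extChartAt 𝓘(ℝ, E) x₀ (Φ q) : E))
    (f := fun r : ℝ ↦ (r, v)) s
    ((h.contDiffAt_chart hs hv hx).differentiableAt (by simp)).hasFDerivAt
    ((hasDerivAt_id s).prodMk (hasDerivAt_const s v))).deriv

/-- The state of the family at a fixed parameter depends smoothly on the initial data. -/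
lemma contDiffAt_chartState (h : g.IsGeodesicFamily W a b Φ) {s : ℝ} {v : E} (hs : s ∈ Ioo a b)
    (hv : v ∈ W) {x₀ : M} (hx : Φ (s, v) ∈ (extChartAt 𝓘(ℝ, E) x₀).source) :
    ContDiffAt ℝ ∞ (fun v ↦ chartState x₀ (velocityLift (E := E) (fun r ↦ Φ (r, v)) s)) v := by
  have h1 := h.contDiffAt_chart hs hv hx
  have h2 : ContDiffAt ℝ ∞ (fun v : E ↦ ((s, v) : ℝ × E)) v := contDiffAt_const.prodMk contDiffAt_id
  have h3 : ContDiffAt ℝ ∞ (fun v ↦ fderiv ℝ (fun q ↦ (extChartAt 𝓘(ℝ, E) x₀ (Φ q) : E))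
      (s, v) (1, 0)) v :=
    (ContDiffAt.comp (g := fderiv ℝ (fun q ↦ (extChartAt 𝓘(ℝ, E) x₀ (Φ q) : E))) v
      (h1.fderiv_right (by simp)) h2).clm_apply contDiffAt_const
  refine ((ContDiffAt.comp (g := fun q ↦ (extChartAt 𝓘(ℝ, E) x₀ (Φ q) : E)) v h1
    h2).prodMk h3).congr_of_eventuallyEq ?_
  have h4 : ∀ᶠ u in 𝓝 v, Φ (s, u) ∈ (extChartAt 𝓘(ℝ, E) x₀).source :=
    (ContinuousAt.comp (g := Φ) (f := fun v : E ↦ ((s, v) : ℝ × E))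
      (h.contMDiffAt hs hv).continuousAt h2.continuousAt).eventually
      ((isOpen_chart_source x₀).mem_nhds hx)
  filter_upwards [h4, h.isOpen.mem_nhds hv] with u hu huW
  rw [chartState_velocityLift ((h.isGeodesicOn u huW s hs).1.mdifferentiableAt two_ne_zero) hu,
    h.deriv_chartCurve hs huW hu]
  rfl

/-- Two families which agree to first order at the parameter `s₁` can be glued: by uniqueness they
coincide slightly beyond `s₁`, and the change-over is placed there. -/
lemma glue [T2Space M] {Φ₂ : ℝ × E → M} {s₁ b₂ : ℝ} (h : g.IsGeodesicFamily W a b Φ)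
    (h₂ : g.IsGeodesicFamily W (s₁ - (b₂ - s₁)) b₂ Φ₂) (ha : a < s₁) (hb : s₁ < b) (hb₂ : s₁ < b₂)
    (heq : ∀ v ∈ W, velocityLift (E := E) (fun r ↦ Φ (r, v)) s₁ =
      velocityLift (fun r ↦ Φ₂ (r, v)) s₁) :
    ∃ Φ' : ℝ × E → M, g.IsGeodesicFamily W a b₂ Φ' ∧
      ∃ c > s₁, ∀ q : ℝ × E, q.1 ≤ c → Φ' q = Φ q := by
  classical
  obtain ⟨c, hsc, hc⟩ := exists_between (lt_min hb hb₂)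
  have hagree {r : ℝ} (hr : s₁ ≤ r) (hr' : r < min b b₂) {v : E} (hv : v ∈ W) :
      Φ (r, v) = Φ₂ (r, v) := by
    have hrb := hr'.trans_le (min_le_left _ _)
    have hrb₂ := hr'.trans_le (min_le_right _ _)
    exact congrArg (fun z : TangentBundle 𝓘(ℝ, E) M ↦ z.1)
      (((h.isGeodesicOn v hv).mono (S' := Icc s₁ r) fun x hx ↦
        ⟨ha.trans_le hx.1, hx.2.trans_lt hrb⟩).velocityLift_eq ((h₂.isGeodesicOn v hv).mono
        fun x hx ↦ ⟨by linarith [hx.1], hx.2.trans_lt hrb₂⟩) (heq v hv) r ⟨hr, le_rfl⟩)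
  set Φ' : ℝ × E → M := fun q ↦ if q.1 ≤ c then Φ q else Φ₂ q with hΦ'
  have hleft {r : ℝ} (hr : r < min b b₂) {v : E} (hv : v ∈ W) : Φ' (r, v) = Φ (r, v) := by
    simp only [hΦ']
    split_ifs with h1
    · rfl
    · exact (hagree (by linarith) hr hv).symm
  have hright {r : ℝ} (hr : s₁ < r) {v : E} (hv : v ∈ W) : Φ' (r, v) = Φ₂ (r, v) := by
    simp only [hΦ']
    split_ifs with h1
    · exact hagree hr.le (h1.trans_lt hc) hv
    · rfl
  refine ⟨Φ', ⟨h.isOpen, ?_, ?_⟩, c, hsc, fun q hq ↦ if_pos hq⟩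
  · rintro ⟨r, v⟩ ⟨hr, hv⟩
    refine ContMDiffAt.contMDiffWithinAt ?_
    rcases lt_or_ge r (min b b₂) with h1 | h1
    · refine (h.contMDiffAt ⟨hr.1, h1.trans_le (min_le_left _ _)⟩ hv).congr_of_eventuallyEq ?_
      filter_upwards [(isOpen_Iio.prod h.isOpen).mem_nhds (⟨h1, hv⟩ : (r, v) ∈ Iio _ ×ˢ W)]
        with q hq using hleft hq.1 hq.2
    · have h2 : s₁ < r := hsc.trans (hc.trans_le h1)
      refine (h₂.contMDiffAt ⟨by linarith, hr.2⟩ hv).congr_of_eventuallyEq ?_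
      filter_upwards [(isOpen_Ioi.prod h.isOpen).mem_nhds (⟨h2, hv⟩ : (r, v) ∈ Ioi _ ×ˢ W)]
        with q hq using hright hq.1 hq.2
  · intro v hv r hr
    rcases lt_or_ge r (min b b₂) with h1 | h1
    · refine IsGeodesicOn.congr (γ := fun r ↦ Φ (r, v)) ((h.isGeodesicOn v hv).mono
        (singleton_subset_iff.2 ⟨hr.1, h1.trans_le (min_le_left _ _)⟩)) ?_
      filter_upwards [Iio_mem_nhds h1] with q hq using hleft hq hv
    · have h2 : s₁ < r := hsc.trans (hc.trans_le h1)
      refine IsGeodesicOn.congr (γ := fun r ↦ Φ₂ (r, v)) ((h₂.isGeodesicOn v hv).mono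
        (singleton_subset_iff.2 ⟨by linarith, hr.2⟩)) ?_
      filter_upwards [Ioi_mem_nhds h2] with q hq using hright hq hv

end IsGeodesicFamily

variable (g) in
/-- Smooth initial data near a given state are realized by a smooth family of geodesics, on a
parameter interval whose length depends only on that state. -/
lemma exists_isGeodesicFamily_of_chartState {x₀ : M} {z₀ : E × E}
    (hz₀ : z₀.1 ∈ (extChartAt 𝓘(ℝ, E) x₀).target) :
    ∃ ε > 0, ∀ (s₁ : ℝ) (σ : E → E × E) (W : Set E), IsOpen W → ContDiffOn ℝ ∞ σ W →
      MapsTo σ W (Metric.ball z₀ ε) → ∃ Φ : ℝ × E → M,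
        g.IsGeodesicFamily W (s₁ - ε) (s₁ + ε) Φ ∧
        ∀ v ∈ W, Φ (s₁, v) ∈ (extChartAt 𝓘(ℝ, E) x₀).source ∧
          chartState x₀ (velocityLift (fun r ↦ Φ (r, v)) s₁) = σ v := by
  have hU := g.isSmoothMetricOn x₀
  obtain ⟨ε, hε, Ψ, hΨ, hflow⟩ := exists_smooth_localFlow (hU.isOpen.prod isOpen_univ)
    hU.contDiffOn_geodesicField (z₀ := z₀) ⟨hz₀, trivial⟩
  refine ⟨ε, hε, fun s₁ σ W hW hσ hmaps ↦ ?_⟩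
  have hsub {r : ℝ} (hr : r ∈ Ioo (s₁ - ε) (s₁ + ε)) : r - s₁ ∈ Metric.ball (0 : ℝ) ε := by
    rw [Metric.mem_ball, dist_zero_right, Real.norm_eq_abs, abs_lt]
    exact ⟨by linarith [hr.1], by linarith [hr.2]⟩
  have hΨσ : ContDiffOn ℝ ∞ (fun q : ℝ × E ↦ Ψ (q.1 - s₁, σ q.2))
      (Ioo (s₁ - ε) (s₁ + ε) ×ˢ W) := by
    refine hΨ.comp (f := fun q : ℝ × E ↦ (q.1 - s₁, σ q.2))
      ((contDiffOn_fst.sub contDiffOn_const).prodMk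
        (hσ.comp contDiffOn_snd fun q hq ↦ hq.2)) fun q hq ↦ ⟨hsub hq.1, hmaps hq.2⟩
  have htgt {r : ℝ} (hr : r ∈ Ioo (s₁ - ε) (s₁ + ε)) {v : E} (hv : v ∈ W) :
      (Ψ (r - s₁, σ v)).1 ∈ (extChartAt 𝓘(ℝ, E) x₀).target :=
    ((hflow _ (hmaps hv)).2 _ (hsub hr)).1.1
  have hgeo (v : E) (hv : v ∈ W) := isGeodesicOn_of_hasDerivAt (g := g) (x₀ := x₀)
    (ψ := fun r ↦ Ψ (r - s₁, σ v)) (isOpen_Ioo (a := s₁ - ε) (b := s₁ + ε))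
    ((hΨσ.comp (f := fun r : ℝ ↦ (r, v)) (contDiffOn_id.prodMk contDiffOn_const)
      fun r hr ↦ ⟨hr, hv⟩).of_le ENat.LEInfty.out)
    (fun r hr ↦ htgt hr hv)
    (fun r hr ↦ HasDerivAt.comp_sub_const r s₁ ((hflow _ (hmaps hv)).2 _ (hsub hr)).2)
  have hs₁ : s₁ ∈ Ioo (s₁ - ε) (s₁ + ε) := ⟨by linarith, by linarith⟩
  refine ⟨fun q ↦ (extChartAt 𝓘(ℝ, E) x₀).symm (Ψ (q.1 - s₁, σ q.2)).1,
    ⟨hW, ?_, fun v hv ↦ (hgeo v hv).1⟩, fun v hv ↦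
      ⟨(extChartAt 𝓘(ℝ, E) x₀).map_target (htgt hs₁ hv), ?_⟩⟩
  · exact (contMDiffOn_extChartAt_symm x₀).comp
      (contMDiffOn_iff_contDiffOn.2 hΨσ.fst) fun q hq ↦ htgt hq.1 hq.2
  · rw [(hgeo v hv).2 s₁ hs₁, sub_self, (hflow _ (hmaps hv)).1]

/-- A geodesic defined on `[0, b]` is part of a smooth family of geodesics from the same point,
parametrized by the initial velocity, on a larger interval. -/
theorem exists_isGeodesicFamily [T2Space M] {p : M} {V : E} {γ : ℝ → M} {b : ℝ} (hb : 0 ≤ b)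
    (hγ : g.IsGeodesicFrom p V γ b) : ∃ δ > 0, ∃ W : Set E, ∃ Φ : ℝ × E → M, V ∈ W ∧
      g.IsGeodesicFamily W (-δ) (b + δ) Φ ∧
      ∀ v ∈ W, velocityLift (fun r ↦ Φ (r, v)) 0 = (⟨p, v⟩ : TangentBundle 𝓘(ℝ, E) M) := by
  set S : Set ℝ := {s | ∃ δ > 0, ∃ W : Set E, ∃ Φ : ℝ × E → M, V ∈ W ∧
      g.IsGeodesicFamily W (-δ) (s + δ) Φ ∧
      ∀ v ∈ W, velocityLift (fun r ↦ Φ (r, v)) 0 = (⟨p, v⟩ : TangentBundle 𝓘(ℝ, E) M)} with hS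
  have h0 : (0 : ℝ) ∈ S := by
    obtain ⟨ε, hε, h⟩ := g.exists_isGeodesicFamily_of_chartState
      (z₀ := (extChartAt 𝓘(ℝ, E) p p, V)) (mem_extChartAt_target p)
    obtain ⟨Φ, hΦ, hΦ0⟩ := h 0 (fun v ↦ (extChartAt 𝓘(ℝ, E) p p, v)) (Metric.ball V ε)
      Metric.isOpen_ball (contDiffOn_const.prodMk contDiffOn_id) fun v hv ↦ by
        rw [Metric.mem_ball, Prod.dist_eq, max_lt_iff]
        exact ⟨by simpa using hε, hv⟩
    refine ⟨ε, hε, _, Φ, Metric.mem_ball_self hε, by simpa using hΦ, fun v hv ↦ ?_⟩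
    refine chartState_injective (x₀ := p) (hΦ0 v hv).1 (mem_extChartAt_source p) ?_
    rw [(hΦ0 v hv).2]
    exact Prod.ext rfl (chartDeriv_self (E := E) p v).symm
  -- near every parameter value the geodesics can be continued by a step of uniform length
  have hstep (s : ℝ) (hs : s ∈ Icc 0 b) : ∃ η > 0, ∀ s₁ ∈ Icc 0 b, |s₁ - s| < η → s₁ ∈ S →
      ∀ s₂ < s + η, s₂ ∈ S := by
    have hx := mem_extChartAt_source (I := 𝓘(ℝ, E)) (γ s)
    obtain ⟨ε, hε, h⟩ := g.exists_isGeodesicFamily_of_chartState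
      (z₀ := chartState (γ s) (velocityLift γ s)) (mem_extChartAt_target (γ s))
    have hev : ∀ᶠ r in 𝓝 s, γ r ∈ (extChartAt 𝓘(ℝ, E) (γ s)).source ∧
        chartState (γ s) (velocityLift γ r) ∈
          Metric.ball (chartState (γ s) (velocityLift γ s)) ε :=
      (eventually_mem_source (hγ.1 s hs).1.continuousAt hx).and
        ((hγ.1.hasDerivAt_chartState hs hx).continuousAt.eventually_mem
          (Metric.ball_mem_nhds _ hε))
    obtain ⟨η, hη, hball⟩ := Metric.eventually_nhds_iff.1 hev
    refine ⟨min η (ε / 2), lt_min hη (by linarith), ?_⟩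
    rintro s₁ hs₁ hs₁s ⟨δ, hδ, W, Φ, hVW, hΦ, hΦ0⟩ s₂ hs₂
    have hs₁' := abs_lt.1 (hs₁s.trans_le (min_le_right _ _))
    obtain ⟨hγs₁, hball₁⟩ := hball (show dist s₁ s < η from hs₁s.trans_le (min_le_left _ _))
    have hs₁I : s₁ ∈ Ioo (-δ) (s₁ + δ) := ⟨by linarith [hs₁.1], by linarith⟩
    have hlift : velocityLift (E := E) (fun r ↦ Φ (r, V)) s₁ = velocityLift γ s₁ :=
      ((hΦ.isGeodesicOn V hVW).mono (S' := Icc 0 s₁) fun r hr ↦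
        ⟨by linarith [hr.1], by linarith [hr.2]⟩).velocityLift_eq
        (hγ.1.mono (Icc_subset_Icc_right hs₁.2)) ((hΦ0 V hVW).trans hγ.2.symm) s₁
        ⟨hs₁.1, le_rfl⟩
    have hΦV : Φ (s₁, V) = γ s₁ := congrArg (fun z : TangentBundle 𝓘(ℝ, E) M ↦ z.1) hlift
    set σ : E → E × E :=
      fun v ↦ chartState (γ s) (velocityLift (E := E) (fun r ↦ Φ (r, v)) s₁) with hσ
    have hcont {v : E} (hv : v ∈ W) : ContinuousAt (fun v ↦ Φ (s₁, v)) v :=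
      ContinuousAt.comp (g := Φ) (f := fun v : E ↦ (s₁, v)) (hΦ.contMDiffAt hs₁I hv).continuousAt
        (by fun_prop)
    set W₀ : Set E := {v | v ∈ W ∧ Φ (s₁, v) ∈ (extChartAt 𝓘(ℝ, E) (γ s)).source ∧
      σ v ∈ Metric.ball (chartState (γ s) (velocityLift γ s)) ε} with hW₀
    set W₁ : Set E := interior W₀ with hW₁
    have hW₁W {v : E} (hv : v ∈ W₁) : v ∈ W ∧ Φ (s₁, v) ∈ (extChartAt 𝓘(ℝ, E) (γ s)).source ∧
      σ v ∈ Metric.ball (chartState (γ s) (velocityLift γ s)) ε := (interior_subset hv : v ∈ W₀)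
    have hVsrc : Φ (s₁, V) ∈ (extChartAt 𝓘(ℝ, E) (γ s)).source := by rwa [hΦV]
    have hVW₁ : V ∈ W₁ := by
      rw [hW₁, mem_interior_iff_mem_nhds]
      refine Filter.inter_mem (hΦ.isOpen.mem_nhds hVW) (Filter.inter_mem
        ((hcont hVW).eventually ((isOpen_chart_source (γ s)).mem_nhds hVsrc))
        ((hΦ.contDiffAt_chartState hs₁I hVW hVsrc).continuousAt.eventually_mem
          (Metric.isOpen_ball.mem_nhds ?_)))
      rwa [hlift]
    obtain ⟨Φ₂, hΦ₂, hΦ₂0⟩ := h s₁ σ W₁ isOpen_interior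
      (fun v hv ↦ (hΦ.contDiffAt_chartState hs₁I (hW₁W hv).1 (hW₁W hv).2.1).contDiffWithinAt)
      (fun v hv ↦ (hW₁W hv).2.2)
    obtain ⟨Φ', hΦ', c, hc, hΦ'eq⟩ := (hΦ.mono isOpen_interior (fun v hv ↦ (hW₁W hv).1) le_rfl
      le_rfl).glue (s₁ := s₁) (b₂ := s₁ + ε) (hΦ₂.mono isOpen_interior le_rfl (by linarith) le_rfl)
      hs₁I.1 hs₁I.2 (by linarith)
      fun v hv ↦ chartState_injective (hW₁W hv).2.1 (hΦ₂0 v hv).1 (hΦ₂0 v hv).2.symm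
    have hs₂' : s₂ < s₁ + ε := by
      have := min_le_right η (ε / 2)
      linarith
    have hΦ'0 (v : E) (hv : v ∈ W₁) :
        velocityLift (fun r ↦ Φ' (r, v)) 0 = (⟨p, v⟩ : TangentBundle 𝓘(ℝ, E) M) := by
      have h0I : (0 : ℝ) ∈ Ioo (-δ) (s₁ + δ) := ⟨by linarith, by linarith [hs₁.1]⟩
      rw [← hΦ0 v (hW₁W hv).1]
      refine velocityLift_congr
        ((hΦ.isGeodesicOn v (hW₁W hv).1 0 h0I).1.mdifferentiableAt two_ne_zero) ?_
      filter_upwards [Iic_mem_nhds (hs₁.1.trans_lt hc)] with r hr using hΦ'eq (r, v) hr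
    exact ⟨min δ (s₁ + ε - s₂), lt_min hδ (by linarith), W₁, Φ', hVW₁,
      hΦ'.mono isOpen_interior le_rfl (neg_le_neg (min_le_left _ _))
        (by linarith [min_le_right δ (s₁ + ε - s₂)]), hΦ'0⟩
  have hsub : Icc 0 b ⊆ S := by
    refine IsClosed.Icc_subset_of_forall_mem_nhdsWithin ?_ h0 ?_
    · refine isClosed_of_closure_subset fun s hs ↦ ?_
      have hsI : s ∈ Icc 0 b := isClosed_Icc.closure_subset_iff.2 inter_subset_right hs
      obtain ⟨η, hη, h⟩ := hstep s hsI
      obtain ⟨s₁, hs₁, hdist⟩ := Metric.mem_closure_iff.1 hs η hη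
      rw [dist_comm] at hdist
      exact ⟨h s₁ hs₁.2 hdist hs₁.1 s (by linarith), hsI⟩
    · rintro s ⟨hs, hsI⟩
      obtain ⟨η, hη, h⟩ := hstep s (Ico_subset_Icc_self hsI)
      exact mem_nhdsWithin_of_mem_nhds (Filter.mem_of_superset (Iio_mem_nhds (by linarith))
        fun r hr ↦ h s (Ico_subset_Icc_self hsI) (by simpa using hη) hs r hr)
  exact hsub ⟨hb, le_rfl⟩

end LorentzianMetric
end Family

/-! ### Variation fields and the exponential map -/

section Variation

set_option maxSynthPendingDepth 3
set_option linter.unusedSectionVars false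

variable {E M : Type*} [NormedAddCommGroup E] [NormedSpace ℝ E] [FiniteDimensional ℝ E]
  [TopologicalSpace M] [ChartedSpace E M] [IsManifold 𝓘(ℝ, E) ∞ M]

/-- The variation field of the family `Φ` at `Φ(·, V)` in the direction `w`. -/
def variationField (Φ : ℝ × E → M) (V w : E) (s : ℝ) : TangentSpace 𝓘(ℝ, E) (Φ (s, V)) :=
  mfderiv 𝓘(ℝ, E) 𝓘(ℝ, E) (fun v ↦ Φ (s, v)) V w

namespace LorentzianMetric

variable {g : LorentzianMetric E M}

lemma IsGeodesicFrom.expMap_eq [T2Space M] {p : M} {V : E} {γ : ℝ → M}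
    (h : g.IsGeodesicFrom p V γ 1) : g.expMap p V = γ 1 := by
  have hex : ∃ γ : ℝ → M, g.IsGeodesicFrom p V γ 1 := ⟨γ, h⟩
  have h1 : g.expMap p V = hex.choose 1 := dif_pos hex
  rw [h1]
  exact congrArg (fun z : TangentBundle 𝓘(ℝ, E) M ↦ z.1)
    (hex.choose_spec.1.velocityLift_eq h.1 (hex.choose_spec.2.trans h.2.symm) 1
      ⟨zero_le_one, le_rfl⟩)

namespace IsGeodesicFamily

variable {W : Set E} {a b : ℝ} {Φ : ℝ × E → M}

lemma contMDiffAt_right (h : g.IsGeodesicFamily W a b Φ) {s : ℝ} {v : E} (hs : s ∈ Ioo a b)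
    (hv : v ∈ W) : ContMDiffAt 𝓘(ℝ, E) 𝓘(ℝ, E) ∞ (fun v ↦ Φ (s, v)) v :=
  ContMDiffAt.comp (g := Φ) (f := fun v : E ↦ (s, v)) v (h.contMDiffAt hs hv)
    (contDiffAt_const.prodMk contDiffAt_id).contMDiffAt

lemma chartDeriv_variationField (h : g.IsGeodesicFamily W a b Φ) {s : ℝ} {V : E}
    (hs : s ∈ Ioo a b) (hV : V ∈ W) {x₀ : M} (hx : Φ (s, V) ∈ (extChartAt 𝓘(ℝ, E) x₀).source)
    (w : E) : chartDeriv x₀ (Φ (s, V)) (variationField Φ V w s) =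
      fderiv ℝ (fun q ↦ (extChartAt 𝓘(ℝ, E) x₀ (Φ q) : E)) (s, V) (0, w) := by
  have h1 := mfderiv_comp (I := 𝓘(ℝ, E)) (I' := 𝓘(ℝ, E)) (I'' := 𝓘(ℝ, E)) V
    (g := extChartAt 𝓘(ℝ, E) x₀) (f := fun v ↦ Φ (s, v)) (mdifferentiableAt_chart hx)
    ((h.contMDiffAt_right hs hV).mdifferentiableAt (by simp))
  have h2 := HasFDerivAt.comp (g := fun q ↦ (extChartAt 𝓘(ℝ, E) x₀ (Φ q) : E))
    (f := fun v : E ↦ (s, v)) V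
    ((h.contDiffAt_chart hs hV hx).differentiableAt (by simp)).hasFDerivAt
    ((hasFDerivAt_const s V).prodMk (hasFDerivAt_id V))
  have h3 : mfderiv 𝓘(ℝ, E) 𝓘(ℝ, E) (extChartAt 𝓘(ℝ, E) x₀ ∘ fun v ↦ Φ (s, v)) V w =
      fderiv ℝ (fun q ↦ (extChartAt 𝓘(ℝ, E) x₀ (Φ q) : E)) (s, V) (0, w) := by
    rw [mfderiv_eq_fderiv]
    exact congrArg (fun A : E →L[ℝ] E ↦ A w) h2.fderiv
  rw [← h3, h1]
  rfl

/-- The two-parameter map `(r, τ) ↦ Φ(r, V + τ w)` in a chart. -/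
lemma hasFDerivAt_line (h : g.IsGeodesicFamily W a b Φ) {V w : E} {q : ℝ × ℝ}
    (hs : q.1 ∈ Ioo a b) (hV : V + q.2 • w ∈ W) {x₀ : M}
    (hx : Φ (q.1, V + q.2 • w) ∈ (extChartAt 𝓘(ℝ, E) x₀).source) :
    HasFDerivAt (fun q : ℝ × ℝ ↦ (extChartAt 𝓘(ℝ, E) x₀ (Φ (q.1, V + q.2 • w)) : E))
      (fderiv ℝ (fun q ↦ (extChartAt 𝓘(ℝ, E) x₀ (Φ q) : E)) (q.1, V + q.2 • w) ∘L
        (ContinuousLinearMap.fst ℝ ℝ ℝ).prod ((ContinuousLinearMap.snd ℝ ℝ ℝ).smulRight w)) q :=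
  HasFDerivAt.comp (g := fun q ↦ (extChartAt 𝓘(ℝ, E) x₀ (Φ q) : E))
    (f := fun q : ℝ × ℝ ↦ (q.1, V + q.2 • w)) q
    ((h.contDiffAt_chart hs hV hx).differentiableAt (by simp)).hasFDerivAt
    (hasFDerivAt_fst.prodMk ((hasFDerivAt_snd.smul_const w).const_add V))

lemma eventually_line (h : g.IsGeodesicFamily W a b Φ) {V w : E} {s : ℝ}
    (hs : s ∈ Ioo a b) (hV : V ∈ W) {x₀ : M}
    (hx : Φ (s, V) ∈ (extChartAt 𝓘(ℝ, E) x₀).source) :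
    ∀ᶠ q : ℝ × ℝ in 𝓝 (s, 0), q.1 ∈ Ioo a b ∧ V + q.2 • w ∈ W ∧
      Φ (q.1, V + q.2 • w) ∈ (extChartAt 𝓘(ℝ, E) x₀).source := by
  have hline : ContinuousAt (fun q : ℝ × ℝ ↦ (q.1, V + q.2 • w)) (s, 0) := by fun_prop
  have h1 : ∀ᶠ z : ℝ × E in 𝓝 (s, V + (0 : ℝ) • w), z ∈ Ioo a b ×ˢ W ∧
      Φ z ∈ (extChartAt 𝓘(ℝ, E) x₀).source := by
    rw [zero_smul, add_zero]
    exact Filter.Eventually.and ((isOpen_Ioo.prod h.isOpen).mem_nhds ⟨hs, hV⟩)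
      ((h.contMDiffAt hs hV).continuousAt.eventually ((isOpen_chart_source x₀).mem_nhds hx))
  filter_upwards [hline.eventually h1] with q hq using ⟨hq.1.1, hq.1.2, hq.2⟩

/-- The variation field of a family of geodesics is a Jacobi field. -/
lemma isJacobiFieldOn (h : g.IsGeodesicFamily W a b Φ) {V : E} (hV : V ∈ W) (w : E) :
    g.IsJacobiFieldOn (fun r ↦ Φ (r, V)) (variationField Φ V w) (Ioo a b) := by
  intro s hs
  set γ : ℝ → M := fun r ↦ Φ (r, V) with hγdef
  set x₀ : M := γ s with hx₀
  have hx : γ s ∈ (extChartAt 𝓘(ℝ, E) x₀).source := mem_extChartAt_source (γ s)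
  have hγ : ContMDiffAt 𝓘(ℝ, ℝ) 𝓘(ℝ, E) 2 γ s := (h.isGeodesicOn V hV s hs).1
  set X : ℝ × E → E := fun q ↦ extChartAt 𝓘(ℝ, E) x₀ (Φ q) with hX
  set x : ℝ × ℝ → E := fun q ↦ X (q.1, V + q.2 • w) with hxdef
  have hXs : ContDiffAt ℝ ∞ X (s, V) := h.contDiffAt_chart hs hV hx
  have hxs : ContDiffAt ℝ ∞ x (s, 0) := by
    refine ContDiffAt.comp (g := X) (f := fun q : ℝ × ℝ ↦ (q.1, V + q.2 • w)) (s, 0) ?_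
      (contDiffAt_fst.prodMk (contDiffAt_const.add (contDiffAt_snd.smul contDiffAt_const)))
    simpa using hXs
  have hline := h.eventually_line (w := w) hs hV hx
  have hcurve (τ : ℝ) : (fun r ↦ x (r, τ)) = chartCurve x₀ (fun r ↦ Φ (r, V + τ • w)) := rfl
  have hcurve0 : (fun r ↦ x (r, 0)) = (chartCurve x₀ γ : ℝ → E) := by
    rw [hcurve, zero_smul, add_zero]
  have hnear : ∀ᶠ r in 𝓝 s, r ∈ Ioo a b ∧ γ r ∈ (extChartAt 𝓘(ℝ, E) x₀).source :=
    Filter.Eventually.and (isOpen_Ioo.mem_nhds hs) (eventually_mem_source hγ.continuousAt hx)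
  -- the variation field in the chart
  have hJ : chartVec x₀ γ (variationField Φ V w) =ᶠ[𝓝 s] fun r ↦ fderiv ℝ x (r, 0) (0, 1) := by
    filter_upwards [hnear] with r hr
    have h1 := h.hasFDerivAt_line (w := w) (q := (r, 0)) (x₀ := x₀) hr.1 (by simpa using hV)
      (by simpa using hr.2)
    rw [show fderiv ℝ x (r, 0) = _ from h1.fderiv]
    refine (h.chartDeriv_variationField hr.1 hV hr.2 w).trans ?_
    simp
  have hslice : ContDiffAt ℝ ∞ (fun r : ℝ ↦ (r, (0 : ℝ))) s := contDiffAt_id.prodMk contDiffAt_const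
  have hJ2 : ContDiffAt ℝ 2 (chartVec x₀ γ (variationField Φ V w)) s := by
    refine ContDiffAt.congr_of_eventuallyEq ?_ hJ
    exact ((ContDiffAt.comp (g := fderiv ℝ x) s (hxs.fderiv_right (m := ∞) (by simp))
      hslice).clm_apply contDiffAt_const).of_le ENat.LEInfty.out
  have hJd : ∀ᶠ r in 𝓝 s, DifferentiableAt ℝ (chartVec x₀ γ (variationField Φ V w)) r := by
    filter_upwards [hJ2.eventually (by simp)] with r hr using hr.differentiableAt two_ne_zero
  -- the geodesic equation for the nearby curves
  have hgeo : ∀ᶠ q in 𝓝 (s, (0 : ℝ)), fderiv ℝ (fun q ↦ fderiv ℝ x q (1, 0)) q (1, 0)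
      + christoffelCLM (g.coordMetric x₀) (x q) (fderiv ℝ x q (1, 0)) (fderiv ℝ x q (1, 0)) =
        0 := by
    have hd1 : ∀ᶠ q in 𝓝 (s, (0 : ℝ)), ContDiffAt ℝ 2 x q :=
      (hxs.of_le (m := 2) ENat.LEInfty.out).eventually (by simp)
    filter_upwards [hline, hd1] with q hq hq2
    have hder {r : ℝ} (hr : DifferentiableAt ℝ x (r, q.2)) :
        deriv (fun r ↦ x (r, q.2)) r = fderiv ℝ x (r, q.2) (1, 0) :=
      (HasFDerivAt.comp_hasDerivAt (l := x) (f := fun r : ℝ ↦ (r, q.2)) r hr.hasFDerivAt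
        ((hasDerivAt_id r).prodMk (hasDerivAt_const r q.2))).deriv
    have hev : deriv (fun r ↦ x (r, q.2)) =ᶠ[𝓝 q.1] fun r ↦ fderiv ℝ x (r, q.2) (1, 0) := by
      have h1 : ContinuousAt (fun r : ℝ ↦ (r, q.2)) q.1 := by fun_prop
      filter_upwards [h1.eventually (hq2.eventually (by simp))] with r hr
      exact hder (hr.differentiableAt two_ne_zero)
    have hdd : DifferentiableAt ℝ (fun q ↦ fderiv ℝ x q (1, 0)) q :=
      ((hq2.fderiv_right (m := 1) (by norm_num)).clm_apply contDiffAt_const).differentiableAt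
        one_ne_zero
    have hder2 : deriv (fun r ↦ fderiv ℝ x (r, q.2) (1, 0)) q.1 =
        fderiv ℝ (fun q ↦ fderiv ℝ x q (1, 0)) q (1, 0) :=
      (HasFDerivAt.comp_hasDerivAt (l := fun q ↦ fderiv ℝ x q (1, 0))
        (f := fun r : ℝ ↦ (r, q.2)) q.1 hdd.hasFDerivAt
        ((hasDerivAt_id q.1).prodMk (hasDerivAt_const q.1 q.2))).deriv
    obtain ⟨h2, h3⟩ := h.isGeodesicOn _ hq.2.1 q.1 hq.1
    have h4 := (g.covDerivAlong_velocity_eq_zero_iff h2 hq.2.2).1 h3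
    rw [← hcurve, hev.deriv_eq, hev.self_of_nhds, hder2] at h4
    exact h4
  have hγ1 : ContMDiffAt 𝓘(ℝ, ℝ) 𝓘(ℝ, E) 1 γ s := hγ.of_le (by norm_num)
  constructor
  · have : IsManifold 𝓘(ℝ, E) (2 + 1) M := IsManifold.of_le (n := ∞)
      (by rw [show (2 : WithTop ℕ∞) + 1 = 3 by norm_num]; exact ENat.LEInfty.out)
    exact (contMDiffAt_tangentBundle_iff (x₀ := x₀) hx).2 ⟨hγ, hJ2.contMDiffAt⟩
  · have hcov : chartVec x₀ γ (g.covDerivAlong γ (variationField Φ V w)) =ᶠ[𝓝 s]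
        covDeriv (g.coordMetric x₀) (fun r ↦ x (r, 0)) (fun r ↦ fderiv ℝ x (r, 0) (0, 1)) := by
      filter_upwards [hnear, hJd, hJ.eventuallyEq_nhds, eventually_contMDiffAt hγ]
        with r hr hr' hJr hγr
      refine (g.chartDeriv_covDerivAlong (hγr.of_le (by norm_num)) hr.2 hr').trans ?_
      rw [hcurve0, covDeriv, covDeriv, hJr.deriv_eq, hJr.self_of_nhds]
    have hdiff : DiffAlong γ (g.covDerivAlong γ (variationField Φ V w)) s :=
      (g.contDiffAt_chartVec_covDerivAlong hγ hx hJ2).differentiableAt one_ne_zero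
    have hvel : @Eq E (velocity (E := E) γ s) (deriv (chartCurve x₀ γ : ℝ → E) s) :=
      (chartDeriv_self _ _).symm.trans (chartVec_velocity (hγ.mdifferentiableAt two_ne_zero) hx)
    have hJs : @Eq E (variationField Φ V w s) (fderiv ℝ x (s, 0) (0, 1)) :=
      (chartDeriv_self _ _).symm.trans hJ.self_of_nhds
    have hxs0 : x (s, 0) = extChartAt 𝓘(ℝ, E) (γ s) (γ s) := congrFun hcurve0 s
    have hfin := (g.isSmoothMetricOn x₀).jacobi_of_variation hxs
      (by rw [hxs0]; exact mem_extChartAt_target (γ s)) hgeo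
    have hcov2 : @Eq E (g.covDerivAlong γ (g.covDerivAlong γ (variationField Φ V w)) s)
        (covDeriv (g.coordMetric x₀) (fun r ↦ x (r, 0))
          (covDeriv (g.coordMetric x₀) (fun r ↦ x (r, 0)) fun r ↦ fderiv ℝ x (r, 0) (0, 1)) s) := by
      refine (g.covDerivAlong_eq_covDeriv hγ1 hdiff).trans ?_
      rw [hcurve0, covDeriv, covDeriv, ← hcurve0, hcov.deriv_eq, hcov.self_of_nhds]
    have hcurv : @Eq E (g.curvature (γ s) (variationField Φ V w s) (velocity γ s) (velocity γ s))
        (curvatureOf (g.coordMetric x₀) (x (s, 0)) (fderiv ℝ x (s, 0) (0, 1))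
          (deriv (fun r ↦ x (r, 0)) s) (deriv (fun r ↦ x (r, 0)) s)) := by
      refine (g.curvature_eq _ _ _ _).trans ?_
      rw [hxs0, hcurve0]
      exact congrArg₂ (fun J v : E ↦ curvatureOf (g.coordMetric x₀)
        (extChartAt 𝓘(ℝ, E) (γ s) (γ s)) J v v) hJs hvel
    exact (congrArg₂ (fun u v : E ↦ u + v) hcov2 hcurv).trans hfin

/-- The variation field of geodesics from a fixed point has the initial derivative `w`, by the
symmetry of second derivatives; if it vanishes for small positive parameters, then `w = 0`. -/
lemma eq_zero_of_variationField_eq_zero (h : g.IsGeodesicFamily W a b Φ) {p : M}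
    (h0 : ∀ v ∈ W, velocityLift (fun r ↦ Φ (r, v)) 0 = (⟨p, v⟩ : TangentBundle 𝓘(ℝ, E) M))
    (ha : a < 0) (hb : 0 < b) {V : E} (hV : V ∈ W) {w : E}
    (hw : ∀ᶠ s in 𝓝[>] (0 : ℝ), variationField Φ V w s = 0) : w = 0 := by
  have hs : (0 : ℝ) ∈ Ioo a b := ⟨ha, hb⟩
  have hp (v : E) (hv : v ∈ W) : Φ (0, v) = p :=
    congrArg (fun z : TangentBundle 𝓘(ℝ, E) M ↦ z.1) (h0 v hv)
  have hx (v : E) (hv : v ∈ W) : Φ (0, v) ∈ (extChartAt 𝓘(ℝ, E) p).source := by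
    rw [hp v hv]
    exact mem_extChartAt_source p
  set X : ℝ × E → E := fun q ↦ extChartAt 𝓘(ℝ, E) p (Φ q) with hX
  have hXs : ContDiffAt ℝ ∞ X (0, V) := h.contDiffAt_chart hs hV (hx V hV)
  have hd : HasFDerivAt (fderiv ℝ X) (fderiv ℝ (fderiv ℝ X) (0, V)) (0, V) :=
    ((hXs.fderiv_right (m := ∞) (by simp)).differentiableAt (by simp)).hasFDerivAt
  -- `∂_v ∂_s X (0, V) w = w`
  have hvel (v : E) (hv : v ∈ W) : fderiv ℝ X (0, v) (1, 0) = v := by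
    rw [← h.deriv_chartCurve hs hv (hx v hv), ← chartVec_velocity
      ((h.isGeodesicOn v hv 0 hs).1.mdifferentiableAt two_ne_zero) (hx v hv)]
    have h1 := congrArg (fun z ↦ (chartState p z).2) (h0 v hv)
    exact h1.trans (chartDeriv_self (E := E) p v)
  have h1 : fderiv ℝ (fderiv ℝ X) (0, V) (0, w) (1, 0) = w := by
    have h2 : HasFDerivAt (fun v ↦ fderiv ℝ X (0, v) (1, 0)) _ V :=
      (HasFDerivAt.comp (g := fderiv ℝ X) (f := fun v : E ↦ ((0 : ℝ), v)) V hd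
        ((hasFDerivAt_const (0 : ℝ) V).prodMk (hasFDerivAt_id V))).clm_apply
        (hasFDerivAt_const ((1 : ℝ), (0 : E)) V)
    have h3 : HasFDerivAt (fun v ↦ fderiv ℝ X (0, v) (1, 0)) (ContinuousLinearMap.id ℝ E) V :=
      (hasFDerivAt_id V).congr_of_eventuallyEq (by
        filter_upwards [h.isOpen.mem_nhds hV] with v hv using hvel v hv)
    simpa using congrArg (fun A : E →L[ℝ] E ↦ A w) (h2.unique h3)
  -- `∂_s ∂_v X (0, V) w = 0`
  have h2 : fderiv ℝ (fderiv ℝ X) (0, V) (1, 0) (0, w) = 0 := by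
    have h3 : HasDerivAt (fun r ↦ fderiv ℝ X (r, V) (0, w))
        (fderiv ℝ (fderiv ℝ X) (0, V) (1, 0) (0, w)) 0 := by
      have := (HasFDerivAt.comp_hasDerivAt (l := fderiv ℝ X) (f := fun r : ℝ ↦ (r, V)) 0 hd
        ((hasDerivAt_id (0 : ℝ)).prodMk (hasDerivAt_const (0 : ℝ) V))).clm_apply
        (hasDerivAt_const (0 : ℝ) ((0 : ℝ), w))
      simpa using this
    have hev : ∀ᶠ r in 𝓝[>] (0 : ℝ), fderiv ℝ X (r, V) (0, w) = 0 := by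
      have hnear : ∀ᶠ r in 𝓝[>] (0 : ℝ), r ∈ Ioo a b ∧
          Φ (r, V) ∈ (extChartAt 𝓘(ℝ, E) p).source :=
        mem_nhdsWithin_of_mem_nhds (Filter.Eventually.and (isOpen_Ioo.mem_nhds hs)
          (eventually_mem_source (h.isGeodesicOn V hV 0 hs).1.continuousAt (hx V hV)))
      filter_upwards [hw, hnear] with r hr hr'
      rw [← h.chartDeriv_variationField hr'.1 hV hr'.2, hr, map_zero]
    have hzero : fderiv ℝ X (0, V) (0, w) = 0 :=
      tendsto_nhds_unique_of_eventuallyEq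
        (h3.continuousAt.tendsto.mono_left nhdsWithin_le_nhds) tendsto_const_nhds hev
    have h4 : HasDerivWithinAt (fun r ↦ fderiv ℝ X (r, V) (0, w)) 0 (Ioi 0) 0 :=
      (hasDerivWithinAt_const (0 : ℝ) (Ioi 0) (0 : E)).congr_of_eventuallyEq hev hzero
    exact (uniqueDiffWithinAt_Ioi (0 : ℝ)).eq_deriv _ h3.hasDerivWithinAt h4
  have hsym := (hXs.isSymmSndFDerivAt
    (by rw [minSmoothness_of_isRCLikeNormedField]; exact ENat.LEInfty.out)).eq (0, w) (1, 0)
  rw [h1, h2] at hsym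
  exact hsym

end IsGeodesicFamily

/-- The exponential map is smooth near `V`, and if its differential at `V` has a kernel, then
`exp_p V` is conjugate to `p`. Since `γ` is only constrained on `[0, 1]`, the Jacobi field lives
along another curve `γ'` with the same restriction to `[0, 1]`, the member of a smooth family of
geodesics. -/
lemma IsGeodesicFrom.exists_smooth_expMap [T2Space M] {p : M} {V : E} {γ : ℝ → M}
    (hγ : g.IsGeodesicFrom p V γ 1) : ∃ W : Set E, IsOpen W ∧ V ∈ W ∧
      ContMDiffOn 𝓘(ℝ, E) 𝓘(ℝ, E) ∞ (fun v : E ↦ g.expMap p v) W ∧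
      ((∃ w : E, w ≠ 0 ∧ mfderiv 𝓘(ℝ, E) 𝓘(ℝ, E) (fun v : E ↦ g.expMap p v) V w = 0) →
        ∃ γ' : ℝ → M, g.IsGeodesicFrom p V γ' 1 ∧ (∀ s ∈ Icc (0 : ℝ) 1, γ' s = γ s) ∧
          g.IsConjugateAlong γ' 1) := by
  obtain ⟨δ, hδ, W, Φ, hVW, hΦ, hΦ0⟩ := exists_isGeodesicFamily zero_le_one hγ
  have hsub : Icc (0 : ℝ) 1 ⊆ Ioo (-δ) (1 + δ) := fun s hs ↦
    ⟨by linarith [hs.1], by linarith [hs.2]⟩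
  have hfrom (v : E) (hv : v ∈ W) : g.IsGeodesicFrom p v (fun r ↦ Φ (r, v)) 1 :=
    ⟨(hΦ.isGeodesicOn v hv).mono hsub, hΦ0 v hv⟩
  have hexp (v : E) (hv : v ∈ W) : g.expMap p v = Φ (1, v) := (hfrom v hv).expMap_eq
  have h0I : (0 : ℝ) ∈ Icc (0 : ℝ) 1 := ⟨le_rfl, zero_le_one⟩
  have h1I : (1 : ℝ) ∈ Icc (0 : ℝ) 1 := ⟨zero_le_one, le_rfl⟩
  refine ⟨W, hΦ.isOpen, hVW, fun v hv ↦ ?_, ?_⟩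
  · exact ((hΦ.contMDiffAt_right (hsub h1I) hv).contMDiffWithinAt).congr
      (fun u hu ↦ hexp u hu) (hexp v hv)
  rintro ⟨w, hw, hker⟩
  refine ⟨fun r ↦ Φ (r, V), hfrom V hVW, fun s hs ↦
    congrArg (fun z : TangentBundle 𝓘(ℝ, E) M ↦ z.1) ((hfrom V hVW).1.velocityLift_eq hγ.1
      ((hfrom V hVW).2.trans hγ.2.symm) s hs), variationField Φ V w,
    fun s hs ↦ hΦ.isJacobiFieldOn hVW w s (hsub hs), ?_, ?_, ?_⟩
  · have h1 : (fun v ↦ Φ (0, v)) =ᶠ[𝓝 V] fun _ ↦ p := by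
      filter_upwards [hΦ.isOpen.mem_nhds hVW] with v hv
      exact congrArg (fun z : TangentBundle 𝓘(ℝ, E) M ↦ z.1) (hΦ0 v hv)
    have h2 : HasMFDerivAt 𝓘(ℝ, E) 𝓘(ℝ, E) (fun v ↦ Φ (0, v)) V (0 : E →L[ℝ] E) :=
      (hasMFDerivAt_const p V).congr_of_eventuallyEq h1
    rw [variationField, h2.mfderiv]
    rfl
  · have h1 : (fun v ↦ Φ (1, v)) =ᶠ[𝓝 V] fun v ↦ g.expMap p v := by
      filter_upwards [hΦ.isOpen.mem_nhds hVW] with v hv using (hexp v hv).symm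
    have h2 : HasMFDerivAt 𝓘(ℝ, E) 𝓘(ℝ, E) (fun v : E ↦ g.expMap p v) V
        (mfderiv 𝓘(ℝ, E) 𝓘(ℝ, E) (fun v ↦ Φ (1, v)) V : E →L[ℝ] E) :=
      ((hΦ.contMDiffAt_right (hsub h1I) hVW).mdifferentiableAt
        (by simp)).hasMFDerivAt.congr_of_eventuallyEq h1.symm
    rw [h2.mfderiv] at hker
    exact hker
  · by_contra! hall
    refine hw (hΦ.eq_zero_of_variationField_eq_zero hΦ0 (by linarith) (by linarith) hVW ?_)
    filter_upwards [Icc_mem_nhdsGT zero_lt_one] with s hs using hall s hs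

end LorentzianMetric

/-- The inverse function theorem: a smooth map with injective differential at `V` restricts, near
`V`, to a diffeomorphism from any set onto its image. -/
lemma isLocalDiffeoOntoImageAt_of_mfderiv {f : E → M} {W : Set E} (hW : IsOpen W) {V : E}
    (hV : V ∈ W) (hf : ContMDiffOn 𝓘(ℝ, E) 𝓘(ℝ, E) ∞ f W)
    (hinj : ∀ w : E, mfderiv 𝓘(ℝ, E) 𝓘(ℝ, E) f V w = 0 → w = 0) (N : Set E) :
    IsLocalDiffeoOntoImageAt f N V := by
  have : CompleteSpace E := FiniteDimensional.complete ℝ E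
  have hx := mem_extChartAt_source (I := 𝓘(ℝ, E)) (f V)
  set U : Set E := W ∩ f ⁻¹' (extChartAt 𝓘(ℝ, E) (f V)).source with hU
  have hUo : IsOpen U := hf.continuousOn.isOpen_inter_preimage hW (isOpen_chart_source _)
  have hfV := hf.contMDiffAt (hW.mem_nhds hV)
  set Θ : E → E := fun v ↦ extChartAt 𝓘(ℝ, E) (f V) (f v) with hΘ
  have hΘs : ContDiffOn ℝ ∞ Θ U := fun v hv ↦ (contMDiffAt_iff_contDiffAt.1
    (ContMDiffAt.comp (g := extChartAt 𝓘(ℝ, E) (f V)) v (contMDiffAt_chart hv.2)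
      (hf.contMDiffAt (hW.mem_nhds hv.1)))).contDiffWithinAt
  have hVU : V ∈ U := ⟨hV, hx⟩
  have hker (w : E) (hw : fderiv ℝ Θ V w = 0) : w = 0 := by
    refine hinj w (chartDeriv_injective hx ?_)
    rw [map_zero, ← hw, ← mfderiv_eq_fderiv, show Θ = extChartAt 𝓘(ℝ, E) (f V) ∘ f from rfl,
      mfderiv_comp V (mdifferentiableAt_chart hx) (hfV.mdifferentiableAt (by simp))]
    rfl
  have hinj' : Function.Injective (fderiv ℝ Θ V).toLinearMap :=
    (injective_iff_map_eq_zero _).2 hker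
  set L : E ≃L[ℝ] E := (LinearEquiv.ofInjectiveEndo _ hinj').toContinuousLinearEquiv with hL
  obtain ⟨θ, hθV, hθU, hθ, hsymm⟩ := exists_smooth_localInverse hUo hΘs hVU L (by
    have h1 : (L : E →L[ℝ] E) = fderiv ℝ Θ V := by
      ext w
      rfl
    rw [h1]
    exact ((hΘs.contDiffAt (hUo.mem_nhds hVU)).differentiableAt (by simp)).hasFDerivAt)
  refine ⟨θ.source, (extChartAt 𝓘(ℝ, E) (f V)).source ∩
    extChartAt 𝓘(ℝ, E) (f V) ⁻¹' θ.target, θ.symm ∘ extChartAt 𝓘(ℝ, E) (f V), θ.open_source, hθV,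
    (continuousOn_extChartAt (f V)).isOpen_inter_preimage (isOpen_chart_source _) θ.open_target,
    hf.mono fun v hv ↦ (hθU hv).1, ?_, ?_⟩
  · exact (contMDiffOn_iff_contDiffOn.2 hsymm).comp
      (fun x hx ↦ (contMDiffAt_chart hx.1).contMDiffWithinAt) fun x hx ↦ hx.2
  · rintro u ⟨hu, -⟩
    have h1 : extChartAt 𝓘(ℝ, E) (f V) (f u) = θ u := (hθ u).symm
    refine ⟨⟨(hθU hu).2, ?_⟩, ?_⟩
    · rw [mem_preimage, h1]
      exact θ.map_source hu
    · rw [Function.comp_apply, h1]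
      exact θ.left_inv hu

end Variation

/-! ### The past null conjugacy radius -/

section Radius

variable {E M : Type*} [NormedAddCommGroup E] [NormedSpace ℝ E] [FiniteDimensional ℝ E]
  [TopologicalSpace M] [ChartedSpace E M] [IsManifold 𝓘(ℝ, E) ∞ M]
  {g : LorentzianMetric E M} {o : g.TimeOrientation} {t : M → ℝ} {Ω : Set M} {p : M}

/-- If no point on the past null geodesics from `p` above the level `t₀` is conjugate to `p`, then
`exp_p` restricted to the past null cone is a local diffeomorphism at the vectors above `t₀`. -/
lemma isLocalDiffeoOntoImageAt_expMap [T2Space M] {t₀ : ℝ}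
    (hconj : ∀ γ : ℝ → M, o.IsPastNullGeodesic Ω p γ 1 → t₀ ≤ t (γ 1) → ¬ g.IsConjugateAlong γ 1)
    {V : E} (hV : V ∈ o.truncatedCone t Ω p t₀) :
    IsLocalDiffeoOntoImageAt (fun v : E ↦ g.expMap p v) (o.pastNullCone p) V := by
  obtain ⟨hnull, ⟨γ, hγ, hγΩ⟩, ht⟩ := hV
  obtain ⟨W, hW, hVW, hsmooth, hker⟩ := hγ.exists_smooth_expMap
  refine isLocalDiffeoOntoImageAt_of_mfderiv hW hVW hsmooth (fun w hw ↦ ?_) _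
  by_contra hw0
  obtain ⟨γ', hγ', heq, hc⟩ := hker ⟨w, hw0, hw⟩
  have h0 : o.IsPastNull (γ' 0) (velocity γ' 0) :=
    (congrArg (fun z : TangentBundle 𝓘(ℝ, E) M ↦ o.IsPastNull z.1 z.2) hγ'.2).mpr hnull
  refine hconj γ' ⟨hγ'.1, congrArg (fun z : TangentBundle 𝓘(ℝ, E) M ↦ z.1) hγ'.2, h0,
    fun s hs ↦ heq s hs ▸ hγΩ s hs⟩ ?_ hc
  rw [← hγ'.expMap_eq]
  exact ht.1

lemma ofReal_le_nullConjugacyRadius [T2Space M] {τ : ℝ} (hτ : τ < 0)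
    (hconj : ∀ γ : ℝ → M, o.IsPastNullGeodesic Ω p γ 1 → τ < t (γ 1) →
      ¬ g.IsConjugateAlong γ 1) :
    ENNReal.ofReal |τ| ≤ nullConjugacyRadius o t Ω p := by
  -- the level `τ` itself need not be admissible, only those strictly above it
  refine le_of_forall_lt_imp_le_of_dense fun c hc ↦ ?_
  have hctop : c ≠ ⊤ := (hc.trans ENNReal.ofReal_lt_top).ne
  have hlt : c.toReal < -τ := by
    rw [← abs_of_neg hτ]
    exact (ENNReal.lt_ofReal_iff_toReal_lt hctop).1 hc
  refine le_sSup ⟨-c.toReal, neg_nonpos.2 ENNReal.toReal_nonneg, ?_, fun V hV ↦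
    isLocalDiffeoOntoImageAt_expMap (fun γ hγ hγt ↦ hconj γ hγ (by linarith)) hV⟩
  rw [abs_neg, abs_of_nonneg ENNReal.toReal_nonneg, ENNReal.ofReal_toReal hctop]

end Radius
end NullConjugacy
end

theorem proposition3p2 {E M : Type*} [NormedAddCommGroup E] [NormedSpace ℝ E]
    [FiniteDimensional ℝ E] [TopologicalSpace M] [T2Space M] [ChartedSpace E M]
    [IsManifold 𝓘(ℝ, E) ∞ M] (g : NullConjugacy.LorentzianMetric E M) (o : g.TimeOrientation)
    (Ω : Set M) (t : M → ℝ) (p : M) (hp : p ∈ Ω) (htp : t p = 0)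
    (ht : o.IsTimeFunctionOn t Ω) (Kn KRm Kπ : ℝ) (hKn : 0 < Kn) (hKπ : 0 ≤ Kπ)
    (hlapse : g.LapseBound t Ω Kn) (hRm : o.NullCurvatureBound t Ω p KRm)
    (hπ : g.DeformationBound t Ω Kπ) :
    (KRm ≤ 0 → ∀ (γ : ℝ → M) (b : ℝ), 0 < b → o.IsPastNullGeodesic Ω p γ b →
      ¬ g.IsConjugateAlong γ b) ∧
    (0 < KRm → NullConjugacy.conjugacyTime Kn KRm Kπ < 0 ∧
      (∀ (γ : ℝ → M) (b : ℝ), 0 < b → o.IsPastNullGeodesic Ω p γ b →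
        NullConjugacy.conjugacyTime Kn KRm Kπ < t (γ b) → ¬ g.IsConjugateAlong γ b) ∧
      ENNReal.ofReal |NullConjugacy.conjugacyTime Kn KRm Kπ|
        ≤ NullConjugacy.nullConjugacyRadius o t Ω p) := by
  exact ⟨fun hK γ b hb hγ ↦ hγ.not_isConjugateAlong_of_nonpos ht hKπ hRm hπ hK hb,
    fun hK ↦ ⟨NullConjugacy.conjugacyTime_neg hKn hK,
      fun γ b hb hγ ↦ hγ.not_isConjugateAlong_of_pos ht htp hKn hKπ hlapse hRm hπ hK hb,
      NullConjugacy.ofReal_le_nullConjugacyRadius (NullConjugacy.conjugacyTime_neg hKn hK)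
        fun γ hγ ↦ hγ.not_isConjugateAlong_of_pos ht htp hKn hKπ hlapse hRm hπ hK one_pos⟩⟩
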